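/- **Definitions.** A singular Riemannian foliation of a Riemannian manifold $(M,g)$ is a partition of $M$ into connected immersed smooth submanifolds (the leaves, possibly of varying dimension) such that every vector tangent to a leaf extends to a smooth vector field on $M$ that is tangent to all leaves, and such that every geodesic that is orthogonal to a leaf at one of its points is orthogonal to all leaves it meets. Let $V$ be a (finite-dimensional) Euclidean vector space. For a partition $\mathcal{F}$ of $V$, let $\mathcal{F}_0$ be the partition into the path components of the members ("leaves") of $\mathcal{F}$, let $\mathrm{O}(\mathcal{F})\subset\mathrm{O}(V)$ be the group of linear isometries that send each leaf of $\mathcal{F}$ to itself, and let $\mathrm{O}(V,\mathcal{F}_0)$ be the group of linear isometries that send leaves of $\mathcal{F}_0$ to leaves of $\mathcal{F}_0$. A disconnected infinitesimal foliation of $V$ is a partition $\mathcal{F}$ of $V$ into smooth (immersed, possibly disconnected) submanifolds such that $\mathcal{F}_0$ is a singular Riemannian foliation of $V$ with $\{0\}$ as a leaf, and such that some subgroup $\Gamma\subset\mathrm{O}(V,\mathcal{F}_0)/\mathrm{O}(\mathcal{F}_0)$, acting on the leaf space $V/\mathcal{F}_0$, preserves the set of connected components of each leaf of $\mathcal{F}$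 and is transitive on it. **Proposition (Converse of the Slice Theorem).** Let $L$ be a connected smooth manifold, let $\mathcal{F}$ be a disconnected infinitesimal foliation of a Euclidean vector space $V$, and let $\pi:P\to L$ be a smooth principal $\mathrm{O}(\mathcal{F})$-bundle, where $\mathrm{O}(\mathcal{F})$ carries its structure of a Lie subgroup of $\mathrm{O}(V)$. Let $H\subset\pi_0(\mathrm{O}(\mathcal{F}))$ be the image of the map $\pi_1(L)\to\pi_0(\mathrm{O}(\mathcal{F}))$ induced by $P$ (which, for a base point $p_0\in P$, sends the class of a loop $\gamma$ at $\pi(p_0)$ to the component of $h$, when $\gamma$ lifts to a path in $P$ from $p_0$ to $p_0h$). Assume that $H$ acts transitively on $\pi_0(L')$ for every leaf $L'$ of $\mathcal{F}$. Consider the associated bundle $P\times_{\mathrm{O}(\mathcal{F})}V=(P\times V)/\big((pa,v)\sim(p,av)\big)$, with its smooth manifold structure (for which the quotient map from $P\times V$ is a submersion), and the family $P\times_{\mathrm{O}(\mathcal{F})}\mathcal{F}_0$ of the images in it of the sets $P\times L'$, for $L'$ a leaf of $\mathcal{F}_0$. Then there exists a smooth Riemannian metric on $P\times_{\mathrm{O}(\mathcal{F})}V$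 such that $P\times_{\mathrm{O}(\mathcal{F})}\mathcal{F}_0$ is a singular Riemannian foliation. Moreover, with $L$ identified with the zero section $P\times_{\mathrm{O}(\mathcal{F})}\{0\}$ and given the induced metric, the bundle projection $[p,v]\mapsto\pi(p)$ is the metric projection onto $L$ (it sends each point to the unique nearest point of the zero section), and it is a Riemannian submersion. -/

import Mathlib

open scoped Manifold ContDiff Topology Bundle ENNReal
open Set

noncomputable section

namespace SliceConverse

/-! ### Submanifolds, tangent spaces, geodesics -/

section Manifold

variable {E : Type*} [NormedAddCommGroup E] [NormedSpace ℝ E]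
  {M : Type*} [TopologicalSpace M] [ChartedSpace E M]

/-- The points of a subset `S`, as a type without a preferred topology: an immersed submanifold
carries its own manifold topology, in general finer than the subspace topology. -/
def LeafCarrier (S : Set M) : Type _ := {x : M // x ∈ S}

/-- The inclusion of a subset into the ambient manifold. -/
def LeafCarrier.val {S : Set M} (y : LeafCarrier S) : M := Subtype.val y

/-- The velocity of a curve. -/
def velocity (γ : ℝ → M) (t : ℝ) : TangentSpace 𝓘(ℝ, E) (γ t) :=
  mfderiv 𝓘(ℝ, ℝ) 𝓘(ℝ, E) γ t (1 : ℝ)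

/-- The tangent space at `x` of a subset `S ∋ x`: the span of the velocities at `x` of the smooth
curves of the ambient manifold that stay in `S`. It is only used for immersed submanifolds in the
sense of `IsImmersedStructure`. -/
def tangentSpaceOf (S : Set M) (x : M) : Submodule ℝ (TangentSpace 𝓘(ℝ, E) x) :=
  Submodule.span ℝ {v | ∃ γ : ℝ → M, ContMDiff 𝓘(ℝ, ℝ) 𝓘(ℝ, E) ∞ γ ∧ (∀ t, γ t ∈ S) ∧
    (⟨x, v⟩ : TangentBundle 𝓘(ℝ, E) M) = ⟨γ 0, velocity γ 0⟩}

/-- A Hausdorff, second countable smooth manifold structure of dimension `k` on `S`, for which the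
inclusion in `M` is a smooth injective immersion; the last clause says that the tangent spaces of
the submanifold do not depend on the choice of that structure. -/
structure IsImmersedStructure (S : Set M) (k : ℕ) [TopologicalSpace (LeafCarrier S)]
    [ChartedSpace (EuclideanSpace ℝ (Fin k)) (LeafCarrier S)] : Prop where
  isManifold : IsManifold (𝓡 k) ∞ (LeafCarrier S)
  t2 : T2Space (LeafCarrier S)
  secondCountable : SecondCountableTopology (LeafCarrier S)
  contMDiff_val : ContMDiff (𝓡 k) 𝓘(ℝ, E) ∞ (LeafCarrier.val (S := S))
  injective_mfderiv : ∀ y : LeafCarrier S,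
    Function.Injective (mfderiv (𝓡 k) 𝓘(ℝ, E) (LeafCarrier.val (S := S)) y)
  range_mfderiv : ∀ y : LeafCarrier S,
    (mfderiv (𝓡 k) 𝓘(ℝ, E) (LeafCarrier.val (S := S)) y).range = tangentSpaceOf S y.val

variable (E) in
/-- `S` is a (possibly disconnected) immersed smooth submanifold. -/
def IsImmersedSubmanifold (S : Set M) : Prop :=
  ∃ (k : ℕ) (_ : TopologicalSpace (LeafCarrier S))
    (_ : ChartedSpace (EuclideanSpace ℝ (Fin k)) (LeafCarrier S)),
    IsImmersedStructure (E := E) S k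

variable (E) in
/-- `S` is an immersed smooth submanifold, connected in its manifold topology. -/
def IsConnectedImmersedSubmanifold (S : Set M) : Prop :=
  ∃ (k : ℕ) (_ : TopologicalSpace (LeafCarrier S))
    (_ : ChartedSpace (EuclideanSpace ℝ (Fin k)) (LeafCarrier S)),
    IsImmersedStructure (E := E) S k ∧ ConnectedSpace (LeafCarrier S)

/-- The Riemannian metric `g` in the coordinates given by the preferred chart at `x₀`. -/
def chartMetric (g : Bundle.RiemannianMetric (fun x : M ↦ TangentSpace 𝓘(ℝ, E) x))
    (x₀ : M) (y u w : E) : ℝ :=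
  g.inner ((extChartAt 𝓘(ℝ, E) x₀).symm y)
    (mfderiv 𝓘(ℝ, E) 𝓘(ℝ, E) (extChartAt 𝓘(ℝ, E) x₀).symm y u)
    (mfderiv 𝓘(ℝ, E) 𝓘(ℝ, E) (extChartAt 𝓘(ℝ, E) x₀).symm y w)

/-- `γ` is a geodesic of `g` on the open set `J ⊆ ℝ`: in the local coordinates of every chart of
the atlas, `c = φ ∘ γ` satisfies the geodesic equation, written in its Euler-Lagrange form
`d/dt (g_c(c', w)) = (1/2) (∂_w g)_c(c', c')` for all constant vectors `w`. -/
def IsGeodesicOn (g : Bundle.RiemannianMetric (fun x : M ↦ TangentSpace 𝓘(ℝ, E) x))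
    (γ : ℝ → M) (J : Set ℝ) : Prop :=
  ContMDiffOn 𝓘(ℝ, ℝ) 𝓘(ℝ, E) ∞ γ J ∧
  ∀ x₀ : M, ∀ t ∈ J, γ t ∈ (chartAt E x₀).source → ∀ w : E,
    let c : ℝ → E := fun s ↦ extChartAt 𝓘(ℝ, E) x₀ (γ s)
    deriv (fun s ↦ chartMetric g x₀ (c s) (deriv c s) w) t =
      1 / 2 * fderiv ℝ (fun y ↦ chartMetric g x₀ y (deriv c t) (deriv c t)) (c t) w

/-- The Riemannian distance of `g`: the infimum of the lengths of the `C¹` paths. -/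
def riemannianDist (g : Bundle.RiemannianMetric (fun x : M ↦ TangentSpace 𝓘(ℝ, E) x))
    (x y : M) : ℝ≥0∞ :=
  letI : Bundle.RiemannianBundle (fun x : M ↦ TangentSpace 𝓘(ℝ, E) x) := ⟨g⟩
  Manifold.riemannianEDist 𝓘(ℝ, E) x y

/-! ### Singular Riemannian foliations -/

/-- `X` is a smooth vertical vector field of the partition `𝓕`: it is tangent to all leaves. -/
def IsVertical [IsManifold 𝓘(ℝ, E) ∞ M] (𝓕 : Set (Set M)) (X : ∀ x : M, TangentSpace 𝓘(ℝ, E) x) : Prop :=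
  ContMDiff 𝓘(ℝ, E) 𝓘(ℝ, E).tangent ∞ (fun x ↦ (⟨x, X x⟩ : TangentBundle 𝓘(ℝ, E) M)) ∧
  ∀ S ∈ 𝓕, ∀ x ∈ S, X x ∈ tangentSpaceOf S x

/-- The curve `γ` is orthogonal at time `t` to the leaf of `𝓕` through `γ t`. -/
def IsOrthogonalAt (g : Bundle.RiemannianMetric (fun x : M ↦ TangentSpace 𝓘(ℝ, E) x))
    (𝓕 : Set (Set M)) (γ : ℝ → M) (t : ℝ) : Prop :=
  ∀ S ∈ 𝓕, γ t ∈ S → ∀ w ∈ tangentSpaceOf (E := E) S (γ t), g.inner (γ t) (velocity γ t) w = 0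

/-- `𝓕` (the set of leaves) is a singular Riemannian foliation of the Riemannian manifold
`(M, g)`. -/
structure IsSingularRiemannianFoliation [IsManifold 𝓘(ℝ, E) ∞ M]
    (g : Bundle.RiemannianMetric (fun x : M ↦ TangentSpace 𝓘(ℝ, E) x))
    (𝓕 : Set (Set M)) : Prop where
  isPartition : Setoid.IsPartition 𝓕
  isConnectedImmersedSubmanifold : ∀ S ∈ 𝓕, IsConnectedImmersedSubmanifold E S
  exists_vertical : ∀ S ∈ 𝓕, ∀ x ∈ S, ∀ v ∈ tangentSpaceOf (E := E) S x,
    ∃ X : ∀ x : M, TangentSpace 𝓘(ℝ, E) x, IsVertical 𝓕 X ∧ X x = v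
  orthogonal : ∀ (γ : ℝ → M) (J : Set ℝ), IsOpen J → J.OrdConnected → IsGeodesicOn g γ J →
    (∃ t ∈ J, IsOrthogonalAt g 𝓕 γ t) → ∀ t ∈ J, IsOrthogonalAt g 𝓕 γ t

end Manifold

/-- The smooth map `f : (M, g) → (N, h)` is a Riemannian submersion: its differential is onto and
isometric on the orthogonal complement of its kernel. -/
structure IsRiemannianSubmersion
    {E : Type*} [NormedAddCommGroup E] [NormedSpace ℝ E]
    {M : Type*} [TopologicalSpace M] [ChartedSpace E M]
    {E' : Type*} [NormedAddCommGroup E'] [NormedSpace ℝ E']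
    {N : Type*} [TopologicalSpace N] [ChartedSpace E' N]
    (g : Bundle.RiemannianMetric (fun x : M ↦ TangentSpace 𝓘(ℝ, E) x))
    (h : Bundle.RiemannianMetric (fun x : N ↦ TangentSpace 𝓘(ℝ, E') x))
    (f : M → N) : Prop where
  contMDiff : ContMDiff 𝓘(ℝ, E) 𝓘(ℝ, E') ∞ f
  surjective : ∀ x, Function.Surjective (mfderiv 𝓘(ℝ, E) 𝓘(ℝ, E') f x)
  isometric : ∀ (x : M) (u w : TangentSpace 𝓘(ℝ, E) x),
    (∀ z : TangentSpace 𝓘(ℝ, E) x, mfderiv 𝓘(ℝ, E) 𝓘(ℝ, E') f x z = 0 → g.inner x u z = 0) →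
    (∀ z : TangentSpace 𝓘(ℝ, E) x, mfderiv 𝓘(ℝ, E) 𝓘(ℝ, E') f x z = 0 → g.inner x w z = 0) →
    h.inner (f x) (mfderiv 𝓘(ℝ, E) 𝓘(ℝ, E') f x u) (mfderiv 𝓘(ℝ, E) 𝓘(ℝ, E') f x w)
      = g.inner x u w

/-! ### Disconnected infinitesimal foliations -/

section Infinitesimal

variable {V : Type*} [NormedAddCommGroup V] [InnerProductSpace ℝ V]

/-- The partition `𝓕₀` into the path components of the leaves of `𝓕`. -/
def connectedLeaves (𝓕 : Set (Set V)) : Set (Set V) :=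
  {C | ∃ S ∈ 𝓕, ∃ x ∈ S, C = pathComponentIn S x}

/-- `O(V, 𝓕)`: the linear isometries of `V` that send leaves to (possibly different) leaves. -/
def foliatedIsometries (𝓕 : Set (Set V)) : Subgroup (V ≃ₗᵢ[ℝ] V) where
  carrier := {g | ∀ S : Set V, g '' S ∈ 𝓕 ↔ S ∈ 𝓕}
  one_mem' := fun S ↦ by simp
  mul_mem' := by
    intro a b ha hb S
    have h : (⇑(a * b) : V → V) '' S = a '' (b '' S) := by
      rw [image_image]; rfl
    rw [h, ha, hb]
  inv_mem' := by
    intro a ha S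
    have h : a '' ((⇑a⁻¹ : V → V) '' S) = S := by
      rw [image_image]
      simp
    rw [← ha, h]

/-- `O(𝓕)`: the linear isometries of `V` that send each leaf of `𝓕` to itself. -/
def leafIsometries (𝓕 : Set (Set V)) : Subgroup (V ≃ₗᵢ[ℝ] V) where
  carrier := {g | ∀ S ∈ 𝓕, g '' S = S}
  one_mem' := fun S _ ↦ by simp
  mul_mem' := by
    intro a b ha hb S hS
    have h : (⇑(a * b) : V → V) '' S = a '' (b '' S) := by
      rw [image_image]; rfl
    rw [h, hb S hS, ha S hS]
  inv_mem' := by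
    intro a ha S hS
    have h : (⇑a⁻¹ : V → V) '' (a '' S) = S := by
      rw [image_image]
      simp
    rw [ha S hS] at h
    exact h

/-- `O(𝓕)` is a normal subgroup of `O(V, 𝓕)`. -/
instance normal_leafIsometries (𝓕 : Set (Set V)) :
    ((leafIsometries 𝓕).subgroupOf (foliatedIsometries 𝓕)).Normal where
  conj_mem := by
    intro n hn g
    rw [Subgroup.mem_subgroupOf] at hn ⊢
    intro S hS
    have hg := (g⁻¹).2
    have h1 : ((g⁻¹ : foliatedIsometries 𝓕) : V ≃ₗᵢ[ℝ] V) '' S ∈ 𝓕 := (hg S).2 hS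
    have h2 := hn _ h1
    have h3 : (⇑((g * n * g⁻¹ : foliatedIsometries 𝓕) : V ≃ₗᵢ[ℝ] V) : V → V) '' S =
        (g : V ≃ₗᵢ[ℝ] V) '' ((n : V ≃ₗᵢ[ℝ] V) '' (((g⁻¹ : foliatedIsometries 𝓕) :
          V ≃ₗᵢ[ℝ] V) '' S)) := by
      rw [image_image, image_image]; rfl
    rw [h3, h2, image_image]
    simp

/-- `𝓕` is a disconnected infinitesimal foliation of the Euclidean space `V`. In `transitive`, the
group `Γ` acts on the leaf space of `𝓕₀` by letting the class of `g` send a leaf `C` to `g '' C`;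
the components of a leaf of `𝓕` are the leaves of `𝓕₀` that it contains. -/
structure IsDisconnectedInfinitesimalFoliation (𝓕 : Set (Set V)) : Prop where
  isPartition : Setoid.IsPartition 𝓕
  isImmersedSubmanifold : ∀ S ∈ 𝓕, IsImmersedSubmanifold V S
  foliation : IsSingularRiemannianFoliation
    (riemannianMetricVectorSpace V).toRiemannianMetric (connectedLeaves 𝓕)
  zero_mem : {(0 : V)} ∈ connectedLeaves 𝓕
  transitive : ∃ Γ : Subgroup (foliatedIsometries (connectedLeaves 𝓕) ⧸
      (leafIsometries (connectedLeaves 𝓕)).subgroupOf (foliatedIsometries (connectedLeaves 𝓕))),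
    ∀ S ∈ 𝓕, ∀ C ∈ connectedLeaves 𝓕, C ⊆ S → ∀ C' ∈ connectedLeaves 𝓕,
      (C' ⊆ S ↔ ∃ g : foliatedIsometries (connectedLeaves 𝓕),
        (QuotientGroup.mk g) ∈ Γ ∧ (g : V ≃ₗᵢ[ℝ] V) '' C = C')

/-- The given Lie group structure on the subgroup `G` of `O(V)` is that of a Lie subgroup: the
inclusion is smooth, and a curve in `G` is continuous if it is continuous as a curve of linear maps.
These properties determine the structure. If `G` is closed, it is the usual one, with the subspace
topology; if `G` is not closed, its topology is finer. -/
structure IsLieSubgroupStructure (G : Subgroup (V ≃ₗᵢ[ℝ] V))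
    {EG : Type*} [NormedAddCommGroup EG] [NormedSpace ℝ EG]
    [TopologicalSpace G] [ChartedSpace EG G] : Prop where
  lieGroup : LieGroup 𝓘(ℝ, EG) ∞ G
  contMDiff_coe : ContMDiff 𝓘(ℝ, EG) 𝓘(ℝ, V →L[ℝ] V) ∞
    (fun g : G ↦ ((g : V ≃ₗᵢ[ℝ] V) : V →L[ℝ] V))
  continuous_curve : ∀ c : ℝ → G,
    Continuous (fun t ↦ ((c t : V ≃ₗᵢ[ℝ] V) : V →L[ℝ] V)) → Continuous c

end Infinitesimal

/-! ### Principal bundles and associated bundles -/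

/-- `proj : P → L` is a smooth principal `G`-bundle, for the given right action of `G` on `P`. -/
structure IsPrincipalBundle
    {EL : Type*} [NormedAddCommGroup EL] [NormedSpace ℝ EL]
    {L : Type*} [TopologicalSpace L] [ChartedSpace EL L]
    {EP : Type*} [NormedAddCommGroup EP] [NormedSpace ℝ EP]
    {P : Type*} [TopologicalSpace P] [ChartedSpace EP P]
    (EG : Type*) [NormedAddCommGroup EG] [NormedSpace ℝ EG]
    (G : Type*) [Group G] [TopologicalSpace G] [ChartedSpace EG G]
    [MulAction (MulOpposite G) P] (proj : P → L) : Prop where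
  contMDiff_proj : ContMDiff 𝓘(ℝ, EP) 𝓘(ℝ, EL) ∞ proj
  contMDiff_action : ContMDiff (𝓘(ℝ, EP).prod 𝓘(ℝ, EG)) 𝓘(ℝ, EP) ∞
    (fun x : P × G ↦ MulOpposite.op x.2 • x.1)
  proj_action : ∀ (p : P) (g : G), proj (MulOpposite.op g • p) = proj p
  exists_trivialization : ∀ x : L, ∃ U : Set L, IsOpen U ∧ x ∈ U ∧
    ∃ e : PartialDiffeomorph 𝓘(ℝ, EP) (𝓘(ℝ, EL).prod 𝓘(ℝ, EG)) P (L × G) ∞,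
      e.source = proj ⁻¹' U ∧ e.target = U ×ˢ univ ∧
      (∀ p ∈ e.source, (e p).1 = proj p) ∧
      ∀ p ∈ e.source, ∀ g : G, (e (MulOpposite.op g • p)).2 = (e p).2 * g

section Associated

variable {V : Type*} [NormedAddCommGroup V] [InnerProductSpace ℝ V]
  (G : Subgroup (V ≃ₗᵢ[ℝ] V)) (P : Type*) [MulAction (MulOpposite G) P]

/-- The equivalence relation `(p · g, v) ∼ (p, g v)` on `P × V`. -/
def assocSetoid : Setoid (P × V) where
  r a b := ∃ g : G, b.1 = MulOpposite.op g • a.1 ∧ a.2 = (g : V ≃ₗᵢ[ℝ] V) b.2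
  iseqv :=
    { refl := fun a ↦ ⟨1, by simp, by simp⟩
      symm := by
        rintro a b ⟨g, h1, h2⟩
        refine ⟨g⁻¹, ?_, ?_⟩
        · rw [h1, MulOpposite.op_inv, inv_smul_smul]
        · rw [h2]
          exact ((g : V ≃ₗᵢ[ℝ] V).symm_apply_apply b.2).symm
      trans := by
        rintro a b c ⟨g, h1, h2⟩ ⟨k, h3, h4⟩
        refine ⟨g * k, ?_, ?_⟩
        · rw [h3, h1, MulOpposite.op_mul, mul_smul]
        · rw [h2, h4]; rfl }

/-- The associated bundle `P ×_G V`, the quotient of `P × V` by the action of `G ⊆ O(V)`. -/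
def AssocBundle : Type _ := Quotient (assocSetoid G P)

variable {P}

/-- The class `[p, v]` of `(p, v)` in `P ×_G V`. -/
def AssocBundle.mk (a : P × V) : AssocBundle G P := Quotient.mk (assocSetoid G P) a

instance [TopologicalSpace P] : TopologicalSpace (AssocBundle G P) :=
  inferInstanceAs (TopologicalSpace (Quotient (assocSetoid G P)))

variable {G} in
/-- The projection `[p, v] ↦ proj p` of the associated bundle. -/
def AssocBundle.proj {L : Type*} (proj : P → L)
    (hproj : ∀ (p : P) (g : G), proj (MulOpposite.op g • p) = proj p) : AssocBundle G P → L :=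
  Quotient.lift (fun a : P × V ↦ proj a.1) (by
    rintro a b ⟨g, h1, _⟩
    show proj a.1 = proj b.1
    rw [h1, hproj])

/-- `P ×_G 𝓕₀`: the images in `P ×_G V` of the sets `P × C`, for `C` a leaf of `𝓕₀`. -/
def assocFoliation (𝓕₀ : Set (Set V)) : Set (Set (AssocBundle G P)) :=
  {D | ∃ C ∈ 𝓕₀, D = AssocBundle.mk G '' ((univ : Set P) ×ˢ C)}

variable {L : Type*} [TopologicalSpace L] [TopologicalSpace P] [TopologicalSpace G]

variable {G} in
/-- The image `H` of the map `α : π₁(L, proj p₀) → π₀(G)` induced by the principal bundle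
`proj : P → L`: the class of a loop `γ` is sent to the component of `g`, if `γ` has a lift to `P`
that starts at `p₀` and ends at `p₀ · g`. -/
def monodromyImage (proj : P → L) (p₀ : P) : Set (ZerothHomotopy G) :=
  {c | ∃ (γ : Path (proj p₀) (proj p₀)) (g : G) (γ' : Path p₀ (MulOpposite.op g • p₀)),
    (∀ t, proj (γ' t) = γ t) ∧ c = Quotient.mk (pathSetoid G) g}

end Associated

end SliceConverse

end

/-!
The associated bundle `B = P ×_G V`, with `G = O(𝓕)`, has local trivializations whose transition
functions take values in `G` (`BundleAtlas`). As `G` preserves every leaf `S` of `𝓕`, the points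
whose fibre coordinate lies in `S` form a well-defined set `BundleAtlas.leaf S`, the bundle with
fibre `S` associated to `P`. The family `P ×_G 𝓕₀` is exactly the family of these sets
(`assocFoliation_eq`), and they are path connected (`isPathConnected_leaf`): both facts hold
because the monodromy group is transitive on the components of `S`, so that one moves from one
component to another along a loop of the base.

The sets `leaf S` are immersed submanifolds, locally products of an open set of the base with `S`.
For their transition functions to be smooth, a smooth map to `V` with values in `S` has to be
smooth as a map to the manifold `S`. This is true for leaves of infinitesimal foliations
(`continuousAt_of_continuousAt_val`): a segment from a nearby point of `S` to a nearest point of a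
plaque of `S` is orthogonal to `S` at its foot, hence at its other end as well. Therefore the
distance to the plaque is locally constant on the part of `S` near the plaque, in the manifold
topology. It takes only countably many values there, so it is constant on connected sets for the
topology of `V`, and such a set lies in the plaque as soon as it meets it.

Each local trivialization carries a flat connection. It is isometric and tangent to the leaves, as
the transition functions take values in `G`. These two properties are preserved by averages with a
partition of unity, and so there is a global connection that has them, over a base with a
Riemannian metric (`BundleGeometry`, `exists_bundleGeometry`). The metric of `B` is the one that
makes horizontal and vertical spaces orthogonal and restricts to the metric of the base on the
former and to that of `V` on the latter (`totalForm`). The projection is then a Riemannian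
submersion. The horizontal spaces are tangent to the leaves, and the tangent space of a leaf is the
sum of the horizontal space and the tangent space of `S` in the fibre.

The vertical part of the Euler-Lagrange equations determines the derivative of the vertical
velocity of a geodesic by means of the connection form (`inner_deriv_vert`), and as that form is
skew-symmetric the length of the vertical velocity is constant. The energy is also constant, and
then so is the length of the horizontal velocity (`hasDerivAt_form`). A geodesic that is orthogonal
to a leaf at one point has no horizontal velocity there. It follows that it has none at all, that
it stays in one fibre, and that it is a straight line of that fibre. The claim on orthogonality is
thereby reduced to the corresponding property of the foliation of `V`
(`isOrthogonalAt_of_isGeodesicOn`).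

The radius `r` of the fibres is constant along horizontal curves, as the connection is isometric,
and the ray from `b` to the zero section has length `r b`. For a function `ψ` on the base whose
differential has norm at most one and for `α ^ 2 + β ^ 2 = 1`, the differential of
`β * ψ - α * √(r ^ 2 + ε ^ 2)` has norm at most one, since the two terms are sensitive to
orthogonal directions. Its increments are hence bounded by the distance
(`ofReal_le_riemannianDist`). With a bump function `ψ` that is positive at `x` and zero at the
projection of `b`, and suitable `α`, `β` and `ε`, this shows that the zero of the fibre over `x`
is further from `b` than `r b` (`riemannianDist_zeroSection_lt`).
-/

noncomputable section

namespace SliceConverse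

/-! ### Coordinate expressions of metrics and vector fields -/

section ChartCalculus

variable {E : Type*} [NormedAddCommGroup E] [NormedSpace ℝ E]
  {M : Type*} [TopologicalSpace M] [ChartedSpace E M]

theorem mfderiv_extChartAt_symm_eq [IsManifold 𝓘(ℝ, E) ∞ M] (x : M) {y : E}
    (hy : y ∈ (extChartAt 𝓘(ℝ, E) x).target) :
    (mfderiv 𝓘(ℝ, E) 𝓘(ℝ, E) (extChartAt 𝓘(ℝ, E) x).symm y : E →L[ℝ] E) =
      fderiv ℝ (extChartAt 𝓘(ℝ, E) ((extChartAt 𝓘(ℝ, E) x).symm y) ∘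
        (extChartAt 𝓘(ℝ, E) x).symm) y := by
  have h : MDifferentiableAt 𝓘(ℝ, E) 𝓘(ℝ, E) (extChartAt 𝓘(ℝ, E) x).symm y :=
    ((contMDiffOn_extChartAt_symm (n := ∞) x).contMDiffAt
      ((isOpen_extChartAt_target x).mem_nhds hy)).mdifferentiableAt (by simp)
  refine h.mfderiv.trans ?_
  simp only [writtenInExtChartAt, mfld_simps, fderivWithin_univ]
  rfl

/-- Tangent vectors of `M` at `x` are vectors of the model space `E`, read in the preferred chart at
`x`; for the velocity of a curve that chart has to be frozen at the point of contact. -/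
theorem mfderiv_curve_eq {γ : ℝ → M} {t : ℝ} (h : MDifferentiableAt 𝓘(ℝ, ℝ) 𝓘(ℝ, E) γ t) :
    (mfderiv 𝓘(ℝ, ℝ) 𝓘(ℝ, E) γ t (1 : ℝ) : E) =
      deriv (fun s ↦ extChartAt 𝓘(ℝ, E) (γ t) (γ s)) t := by
  refine (DFunLike.congr_fun h.mfderiv (1 : ℝ)).trans ?_
  simp only [writtenInExtChartAt, mfld_simps, fderivWithin_univ]
  exact fderiv_apply_one_eq_deriv (F := E)

theorem contMDiffAt_extChartAt_symm [IsManifold 𝓘(ℝ, E) ∞ M] (x : M) {y : E}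
    (hy : y ∈ (extChartAt 𝓘(ℝ, E) x).target) :
    ContMDiffAt 𝓘(ℝ, E) 𝓘(ℝ, E) ∞ (extChartAt 𝓘(ℝ, E) x).symm y :=
  (contMDiffOn_extChartAt_symm (n := ∞) x).contMDiffAt ((isOpen_extChartAt_target x).mem_nhds hy)

theorem contDiffAt_coordChange [IsManifold 𝓘(ℝ, E) ∞ M] (x x' : M) {y : E}
    (hy : y ∈ (extChartAt 𝓘(ℝ, E) x).target)
    (hy' : (extChartAt 𝓘(ℝ, E) x).symm y ∈ (extChartAt 𝓘(ℝ, E) x').source) :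
    ContDiffAt ℝ ∞ (extChartAt 𝓘(ℝ, E) x' ∘ (extChartAt 𝓘(ℝ, E) x).symm) y := by
  rw [← contMDiffAt_iff_contDiffAt]
  exact (contMDiffAt_extChartAt' (by simpa using hy')).comp y (contMDiffAt_extChartAt_symm x hy)

/-- A positive form on a finite-dimensional space is bounded below by its minimum on the unit
sphere. -/
theorem isVonNBounded_of_pos [FiniteDimensional ℝ E] (q : E →L[ℝ] E →L[ℝ] ℝ)
    (pos : ∀ u, u ≠ 0 → 0 < q u u) : Bornology.IsVonNBounded ℝ {u : E | q u u < 1} := by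
  rw [NormedSpace.isVonNBounded_iff]
  rcases subsingleton_or_nontrivial E with hE | hE
  · exact (Set.toFinite _).isBounded
  have hc : Continuous fun u : E ↦ q u u := by fun_prop
  obtain ⟨u₀, hu₀, hmin⟩ := (isCompact_sphere (0 : E) 1).exists_isMinOn
    (NormedSpace.sphere_nonempty.2 zero_le_one) hc.continuousOn
  have hm : 0 < q u₀ u₀ := pos u₀ (by
    rintro rfl
    simp at hu₀)
  refine (Metric.isBounded_ball (x := (0 : E)) (r := Real.sqrt (1 / q u₀ u₀))).subset ?_
  intro u hu
  rw [mem_ball_zero_iff]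
  apply Real.lt_sqrt_of_sq_lt
  rw [lt_div_iff₀ hm]
  rcases eq_or_ne u 0 with rfl | h0
  · simp
  have hn : 0 < ‖u‖ := norm_pos_iff.2 h0
  have h1 := hmin (show ‖u‖⁻¹ • u ∈ Metric.sphere (0 : E) 1 by simp [norm_smul, hn.ne'])
  simp only [mem_ofPred_eq, map_smul, smul_apply, smul_eq_mul] at h1 hu
  calc ‖u‖ ^ 2 * q u₀ u₀ ≤ ‖u‖ ^ 2 * (‖u‖⁻¹ * (‖u‖⁻¹ * q u u)) := by gcongr
    _ = q u u := by field_simp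
    _ < 1 := hu

/-- A smooth family of positive definite symmetric bilinear forms in each of the preferred charts,
compatible with the changes of charts, defines a smooth Riemannian metric. -/
theorem exists_metric_of_charts [FiniteDimensional ℝ E] [IsManifold 𝓘(ℝ, E) ∞ M]
    (h : M → E → E →L[ℝ] E →L[ℝ] ℝ)
    (symm : ∀ x, ∀ y ∈ (extChartAt 𝓘(ℝ, E) x).target, ∀ u w, h x y u w = h x y w u)
    (pos : ∀ x, ∀ y ∈ (extChartAt 𝓘(ℝ, E) x).target, ∀ u, u ≠ 0 → 0 < h x y u u)
    (smooth : ∀ x, ContDiffOn ℝ ∞ (h x) (extChartAt 𝓘(ℝ, E) x).target)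
    (compat : ∀ x x', ∀ y ∈ (extChartAt 𝓘(ℝ, E) x).target,
      (extChartAt 𝓘(ℝ, E) x).symm y ∈ (extChartAt 𝓘(ℝ, E) x').source → ∀ u w,
        h x' (extChartAt 𝓘(ℝ, E) x' ((extChartAt 𝓘(ℝ, E) x).symm y))
          (fderiv ℝ (extChartAt 𝓘(ℝ, E) x' ∘ (extChartAt 𝓘(ℝ, E) x).symm) y u)
          (fderiv ℝ (extChartAt 𝓘(ℝ, E) x' ∘ (extChartAt 𝓘(ℝ, E) x).symm) y w) = h x y u w) :
    ∃ g : Bundle.ContMDiffRiemannianMetric 𝓘(ℝ, E) ∞ E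
        (fun x : M ↦ TangentSpace 𝓘(ℝ, E) x),
      (∀ (b : M) (u w : E), g.inner b u w = h b (extChartAt 𝓘(ℝ, E) b b) u w) ∧
      ∀ (x : M), ∀ y ∈ (extChartAt 𝓘(ℝ, E) x).target, ∀ u w : E,
        chartMetric g.toRiemannianMetric x y u w = h x y u w := by
  have key : ∀ (x : M), ∀ y ∈ (extChartAt 𝓘(ℝ, E) x).target, ∀ u w : E,
      h ((extChartAt 𝓘(ℝ, E) x).symm y)
        (extChartAt 𝓘(ℝ, E) ((extChartAt 𝓘(ℝ, E) x).symm y) ((extChartAt 𝓘(ℝ, E) x).symm y))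
        (mfderiv 𝓘(ℝ, E) 𝓘(ℝ, E) (extChartAt 𝓘(ℝ, E) x).symm y u : E)
        (mfderiv 𝓘(ℝ, E) 𝓘(ℝ, E) (extChartAt 𝓘(ℝ, E) x).symm y w : E) = h x y u w := by
    intro x y hy u w
    rw [mfderiv_extChartAt_symm_eq x hy]
    exact compat _ _ _ hy (mem_extChartAt_source _) u w
  let g : Bundle.ContMDiffRiemannianMetric 𝓘(ℝ, E) ∞ E
      (fun x : M ↦ TangentSpace 𝓘(ℝ, E) x) :=
    { inner := fun b ↦ h b (extChartAt 𝓘(ℝ, E) b b)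
      symm := fun b u w ↦ symm b _ (mem_extChartAt_target b) u w
      pos := fun b u hu ↦ pos b _ (mem_extChartAt_target b) u hu
      isVonNBounded := by
        intro b
        exact isVonNBounded_of_pos (h b (extChartAt 𝓘(ℝ, E) b b))
          (fun u hu ↦ pos b _ (mem_extChartAt_target b) u hu)
      contMDiff := by
        intro x₀
        rw [contMDiffAt_hom_bundle]
        refine ⟨contMDiffAt_id, ?_⟩
        have h1 : ContMDiffAt 𝓘(ℝ, E) 𝓘(ℝ, E →L[ℝ] E →L[ℝ] ℝ) ∞
            (fun b ↦ h x₀ (extChartAt 𝓘(ℝ, E) x₀ b)) x₀ := by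
          refine ContMDiffAt.comp x₀ (g := h x₀) ?_ (contMDiffAt_extChartAt)
          rw [contMDiffAt_iff_contDiffAt]
          exact (smooth x₀).contDiffAt (extChartAt_target_mem_nhds x₀)
        refine h1.congr_of_eventuallyEq ?_
        filter_upwards [chart_source_mem_nhds E x₀] with b hb
        have hb' : b ∈ (extChartAt 𝓘(ℝ, E) x₀).source := by simpa using hb
        have k := key x₀ (extChartAt 𝓘(ℝ, E) x₀ b) ((extChartAt 𝓘(ℝ, E) x₀).map_source hb')
        rw [(extChartAt 𝓘(ℝ, E) x₀).left_inv hb'] at k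
        ext u w
        rw [← k]
        have hs := TangentBundle.symmL_trivializationAt (I := 𝓘(ℝ, E)) hb
        rw [modelWithCornersSelf_coe, range_id, mfderivWithin_univ] at hs
        have hu : ∀ u : E, (trivializationAt E (TangentSpace 𝓘(ℝ, E)) x₀).symm b u =
            mfderiv 𝓘(ℝ, E) 𝓘(ℝ, E) (extChartAt 𝓘(ℝ, E) x₀).symm (extChartAt 𝓘(ℝ, E) x₀ b) u :=
          fun u ↦ by
            rw [← hs]
            exact (Bundle.Trivialization.symmL_apply _ (by simpa using hb) u).symm
        refine (inCoordinates_apply_eq₂ (E₃ := fun _ ↦ ℝ) (F₃ := ℝ) (E₁ := TangentSpace 𝓘(ℝ, E))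
          (E₂ := TangentSpace 𝓘(ℝ, E)) (by simpa using hb) (by simpa using hb)
          (by simp)).trans ?_
        rw [hu, hu]
        simp
        rfl }
  exact ⟨g, fun b u w ↦ rfl, fun x y hy u w ↦ key x y hy u w⟩

/-- In the coordinates of the preferred charts, the inverse of the trivialization of the tangent
bundle is the derivative of the coordinate change. -/
theorem trivializationAt_symm_eq [IsManifold 𝓘(ℝ, E) ∞ M] {x b : M}
    (hb : b ∈ (extChartAt 𝓘(ℝ, E) x).source) (u : E) :
    ((trivializationAt E (TangentSpace 𝓘(ℝ, E)) x).symm b u : E) =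
      fderiv ℝ (extChartAt 𝓘(ℝ, E) b ∘ (extChartAt 𝓘(ℝ, E) x).symm)
        (extChartAt 𝓘(ℝ, E) x b) u := by
  have hb' : b ∈ (chartAt E x).source := by simpa using hb
  have hs := TangentBundle.symmL_trivializationAt (I := 𝓘(ℝ, E)) hb'
  rw [modelWithCornersSelf_coe, range_id, mfderivWithin_univ] at hs
  have h1 := mfderiv_extChartAt_symm_eq x ((extChartAt 𝓘(ℝ, E) x).map_source hb)
  have h2 : (trivializationAt E (TangentSpace 𝓘(ℝ, E)) x).symm b u =
      (trivializationAt E (TangentSpace 𝓘(ℝ, E)) x).symmL ℝ b u :=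
    (Bundle.Trivialization.symmL_apply _ (by simpa using hb) u).symm
  rw [h2, hs]
  refine (DFunLike.congr_fun h1 u).trans ?_
  rw [(extChartAt 𝓘(ℝ, E) x).left_inv hb]
  rfl

/-- A vector field given in a chart, multiplied by a cutoff function supported in the domain of the
chart, is smooth. -/
theorem contMDiff_cutoff_vectorField [IsManifold 𝓘(ℝ, E) ∞ M] (x : M) {ρ : M → ℝ}
    (hρ : ContMDiff 𝓘(ℝ, E) 𝓘(ℝ, ℝ) ∞ ρ) (hs : tsupport ρ ⊆ (extChartAt 𝓘(ℝ, E) x).source)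
    {W : E → E} (hW : ContDiff ℝ ∞ W) :
    ContMDiff 𝓘(ℝ, E) 𝓘(ℝ, E).tangent ∞ (fun b ↦ (⟨b, ρ b •
      (trivializationAt E (TangentSpace 𝓘(ℝ, E)) x).symm b (W (extChartAt 𝓘(ℝ, E) x b))⟩ :
        TangentBundle 𝓘(ℝ, E) M)) := by
  intro b
  by_cases hb : b ∈ (extChartAt 𝓘(ℝ, E) x).source
  · have hb' : b ∈ (trivializationAt E (TangentSpace 𝓘(ℝ, E)) x).baseSet := by simpa using hb
    refine ((trivializationAt E (TangentSpace 𝓘(ℝ, E)) x).contMDiffAt_section_iff hb').2 ?_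
    have h1 : ContMDiffAt 𝓘(ℝ, E) 𝓘(ℝ, E) ∞ (fun b ↦ ρ b • W (extChartAt 𝓘(ℝ, E) x b)) b :=
      hρ.contMDiffAt.smul (hW.contMDiff.contMDiffAt.comp b
        (contMDiffAt_extChartAt' (by simpa using hb)))
    refine h1.congr_of_eventuallyEq ?_
    filter_upwards [(trivializationAt E (TangentSpace 𝓘(ℝ, E)) x).open_baseSet.mem_nhds hb']
      with b' hb''
    have h2 := (trivializationAt E (TangentSpace 𝓘(ℝ, E)) x).apply_mk_symm hb''
      (W (extChartAt 𝓘(ℝ, E) x b'))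
    have h3 := ((trivializationAt E (TangentSpace 𝓘(ℝ, E)) x).linear ℝ hb'').map_smul (ρ b')
      ((trivializationAt E (TangentSpace 𝓘(ℝ, E)) x).symm b' (W (extChartAt 𝓘(ℝ, E) x b')))
    refine h3.trans ?_
    rw [h2]
  · have hz : ρ =ᶠ[𝓝 b] 0 := notMem_tsupport_iff_eventuallyEq.1 fun h ↦ hb (hs h)
    have h0 : ContMDiffAt 𝓘(ℝ, E) 𝓘(ℝ, E).tangent ∞
        (fun b : M ↦ (⟨b, 0⟩ : TangentBundle 𝓘(ℝ, E) M)) b :=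
      Bundle.contMDiff_zeroSection ℝ (TangentSpace 𝓘(ℝ, E)) b
    refine h0.congr_of_eventuallyEq ?_
    filter_upwards [hz] with b' hb'
    simp [hb']

/-! ### Tangent vectors of curves in a subset -/

/-- The space `tangentSpaceOf S` is spanned by velocities of curves defined on all of `ℝ`; a curve
on an interval around `0` does as well, after a reparametrization. -/
theorem mfderiv_mem_tangentSpaceOf {S : Set M} {γ : ℝ → M} {ε : ℝ} (hε : 0 < ε)
    (hγ : ContMDiffOn 𝓘(ℝ, ℝ) 𝓘(ℝ, E) ∞ γ (Ioo (-ε) ε)) (hS : ∀ t ∈ Ioo (-ε) ε, γ t ∈ S) :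
    (mfderiv 𝓘(ℝ, ℝ) 𝓘(ℝ, E) γ 0 (1 : ℝ)) ∈ tangentSpaceOf S (γ 0) := by
  -- a reparametrization of all of `ℝ` into the interval, with value `0` and derivative `1` at `0`
  let θ : ℝ → ℝ := fun t ↦ ε / 2 * Real.sin (t / (ε / 2))
  have hθ : ContDiff ℝ ∞ θ := by fun_prop
  have hθ0 : θ 0 = 0 := by simp [θ]
  have hmem : ∀ t, θ t ∈ Ioo (-ε) ε := by
    intro t
    have h1 := Real.sin_le_one (t / (ε / 2))
    have h2 := Real.neg_one_le_sin (t / (ε / 2))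
    constructor <;> simp only [θ] <;> nlinarith
  have hd : HasDerivAt θ 1 0 := by
    have := ((hasDerivAt_id (0 : ℝ)).div_const (ε / 2)).sin.const_mul (ε / 2)
    convert! this using 1
    simp
    field_simp
  refine Submodule.subset_span ⟨γ ∘ θ, ?_, fun t ↦ hS _ (hmem t), ?_⟩
  · exact hγ.comp_contMDiff hθ.contMDiff hmem
  · have hs : ∀ s : ℝ, s = 0 → (⟨γ 0, mfderiv 𝓘(ℝ, ℝ) 𝓘(ℝ, E) γ 0 (1 : ℝ)⟩ :
        TangentBundle 𝓘(ℝ, E) M) = ⟨γ s, mfderiv 𝓘(ℝ, ℝ) 𝓘(ℝ, E) γ s (1 : ℝ)⟩ := by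
      rintro _ rfl; rfl
    rw [hs _ hθ0]
    have hγd : MDifferentiableAt 𝓘(ℝ, ℝ) 𝓘(ℝ, E) γ (θ 0) :=
      (hγ.contMDiffAt (isOpen_Ioo.mem_nhds (hmem 0))).mdifferentiableAt (by simp)
    have h1 : velocity (E := E) (γ ∘ θ) 0 = mfderiv 𝓘(ℝ, ℝ) 𝓘(ℝ, E) γ (θ 0) (1 : ℝ) := by
      unfold velocity
      rw [mfderiv_comp (I' := 𝓘(ℝ, ℝ)) (0 : ℝ) hγd
        (hθ.contMDiff.mdifferentiable (by simp) 0)]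
      refine congrArg (mfderiv 𝓘(ℝ, ℝ) 𝓘(ℝ, E) γ (θ 0)) ?_
      rw [mfderiv_eq_fderiv]
      exact (fderiv_apply_one_eq_deriv (𝕜 := ℝ) (F := ℝ) (f := θ)).trans hd.deriv
    rw [h1]
    rfl

theorem mem_tangentSpaceOf_of_curve {S : Set M} {x : M} {γ : ℝ → M} {ε : ℝ} (hε : 0 < ε)
    (hγ : ContMDiffOn 𝓘(ℝ, ℝ) 𝓘(ℝ, E) ∞ γ (Ioo (-ε) ε)) (hS : ∀ t ∈ Ioo (-ε) ε, γ t ∈ S)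
    (hx : γ 0 = x) {w : E} (hw : HasDerivAt (fun s ↦ extChartAt 𝓘(ℝ, E) x (γ s)) w 0) :
    (w : TangentSpace 𝓘(ℝ, E) x) ∈ tangentSpaceOf S x := by
  subst hx
  have h := mfderiv_mem_tangentSpaceOf hε hγ hS
  have h0 : MDifferentiableAt 𝓘(ℝ, ℝ) 𝓘(ℝ, E) γ 0 :=
    (hγ.contMDiffAt (Ioo_mem_nhds (by linarith) hε)).mdifferentiableAt (by simp)
  have h1 := mfderiv_curve_eq h0
  rw [hw.deriv] at h1
  rw [← h1]
  exact h

/-- To bound the tangent space of `S` from above it suffices to bound the coordinate velocities of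
the smooth curves in `S`. -/
theorem tangentSpaceOf_le {S : Set M} {x : M} (T : Submodule ℝ E)
    (h : ∀ γ : ℝ → M, ContMDiff 𝓘(ℝ, ℝ) 𝓘(ℝ, E) ∞ γ → (∀ t, γ t ∈ S) → γ 0 = x →
      deriv (fun s ↦ extChartAt 𝓘(ℝ, E) x (γ s)) 0 ∈ T)
    {w : E} (hw : (w : TangentSpace 𝓘(ℝ, E) x) ∈ tangentSpaceOf S x) : w ∈ T := by
  have : tangentSpaceOf (E := E) S x ≤ T := by
    refine Submodule.span_le.2 ?_
    rintro v ⟨γ, hγ, hS, hv⟩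
    have hx : γ 0 = x := (congrArg Bundle.TotalSpace.proj hv).symm
    subst hx
    have h1 := h γ hγ hS rfl
    have h2 : v = velocity γ 0 := by
      injection hv with _ h3
    rw [h2]
    rw [← mfderiv_curve_eq (hγ.mdifferentiable (by simp) 0)] at h1
    exact h1
  exact this hw

/-! ### Bounds for the Riemannian distance -/

theorem enorm_eq_ofReal_sqrt
    (g : Bundle.RiemannianMetric (fun x : M ↦ TangentSpace 𝓘(ℝ, E) x)) (x : M)
    (v : TangentSpace 𝓘(ℝ, E) x) :
    letI : Bundle.RiemannianBundle (fun x : M ↦ TangentSpace 𝓘(ℝ, E) x) := ⟨g⟩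
    ‖v‖ₑ = ENNReal.ofReal (Real.sqrt (g.inner x v v)) := by
  let _ : Bundle.RiemannianBundle (fun x : M ↦ TangentSpace 𝓘(ℝ, E) x) := ⟨g⟩
  rw [← ofReal_norm, norm_eq_sqrt_real_inner]
  rfl

/-- A function with gradient of norm at most `1` is Lipschitz for the Riemannian distance. -/
theorem ofReal_sub_le_riemannianDist
    (g : Bundle.RiemannianMetric (fun x : M ↦ TangentSpace 𝓘(ℝ, E) x))
    {F : M → ℝ} (hF : ContMDiff 𝓘(ℝ, E) 𝓘(ℝ, ℝ) 1 F) {F' : M → E →L[ℝ] ℝ}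
    (hF' : ∀ x, HasMFDerivAt 𝓘(ℝ, E) 𝓘(ℝ, ℝ) F x (F' x))
    (hle : ∀ (x : M) (v : E), F' x v ≤ Real.sqrt (g.inner x v v)) (x y : M) :
    ENNReal.ofReal (F y - F x) ≤ riemannianDist g x y := by
  let _ : Bundle.RiemannianBundle (fun x : M ↦ TangentSpace 𝓘(ℝ, E) x) := ⟨g⟩
  refine le_of_forall_gt fun r hr ↦ ?_
  obtain ⟨γ, h0, h1, hγ, hl⟩ := Manifold.exists_lt_of_riemannianEDist_lt hr
  refine lt_of_le_of_lt ?_ hl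
  have hc : ContDiffOn ℝ 1 (F ∘ γ) (Icc 0 1) := (hF.comp_contMDiffOn hγ).contDiffOn
  have h2 := enorm_sub_le_lintegral_deriv_of_contDiffOn_Icc hc zero_le_one
  simp only [Function.comp_apply, h0, h1] at h2
  rw [Manifold.pathELength_eq_lintegral_mfderiv_Ioo]
  refine (ENNReal.ofReal_le_ofReal (le_abs_self _)).trans ?_
  rw [← Real.enorm_eq_ofReal_abs]
  refine h2.trans ?_
  rw [← MeasureTheory.restrict_Ioo_eq_restrict_Icc]
  refine MeasureTheory.setLIntegral_mono' measurableSet_Ioo fun t ht ↦ ?_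
  have hγt : MDifferentiableAt 𝓘(ℝ, ℝ) 𝓘(ℝ, E) γ t :=
    (hγ.contMDiffAt (Icc_mem_nhds ht.1 ht.2)).mdifferentiableAt (by simp)
  let D : ℝ →L[ℝ] E := mfderiv 𝓘(ℝ, ℝ) 𝓘(ℝ, E) γ t
  have hD : HasMFDerivAt 𝓘(ℝ, ℝ) 𝓘(ℝ, E) γ t D := hγt.hasMFDerivAt
  have h3 : HasFDerivAt (F ∘ γ) ((F' (γ t)).comp D) t := ((hF' (γ t)).comp t hD).hasFDerivAt
  have h4 : deriv (F ∘ γ) t = F' (γ t) (D 1) := by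
    rw [← fderiv_apply_one_eq_deriv, h3.fderiv]
    rfl
  rw [h4, Real.enorm_eq_ofReal_abs, enorm_eq_ofReal_sqrt]
  refine ENNReal.ofReal_le_ofReal (abs_le'.2 ⟨hle _ _, ?_⟩)
  have h5 := hle (γ t) (-(D 1))
  rw [(F' (γ t)).map_neg (D 1)] at h5
  refine h5.trans_eq (congrArg Real.sqrt ?_)
  let q : E →L[ℝ] E →L[ℝ] ℝ := g.inner (γ t)
  show q (-(D 1)) (-(D 1)) = q (D 1) (D 1)
  simp

theorem riemannianDist_le_of_curve
    (g : Bundle.RiemannianMetric (fun x : M ↦ TangentSpace 𝓘(ℝ, E) x))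
    {γ : ℝ → M} (hγ : ContMDiff 𝓘(ℝ, ℝ) 𝓘(ℝ, E) 1 γ) {r : ℝ}
    (hr : ∀ t, Real.sqrt (g.inner (γ t) (mfderiv 𝓘(ℝ, ℝ) 𝓘(ℝ, E) γ t (1 : ℝ))
      (mfderiv 𝓘(ℝ, ℝ) 𝓘(ℝ, E) γ t (1 : ℝ))) ≤ r) :
    riemannianDist g (γ 0) (γ 1) ≤ ENNReal.ofReal r := by
  let _ : Bundle.RiemannianBundle (fun x : M ↦ TangentSpace 𝓘(ℝ, E) x) := ⟨g⟩
  refine (Manifold.riemannianEDist_le_pathELength (I := 𝓘(ℝ, E)) (hγ.contMDiffOn (s := Icc 0 1))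
    rfl rfl zero_le_one).trans ?_
  rw [Manifold.pathELength_eq_lintegral_mfderiv_Icc]
  calc _ ≤ ∫⁻ _ in Icc (0 : ℝ) 1, ENNReal.ofReal r := by
        refine MeasureTheory.lintegral_mono fun t ↦ ?_
        rw [enorm_eq_ofReal_sqrt]
        exact ENNReal.ofReal_le_ofReal (hr t)
    _ = ENNReal.ofReal r := by simp

end ChartCalculus

/-! ### Infinitesimal foliations of a Euclidean space -/

section FibreFoliation

variable {V : Type*} [NormedAddCommGroup V] [InnerProductSpace ℝ V]

theorem extChartAt_model (x : V) : (extChartAt 𝓘(ℝ, V) x : V → V) = id := rfl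

theorem extChartAt_model_symm (x : V) : ((extChartAt 𝓘(ℝ, V) x).symm : V → V) = id := rfl

/-- The tangent space at `x` of a subset of a vector space, as a space of vectors. -/
def leafTangent (S : Set V) (x : V) : Submodule ℝ V := tangentSpaceOf (E := V) S x

theorem mem_leafTangent_of_curve {S : Set V} {x w : V} {γ : ℝ → V} {ε : ℝ} (hε : 0 < ε)
    (hγ : ContDiffOn ℝ ∞ γ (Ioo (-ε) ε)) (hS : ∀ t ∈ Ioo (-ε) ε, γ t ∈ S)
    (hx : γ 0 = x) (hw : HasDerivAt γ w 0) : w ∈ leafTangent S x :=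
  mem_tangentSpaceOf_of_curve (E := V) hε hγ.contMDiffOn hS hx hw

theorem leafTangent_le {S : Set V} {x : V} (T : Submodule ℝ V)
    (h : ∀ γ : ℝ → V, ContDiff ℝ ∞ γ → (∀ t, γ t ∈ S) → γ 0 = x → deriv γ 0 ∈ T) :
    leafTangent S x ≤ T := by
  intro w hw
  refine tangentSpaceOf_le (E := V) T (fun γ hγ hS hx ↦ ?_) hw
  exact h γ hγ.contDiff hS hx

/-- Passing to the path components does not change tangent spaces, since a curve in `S` stays in one
path component. -/
theorem leafTangent_pathComponentIn {S : Set V} {x y : V} (hy : y ∈ pathComponentIn S x) :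
    leafTangent (pathComponentIn S x) y = leafTangent S y := by
  have hsub : pathComponentIn S x ⊆ S := pathComponentIn_subset
  apply le_antisymm
  · refine leafTangent_le _ fun γ hγ hS h0 ↦ ?_
    exact mem_leafTangent_of_curve one_pos hγ.contDiffOn (fun t _ ↦ hsub (hS t)) h0
      (hγ.differentiable (by simp) 0).hasDerivAt
  · refine leafTangent_le _ fun γ hγ hS h0 ↦ ?_
    refine mem_leafTangent_of_curve one_pos hγ.contDiffOn (fun t _ ↦ ?_) h0
      (hγ.differentiable (by simp) 0).hasDerivAt
    have h1 : JoinedIn S x y := hy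
    refine h1.trans ?_
    have h2 : IsPathConnected (range γ) := isPathConnected_range hγ.continuous
    exact (h2.joinedIn y ⟨0, h0⟩ (γ t) ⟨t, rfl⟩).mono (range_subset_iff.2 hS)

omit [InnerProductSpace ℝ V] in
theorem pathComponentIn_mem_connectedLeaves {𝓕 : Set (Set V)} {S : Set V} (hS : S ∈ 𝓕) {x : V}
    (hx : x ∈ S) : pathComponentIn S x ∈ connectedLeaves 𝓕 := ⟨S, hS, x, hx, rfl⟩

theorem chartMetric_vectorSpace (x₀ y u w : V) :
    chartMetric (riemannianMetricVectorSpace V).toRiemannianMetric x₀ y u w = inner ℝ u w := by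
  have h : ∀ u : V, (mfderiv 𝓘(ℝ, V) 𝓘(ℝ, V) (extChartAt 𝓘(ℝ, V) x₀).symm y u : V) = u := by
    intro u
    rw [extChartAt_model_symm]
    exact DFunLike.congr_fun (mfderiv_id (I := 𝓘(ℝ, V)) (x := y)) u
  have h2 : chartMetric (riemannianMetricVectorSpace V).toRiemannianMetric x₀ y u w =
      inner ℝ (mfderiv 𝓘(ℝ, V) 𝓘(ℝ, V) (extChartAt 𝓘(ℝ, V) x₀).symm y u : V)
        (mfderiv 𝓘(ℝ, V) 𝓘(ℝ, V) (extChartAt 𝓘(ℝ, V) x₀).symm y w : V) := rfl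
  rw [h2]
  erw [h u, h w]
  rfl

theorem velocity_line (p ξ : V) (t : ℝ) :
    (velocity (E := V) (fun s : ℝ ↦ p + s • ξ) t : V) = ξ := by
  have h : HasDerivAt (fun s : ℝ ↦ p + s • ξ) ξ t := by
    simpa using ((hasDerivAt_id t).smul_const ξ).const_add p
  refine (mfderiv_curve_eq (E := V) (M := V) h.differentiableAt.mdifferentiableAt).trans ?_
  exact h.deriv

theorem isGeodesicOn_line (p ξ : V) :
    IsGeodesicOn (riemannianMetricVectorSpace V).toRiemannianMetric
      (fun s : ℝ ↦ p + s • ξ) univ := by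
  have h : ∀ t, HasDerivAt (fun s : ℝ ↦ p + s • ξ) ξ t := fun t ↦ by
    simpa using ((hasDerivAt_id t).smul_const ξ).const_add p
  refine ⟨(by fun_prop : ContDiff ℝ ∞ (fun s : ℝ ↦ p + s • ξ)).contMDiff.contMDiffOn, ?_⟩
  intro x₀ t _ _ w
  simp only [chartMetric_vectorSpace, extChartAt_model, id]
  have h1 : deriv (fun s : ℝ ↦ p + s • ξ) = fun _ ↦ ξ := funext fun t ↦ (h t).deriv
  simp only [h1, deriv_const, fderiv_const_apply]
  simp

variable {𝓕 : Set (Set V)}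

/-- A straight line that is orthogonal to a leaf of an infinitesimal foliation at one of its points
is orthogonal to all the leaves that it meets. -/
theorem IsDisconnectedInfinitesimalFoliation.orthogonal_line
    (h𝓕 : IsDisconnectedInfinitesimalFoliation 𝓕) {S S' : Set V} (hS : S ∈ 𝓕) (hS' : S' ∈ 𝓕)
    {p q ξ : V} {t : ℝ} (hp : p ∈ S) (hpq : p + t • ξ = q) (hq : q ∈ S')
    (h : ∀ w ∈ leafTangent S p, inner ℝ ξ w = 0) :
    ∀ w ∈ leafTangent S' q, inner ℝ ξ w = 0 := by
  subst hpq
  have key := h𝓕.foliation.orthogonal (fun s : ℝ ↦ p + s • ξ) univ isOpen_univ ordConnected_univ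
    (isGeodesicOn_line p ξ) ⟨0, mem_univ _, ?_⟩ t (mem_univ _)
  · intro w hw
    rw [← leafTangent_pathComponentIn (mem_pathComponentIn_self hq)] at hw
    have := key _ (pathComponentIn_mem_connectedLeaves hS' hq) (mem_pathComponentIn_self hq) w hw
    rw [← velocity_line p ξ t]
    exact this
  · intro C hC h0 w hw
    obtain ⟨S₁, hS₁, x, hx, rfl⟩ := hC
    have h0' : p ∈ pathComponentIn S₁ x := by simpa using h0
    have hSS : S₁ = S := by
      by_contra hne
      exact ((h𝓕.isPartition.pairwiseDisjoint hS₁ hS hne).le_bot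
        ⟨pathComponentIn_subset h0', hp⟩).elim
    subst hSS
    have h1 : (w : V) ∈ leafTangent (pathComponentIn S₁ x) p := by
      have hp0 : p + (0 : ℝ) • ξ = p := by simp
      rw [← hp0]
      exact hw
    rw [leafTangent_pathComponentIn h0'] at h1
    have h2 := h w h1
    rw [← velocity_line p ξ 0] at h2
    exact h2

/-- Every vector tangent to a leaf of `𝓕` extends to a smooth vector field of `V` tangent to all the
leaves; the leaves here may be disconnected, as they have the tangent spaces of their components. -/
theorem IsDisconnectedInfinitesimalFoliation.exists_vertical
    (h𝓕 : IsDisconnectedInfinitesimalFoliation 𝓕) {S : Set V} (hS : S ∈ 𝓕) {x w : V} (hx : x ∈ S)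
    (hw : w ∈ leafTangent S x) : ∃ X : V → V, ContDiff ℝ ∞ X ∧ X x = w ∧
      ∀ S' ∈ 𝓕, ∀ y ∈ S', X y ∈ leafTangent S' y := by
  rw [← leafTangent_pathComponentIn (mem_pathComponentIn_self hx)] at hw
  obtain ⟨X, ⟨hX1, hX2⟩, hXx⟩ := h𝓕.foliation.exists_vertical _
    (pathComponentIn_mem_connectedLeaves hS hx) x (mem_pathComponentIn_self hx) w hw
  refine ⟨X, contMDiff_vectorSpace_iff_contDiff.1 hX1, hXx, fun S' hS' y hy ↦ ?_⟩
  rw [← leafTangent_pathComponentIn (mem_pathComponentIn_self hy)]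
  exact hX2 _ (pathComponentIn_mem_connectedLeaves hS' hy) y (mem_pathComponentIn_self hy)

end FibreFoliation

/-- A continuous function that has, at each point, a differentiable upper support function with
derivative zero takes the same value at the end points. -/
theorem eq_of_upper_support {h : ℝ → ℝ} (hc : Continuous h)
    (hφ : ∀ t ∈ Icc (0 : ℝ) 1, ∃ φ : ℝ → ℝ, (∀ s ∈ Icc (0 : ℝ) 1, h s ≤ φ s) ∧ φ t = h t ∧
      HasDerivAt φ 0 t) : h 0 = h 1 := by
  have key : ∀ h : ℝ → ℝ, Continuous h → (∀ t ∈ Icc (0 : ℝ) 1, ∃ φ : ℝ → ℝ,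
      (∀ s ∈ Icc (0 : ℝ) 1, h s ≤ φ s) ∧ φ t = h t ∧ HasDerivAt φ 0 t) → h 1 ≤ h 0 := by
    intro h hc hφ
    refine image_le_of_liminf_slope_right_le_deriv_boundary (f := h) (a := 0) (b := 1)
      (B := fun _ ↦ h 0) (B' := fun _ ↦ 0) hc.continuousOn le_rfl continuousOn_const
      (fun x _ ↦ hasDerivWithinAt_const _ _ _) (fun t ht r hr ↦ ?_) (right_mem_Icc.2 zero_le_one)
    obtain ⟨φ, h1, h2, h3⟩ := hφ t ⟨ht.1, ht.2.le⟩
    have h4 := (hasDerivAt_iff_tendsto_slope.1 h3).mono_left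
      (nhdsWithin_mono t (fun s (hs : t < s) ↦ (ne_of_gt hs : s ≠ t)))
    refine Filter.Eventually.frequently ?_
    filter_upwards [h4.eventually (gt_mem_nhds hr), Ioo_mem_nhdsGT ht.2] with s hs hs'
    refine lt_of_le_of_lt ?_ hs
    rw [slope_def_field, slope_def_field, h2]
    have : 0 < s - t := sub_pos.2 hs'.1
    gcongr
    exact h1 s ⟨ht.1.trans hs'.1.le, hs'.2.le⟩
  refine le_antisymm ?_ (key h hc hφ)
  have h2 := key (fun t ↦ h (1 - t)) (by fun_prop) fun t ht ↦ ?_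
  · simpa using h2
  · obtain ⟨φ, h1, h2, h3⟩ := hφ (1 - t) ⟨by linarith [ht.2], by linarith [ht.1]⟩
    refine ⟨fun s ↦ φ (1 - s), fun s hs ↦ h1 _ ⟨by linarith [hs.2], by linarith [hs.1]⟩, h2, ?_⟩
    have := HasDerivAt.comp t h3 ((hasDerivAt_id t).const_sub 1)
    simpa [Function.comp_def] using this

/-! ### Leaves of infinitesimal foliations are weakly embedded -/

section Immersed

variable {V : Type*} [NormedAddCommGroup V] [InnerProductSpace ℝ V] {S : Set V} {k : ℕ}
  [TopologicalSpace (LeafCarrier S)]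
  [ChartedSpace (EuclideanSpace ℝ (Fin k)) (LeafCarrier S)]

theorem LeafCarrier.val_injective {M : Type*} {S : Set M} :
    Function.Injective (LeafCarrier.val (S := S)) := Subtype.val_injective

theorem LeafCarrier.val_mem {M : Type*} {S : Set M} (s : LeafCarrier S) : s.val ∈ S := s.2

variable (S) in
/-- The inclusion of an immersed submanifold of a vector space, in the chart at a point. -/
def leafParam (s₀ : LeafCarrier S) (z : EuclideanSpace ℝ (Fin k)) : V :=
  ((extChartAt (𝓡 k) s₀).symm z).val

namespace IsImmersedStructure

theorem contDiffAt_leafParam (hI : IsImmersedStructure (E := V) S k) {s₀ : LeafCarrier S}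
    {z : EuclideanSpace ℝ (Fin k)} (hz : z ∈ (extChartAt (𝓡 k) s₀).target) :
    ContDiffAt ℝ ∞ (leafParam S s₀) z := by
  have := hI.isManifold
  rw [← contMDiffAt_iff_contDiffAt]
  exact hI.contMDiff_val.contMDiffAt.comp z (contMDiffAt_extChartAt_symm s₀ hz)

/-- A local parametrization of a leaf is an immersion, with the tangent spaces of the leaf, defined
by curves, as the images of its differentials. -/
theorem exists_fderiv_leafParam (hI : IsImmersedStructure (E := V) S k) {s₀ : LeafCarrier S}
    {z : EuclideanSpace ℝ (Fin k)} (hz : z ∈ (extChartAt (𝓡 k) s₀).target) :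
    Function.Injective (fderiv ℝ (leafParam S s₀) z) ∧
      (fderiv ℝ (leafParam S s₀) z).range = leafTangent S (leafParam S s₀ z) := by
  have := hI.isManifold
  set s := (extChartAt (𝓡 k) s₀).symm z with hs
  have h1 : MDifferentiableAt (𝓡 k) (𝓡 k) (extChartAt (𝓡 k) s₀).symm z :=
    (contMDiffAt_extChartAt_symm s₀ hz).mdifferentiableAt (by simp)
  have h2 : MDifferentiableAt (𝓡 k) 𝓘(ℝ, V) (LeafCarrier.val (S := S)) s :=
    hI.contMDiff_val.mdifferentiable (by simp) s
  let D1 : EuclideanSpace ℝ (Fin k) →L[ℝ] EuclideanSpace ℝ (Fin k) :=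
    mfderiv (𝓡 k) (𝓡 k) (extChartAt (𝓡 k) s₀).symm z
  let D2 : EuclideanSpace ℝ (Fin k) →L[ℝ] V := mfderiv (𝓡 k) 𝓘(ℝ, V) (LeafCarrier.val (S := S)) s
  have h3 : HasFDerivAt (leafParam S s₀) (D2.comp D1) z :=
    (h2.hasMFDerivAt.comp z h1.hasMFDerivAt).hasFDerivAt
  have hinv := isInvertible_mfderivWithin_extChartAt_symm (I := 𝓡 k) hz
  rw [modelWithCornersSelf_coe, range_id, mfderivWithin_univ] at hinv
  obtain ⟨e, he⟩ := hinv
  have hD1 : Function.Bijective D1 := by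
    have : (D1 : EuclideanSpace ℝ (Fin k) → EuclideanSpace ℝ (Fin k)) = e :=
      funext fun u ↦ (DFunLike.congr_fun he u).symm
    rw [this]
    exact e.bijective
  rw [h3.fderiv]
  refine ⟨(hI.injective_mfderiv s).comp hD1.1, ?_⟩
  have h4 : D2.range = leafTangent S (leafParam S s₀ z) := hI.range_mfderiv s
  rw [← h4]
  ext v
  constructor
  · rintro ⟨u, rfl⟩
    exact ⟨D1 u, rfl⟩
  · rintro ⟨u, rfl⟩
    obtain ⟨u', rfl⟩ := hD1.2 u
    exact ⟨u', rfl⟩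

omit [NormedAddCommGroup V] [InnerProductSpace ℝ V] in
theorem injOn_leafParam (s₀ : LeafCarrier S) :
    InjOn (leafParam (k := k) S s₀) (extChartAt (𝓡 k) s₀).target :=
  (LeafCarrier.val_injective.injOn (s := univ)).comp (extChartAt (𝓡 k) s₀).symm.injOn
    (mapsTo_univ _ _)

omit [NormedAddCommGroup V] [InnerProductSpace ℝ V] in
theorem leafParam_mem (s₀ : LeafCarrier S) (z : EuclideanSpace ℝ (Fin k)) :
    leafParam S s₀ z ∈ S := LeafCarrier.val_mem _

omit [NormedAddCommGroup V] [InnerProductSpace ℝ V] in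
theorem leafParam_extChartAt (s₀ : LeafCarrier S) :
    leafParam (k := k) S s₀ (extChartAt (𝓡 k) s₀ s₀) = s₀.val :=
  congrArg LeafCarrier.val (extChartAt_to_inv s₀)

end IsImmersedStructure

end Immersed

section WeakEmbedding

open IsImmersedStructure

variable {V : Type*} [NormedAddCommGroup V] [InnerProductSpace ℝ V] {𝓕 : Set (Set V)}
  {S : Set V} {k : ℕ} [TopologicalSpace (LeafCarrier S)]
  [ChartedSpace (EuclideanSpace ℝ (Fin k)) (LeafCarrier S)]

/-- Near a point of a leaf `S`, a nearest point of a small compact plaque is joined to the given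
point of `S` by a segment that is orthogonal to `S`. -/
theorem exists_foot_orthogonal (h𝓕 : IsDisconnectedInfinitesimalFoliation 𝓕) (hS : S ∈ 𝓕)
    (hI : IsImmersedStructure (E := V) S k) (s₀ : LeafCarrier S) {r : ℝ} (hr : 0 < r)
    (hball : Metric.closedBall (extChartAt (𝓡 k) s₀ s₀) r ⊆ (extChartAt (𝓡 k) s₀).target) :
    ∃ δ > 0, ∀ q ∈ S, dist q s₀.val < δ →
      ∃ p ∈ leafParam S s₀ '' Metric.closedBall (extChartAt (𝓡 k) s₀ s₀) r,
        Metric.infDist q (leafParam S s₀ '' Metric.closedBall (extChartAt (𝓡 k) s₀ s₀) r) =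
          dist q p ∧ ∀ w ∈ leafTangent S q, inner ℝ (q - p) w = 0 := by
  set z₀ := extChartAt (𝓡 k) s₀ s₀ with hz₀
  have hcont : ContinuousOn (leafParam S s₀) (Metric.closedBall z₀ r) := fun z hz ↦
    (hI.contDiffAt_leafParam (hball hz)).continuousAt.continuousWithinAt
  set K := leafParam S s₀ '' Metric.closedBall z₀ r with hK
  have hKc : IsCompact K := (isCompact_closedBall z₀ r).image_of_continuousOn hcont
  have hy₀ : leafParam S s₀ z₀ = s₀.val := leafParam_extChartAt s₀
  have hz₀b : z₀ ∈ Metric.closedBall z₀ r := Metric.mem_closedBall_self hr.le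
  have hy₀K : s₀.val ∈ K := ⟨z₀, hz₀b, hy₀⟩
  have hspc : IsClosed (leafParam S s₀ '' Metric.sphere z₀ r) :=
    ((isCompact_sphere z₀ r).image_of_continuousOn
      (hcont.mono Metric.sphere_subset_closedBall)).isClosed
  have hns : s₀.val ∈ (leafParam S s₀ '' Metric.sphere z₀ r)ᶜ := by
    rintro ⟨z, hz, hzy⟩
    have h1 := injOn_leafParam s₀ (hball (Metric.sphere_subset_closedBall hz)) (hball hz₀b)
      (hzy.trans hy₀.symm)
    rw [h1, Metric.mem_sphere, dist_self] at hz
    exact hr.ne hz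
  obtain ⟨η, hη, hηb⟩ := Metric.isOpen_iff.1 hspc.isOpen_compl _ hns
  refine ⟨η / 2, by positivity, fun q hq hqd ↦ ?_⟩
  obtain ⟨p, hpK, hp⟩ := hKc.exists_infDist_eq_dist ⟨_, hy₀K⟩ q
  refine ⟨p, hpK, hp, ?_⟩
  obtain ⟨z, hz, rfl⟩ := hpK
  have h1 : dist q (leafParam S s₀ z) ≤ dist q s₀.val := hp ▸ Metric.infDist_le_dist_of_mem hy₀K
  have h2 : leafParam S s₀ z ∈ Metric.ball s₀.val η := by
    rw [Metric.mem_ball]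
    calc _ ≤ dist q (leafParam S s₀ z) + dist q s₀.val := dist_triangle_left _ _ _
      _ < η := by linarith
  have hzr : z ∈ Metric.ball z₀ r := by
    refine lt_of_le_of_ne hz fun h ↦ hηb h2 ⟨z, h, rfl⟩
  have hzt := hball hz
  -- the squared distance to `q` has a local minimum at `z`
  have hmin : IsLocalMin (fun z' ↦ ‖leafParam S s₀ z' - q‖ ^ 2) z := by
    filter_upwards [Metric.isOpen_ball.mem_nhds hzr] with z' hz'
    have h3 : dist q (leafParam S s₀ z) ≤ dist q (leafParam S s₀ z') :=
      hp ▸ Metric.infDist_le_dist_of_mem ⟨z', Metric.ball_subset_closedBall hz', rfl⟩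
    rw [dist_eq_norm', dist_eq_norm'] at h3
    gcongr
  have hd : HasFDerivAt (leafParam S s₀) (fderiv ℝ (leafParam S s₀) z) z :=
    ((hI.contDiffAt_leafParam hzt).differentiableAt (by simp)).hasFDerivAt
  have hzero := hmin.hasFDerivAt_eq_zero (hd.sub_const q).norm_sq
  have horth : ∀ w ∈ leafTangent S (leafParam S s₀ z),
      inner ℝ (q - leafParam S s₀ z) w = 0 := by
    intro w hw
    rw [← (hI.exists_fderiv_leafParam hzt).2] at hw
    obtain ⟨u, rfl⟩ := hw
    have h4 := DFunLike.congr_fun hzero u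
    simp at h4
    rw [← neg_sub, inner_neg_left, neg_eq_zero, inner_sub_left]
    exact h4
  exact h𝓕.orthogonal_line hS hS (t := 1) (leafParam_mem s₀ z) (by simp) hq horth

/-- The leaves of an infinitesimal foliation are weakly embedded: a map from a locally connected
space into a leaf is continuous for the topology of the leaf as soon as it is continuous as a map
into the ambient space. The distance to a plaque is locally constant along the leaf, because the
segments to the nearest points are orthogonal to the leaf at both ends; so it takes only
countably many values, and it is constant on connected sets. -/
theorem continuousAt_of_continuousAt_val (h𝓕 : IsDisconnectedInfinitesimalFoliation 𝓕)
    (hS : S ∈ 𝓕) (hI : IsImmersedStructure (E := V) S k)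
    {N : Type*} [TopologicalSpace N] [LocallyConnectedSpace N] {f : N → LeafCarrier S} {n₀ : N}
    (hf : ∀ᶠ n in 𝓝 n₀, ContinuousAt (fun n ↦ (f n).val) n) : ContinuousAt f n₀ := by
  have := hI.isManifold
  have := hI.secondCountable
  set s₀ := f n₀ with hs₀
  set z₀ := extChartAt (𝓡 k) s₀ s₀ with hz₀
  intro W hW
  rw [Filter.mem_map]
  -- a closed coordinate ball inside the neighborhood `W`
  have hW' : (extChartAt (𝓡 k) s₀).target ∩ (extChartAt (𝓡 k) s₀).symm ⁻¹' W ∈ 𝓝 z₀ := by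
    refine Filter.inter_mem (extChartAt_target_mem_nhds s₀) ?_
    refine (continuousAt_extChartAt_symm s₀).preimage_mem_nhds ?_
    rwa [extChartAt_to_inv]
  obtain ⟨r, hr, hrW⟩ := Metric.nhds_basis_closedBall.mem_iff.1 hW'
  have hball := hrW.trans inter_subset_left
  obtain ⟨δ, hδ, hfoot⟩ := exists_foot_orthogonal h𝓕 hS hI s₀ hr hball
  set K := leafParam S s₀ '' Metric.closedBall z₀ r with hK
  have hKc : IsCompact K := (isCompact_closedBall z₀ r).image_of_continuousOn fun z hz ↦
    (hI.contDiffAt_leafParam (hball hz)).continuousAt.continuousWithinAt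
  have hs₀K : s₀.val ∈ K :=
    ⟨z₀, Metric.mem_closedBall_self hr.le, leafParam_extChartAt s₀⟩
  let D : LeafCarrier S → ℝ := fun s ↦ Metric.infDist s.val K
  let O : Set (LeafCarrier S) := {s | dist s.val s₀.val < δ}
  have hvc : Continuous (LeafCarrier.val (S := S)) := hI.contMDiff_val.continuous
  have hO : IsOpen O := isOpen_lt (hvc.dist continuous_const) continuous_const
  have hDloc : ∀ s₁ ∈ O, ∀ᶠ s in 𝓝 s₁, D s = D s₁ := by
    intro s₁ hs₁
    set z₁ := extChartAt (𝓡 k) s₁ s₁ with hz₁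
    have hO' : (extChartAt (𝓡 k) s₁).target ∩ (extChartAt (𝓡 k) s₁).symm ⁻¹' O ∈ 𝓝 z₁ := by
      refine Filter.inter_mem (extChartAt_target_mem_nhds s₁) ?_
      refine (continuousAt_extChartAt_symm s₁).preimage_mem_nhds ?_
      rw [extChartAt_to_inv]
      exact hO.mem_nhds hs₁
    obtain ⟨r₁, hr₁, hr₁O⟩ := Metric.nhds_basis_ball.mem_iff.1 hO'
    have h1 : ∀ᶠ s in 𝓝 s₁, extChartAt (𝓡 k) s₁ s ∈ Metric.ball z₁ r₁ :=
      (continuousAt_extChartAt s₁).preimage_mem_nhds (Metric.ball_mem_nhds _ hr₁)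
    filter_upwards [h1, extChartAt_source_mem_nhds (I := 𝓡 k) s₁] with s hs hs'
    set z := extChartAt (𝓡 k) s₁ s with hz
    let c : ℝ → EuclideanSpace ℝ (Fin k) := fun t ↦ z₁ + max 0 (min 1 t) • (z - z₁)
    have hcI : ∀ t, c t ∈ Metric.ball z₁ r₁ := by
      intro t
      have h01 : max 0 (min 1 t) ∈ Icc (0 : ℝ) 1 := ⟨le_max_left _ _, by simp⟩
      have := (convex_ball z₁ r₁).add_smul_sub_mem (Metric.mem_ball_self hr₁) hs h01
      exact this
    have hlc : ∀ z' ∈ Metric.ball z₁ r₁, ContinuousAt (leafParam S s₁) z' := fun z' hz' ↦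
      (hI.contDiffAt_leafParam (hr₁O hz').1).continuousAt
    have hcc : Continuous c := by fun_prop
    let h : ℝ → ℝ := fun t ↦ Metric.infDist (leafParam S s₁ (c t)) K ^ 2
    have hh : h 0 = h 1 := by
      refine eq_of_upper_support ?_ ?_
      · refine continuous_iff_continuousAt.2 fun t ↦ ?_
        exact (((Metric.continuous_infDist_pt K).continuousAt).comp
          ((hlc _ (hcI t)).comp hcc.continuousAt)).pow 2
      · intro t ht
        have hct : ∀ t ∈ Icc (0 : ℝ) 1, c t = z₁ + t • (z - z₁) := fun t ht ↦ by
          simp only [c, min_eq_right ht.2, max_eq_right ht.1]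
        obtain ⟨p, hpK, hp, horth⟩ := hfoot (leafParam S s₁ (c t)) (leafParam_mem _ _)
          (hr₁O (hcI t)).2
        refine ⟨fun t' ↦ ‖leafParam S s₁ (z₁ + t' • (z - z₁)) - p‖ ^ 2, fun t' ht' ↦ ?_, ?_, ?_⟩
        · simp only [h]
          rw [← hct t' ht', ← dist_eq_norm]
          have := Metric.infDist_le_dist_of_mem (x := leafParam S s₁ (c t')) hpK
          gcongr
          exact Metric.infDist_nonneg
        · simp only [h]
          rw [← hct t ht, ← dist_eq_norm, hp]
        · have hline : HasDerivAt (fun t' : ℝ ↦ z₁ + t' • (z - z₁)) (z - z₁) t := by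
            simpa using ((hasDerivAt_id t).smul_const (z - z₁)).const_add z₁
          have hct' := hct t ht
          have htt := (hr₁O (hcI t)).1
          rw [hct'] at htt horth
          have hd : HasFDerivAt (leafParam S s₁)
              (fderiv ℝ (leafParam S s₁) (z₁ + t • (z - z₁))) (z₁ + t • (z - z₁)) :=
            ((hI.contDiffAt_leafParam htt).differentiableAt (by simp)).hasFDerivAt
          have h5 := ((hd.comp_hasDerivAt t hline).sub_const p).norm_sq
          have h6 := horth (fderiv ℝ (leafParam S s₁) (z₁ + t • (z - z₁)) (z - z₁)) (by
            rw [← (hI.exists_fderiv_leafParam htt).2]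
            exact ⟨_, rfl⟩)
          simp only [Function.comp_apply] at h5
          rw [h6, mul_zero] at h5
          exact h5
    have hc0 : c 0 = z₁ := by simp [c]
    have hc1 : c 1 = z := by simp [c]
    simp only [h, hc0, hc1] at hh
    have e1 : leafParam S s₁ z₁ = s₁.val := leafParam_extChartAt s₁
    have e2 : leafParam S s₁ z = s.val :=
      congrArg LeafCarrier.val ((extChartAt (𝓡 k) s₁).left_inv hs')
    rw [e1, e2] at hh
    exact ((pow_left_inj₀ Metric.infDist_nonneg Metric.infDist_nonneg two_ne_zero).1 hh).symm
  -- hence `D` takes countably many values on `O`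
  have hcount : (D '' O).Countable := by
    let A : D '' O → Set (LeafCarrier S) := fun d ↦ O ∩ D ⁻¹' {d.1}
    have hA : (univ : Set (D '' O)).Countable := by
      refine Set.PairwiseDisjoint.countable_of_isOpen (s := A) ?_ ?_ ?_
      · intro d _ d' _ hne
        refine disjoint_left.2 fun s hs hs' ↦ hne (Subtype.ext ?_)
        exact (hs.2 : D s = d.1).symm.trans hs'.2
      · rintro d -
        refine isOpen_iff_mem_nhds.2 fun s hs ↦ ?_
        filter_upwards [hO.mem_nhds hs.1, hDloc s hs.1] with s' h1 h2
        exact ⟨h1, h2.trans hs.2⟩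
      · rintro ⟨d, s, hs, rfl⟩ -
        exact ⟨s, hs, rfl⟩
    exact countable_coe_iff.1 (countable_univ_iff.1 hA)
  -- a connected neighborhood of `n₀` on which `f` is continuous and stays in `O`
  have hO'' : ∀ᶠ n in 𝓝 n₀, f n ∈ O ∧ ContinuousAt (fun n ↦ (f n).val) n := by
    refine Filter.Eventually.and ?_ hf
    have : ∀ᶠ n in 𝓝 n₀, (f n).val ∈ Metric.ball s₀.val δ :=
      hf.self_of_nhds.preimage_mem_nhds (Metric.ball_mem_nhds _ hδ)
    exact this
  obtain ⟨N', ⟨hN'o, hN'n, hN'c⟩, hN'⟩ :=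
    (LocallyConnectedSpace.open_connected_basis n₀).mem_iff.1 hO''
  have hsub : (D ∘ f '' N').Subsingleton := by
    refine hcount.isTotallyDisconnected _ ?_ ?_
    · rintro _ ⟨n, hn, rfl⟩
      exact ⟨f n, (hN' hn).1, rfl⟩
    · refine hN'c.isPreconnected.image _ fun n hn ↦ ?_
      exact ((Metric.continuous_infDist_pt K).continuousAt.comp (hN' hn).2).continuousWithinAt
  filter_upwards [hN'o.mem_nhds hN'n] with n hn
  have h0 : D (f n) = 0 := by
    have h1 := hsub ⟨n, hn, rfl⟩ ⟨n₀, hN'n, rfl⟩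
    have h2 : D (f n₀) = 0 := Metric.infDist_zero_of_mem hs₀K
    exact h1.trans h2
  have hmem : (f n).val ∈ K :=
    (hKc.isClosed.mem_iff_infDist_zero ⟨_, hs₀K⟩).2 h0
  obtain ⟨z, hz, hzf⟩ := hmem
  have : (extChartAt (𝓡 k) s₀).symm z = f n := LeafCarrier.val_injective hzf
  rw [mem_preimage, ← this]
  exact (hrW hz).2

/-- A continuous map into an immersed submanifold is smooth if it is smooth as a map into the
ambient space. -/
theorem contMDiffAt_of_contMDiffAt_val [FiniteDimensional ℝ V]
    (hI : IsImmersedStructure (E := V) S k)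
    {EN HN N : Type*} [NormedAddCommGroup EN] [NormedSpace ℝ EN] [TopologicalSpace HN]
    {IN : ModelWithCorners ℝ EN HN} [TopologicalSpace N] [ChartedSpace HN N]
    {f : N → LeafCarrier S} {n₀ : N} (hf : ContinuousAt f n₀)
    (hf' : ContMDiffAt IN 𝓘(ℝ, V) ∞ (fun n ↦ (f n).val) n₀) :
    ContMDiffAt IN (𝓡 k) ∞ f n₀ := by
  have := hI.isManifold
  rw [contMDiffAt_iff_target]
  refine ⟨hf, ?_⟩
  set s₀ := f n₀ with hs₀
  set z₀ := extChartAt (𝓡 k) s₀ s₀ with hz₀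
  have hz₀t : z₀ ∈ (extChartAt (𝓡 k) s₀).target := mem_extChartAt_target s₀
  have hD := hI.contDiffAt_leafParam hz₀t
  -- a linear left inverse of the differential of the inclusion makes it a local diffeomorphism
  obtain ⟨A, hA⟩ := LinearMap.exists_leftInverse_of_injective
    (fderiv ℝ (leafParam S s₀) z₀ : EuclideanSpace ℝ (Fin k) →ₗ[ℝ] V)
    (LinearMap.ker_eq_bot.2 (hI.exists_fderiv_leafParam hz₀t).1)
  let A' : V →L[ℝ] EuclideanSpace ℝ (Fin k) := LinearMap.toContinuousLinearMap A
  let G : EuclideanSpace ℝ (Fin k) → EuclideanSpace ℝ (Fin k) := fun z ↦ A' (leafParam S s₀ z)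
  have hG : ContDiffAt ℝ ∞ G z₀ := A'.contDiff.contDiffAt.comp z₀ hD
  have hG' : HasFDerivAt G ((ContinuousLinearEquiv.refl ℝ (EuclideanSpace ℝ (Fin k)) :
      EuclideanSpace ℝ (Fin k) ≃L[ℝ] EuclideanSpace ℝ (Fin k)) :
      EuclideanSpace ℝ (Fin k) →L[ℝ] EuclideanSpace ℝ (Fin k)) z₀ := by
    have h1 := A'.hasFDerivAt.comp z₀ (hD.differentiableAt (by simp)).hasFDerivAt
    convert! h1 using 1
    ext1 u
    exact (DFunLike.congr_fun hA u).symm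
  have hinv := hG.to_localInverse hG' (by simp)
  have hleft := (hG.hasStrictFDerivAt' hG' (by simp)).eventually_left_inverse
  have h2 : ContMDiffAt IN 𝓘(ℝ, EuclideanSpace ℝ (Fin k)) ∞
      (fun n ↦ hG.localInverse hG' (by simp) (A' (f n).val)) n₀ := by
    have h3 : ContMDiffAt IN 𝓘(ℝ, EuclideanSpace ℝ (Fin k)) ∞ (fun n ↦ A' (f n).val) n₀ :=
      A'.contDiff.contMDiff.contMDiffAt.comp n₀ hf'
    have h4 : A' (f n₀).val = G z₀ := congrArg A' (leafParam_extChartAt s₀).symm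
    refine ContMDiffAt.comp n₀ (g := hG.localInverse hG' (by simp)) ?_ h3
    rw [h4]
    exact hinv.contMDiffAt
  refine h2.congr_of_eventuallyEq ?_
  have h5 : ∀ᶠ n in 𝓝 n₀, f n ∈ (extChartAt (𝓡 k) s₀).source :=
    hf.preimage_mem_nhds (extChartAt_source_mem_nhds s₀)
  have h6 : Filter.Tendsto (fun n ↦ extChartAt (𝓡 k) s₀ (f n)) (𝓝 n₀) (𝓝 z₀) :=
    (continuousAt_extChartAt s₀).tendsto.comp hf
  filter_upwards [h5, h6.eventually hleft] with n hn hn'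
  have h7 : leafParam S s₀ (extChartAt (𝓡 k) s₀ (f n)) = (f n).val :=
    congrArg LeafCarrier.val ((extChartAt (𝓡 k) s₀).left_inv hn)
  have h8 : G (extChartAt (𝓡 k) s₀ (f n)) = A' (f n).val := congrArg A' h7
  rw [h8] at hn'
  exact hn'.symm

end WeakEmbedding

/-! ### Vector bundles with structure group in the orthogonal group -/

/-- Local trivializations, over coordinate domains of the base `L`, of a bundle `B → L` with fibre
the Euclidean space `V` and structure group `G ⊆ O(V)`. They are indexed by the points of `L`, and
the base coordinate of `chart i` is the preferred chart of `L` at `i`, so that they are charts with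
values in the model space `EL × V`. -/
structure BundleAtlas {V : Type*} [NormedAddCommGroup V] [InnerProductSpace ℝ V]
    (G : Subgroup (V ≃ₗᵢ[ℝ] V)) (EL : Type*) [NormedAddCommGroup EL] [NormedSpace ℝ EL]
    (L : Type*) [TopologicalSpace L] [ChartedSpace EL L] (B : Type*) [TopologicalSpace B] where
  /-- The bundle projection. -/
  proj : B → L
  /-- The open set of the base over which `chart i` is defined. -/
  base : L → Set L
  isOpen_base : ∀ i, IsOpen (base i)
  mem_base : ∀ i, i ∈ base i
  base_subset : ∀ i, base i ⊆ (chartAt EL i).source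
  /-- The local trivialization over `base i`. -/
  chart : L → OpenPartialHomeomorph B (EL × V)
  source_eq : ∀ i, (chart i).source = proj ⁻¹' base i
  target_eq : ∀ i, (chart i).target =
    {z | z.1 ∈ (chartAt EL i).target ∧ (chartAt EL i).symm z.1 ∈ base i}
  fst_chart : ∀ i b, proj b ∈ base i → (chart i b).1 = chartAt EL i (proj b)
  /-- The transition functions, with values in the structure group. -/
  trans : L → L → L → G
  contMDiffOn_trans : ∀ i j, ContMDiffOn 𝓘(ℝ, EL) 𝓘(ℝ, V →L[ℝ] V) ∞
    (fun x ↦ ((trans i j x : V ≃ₗᵢ[ℝ] V) : V →L[ℝ] V)) (base i ∩ base j)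
  snd_chart : ∀ i j b, proj b ∈ base i → proj b ∈ base j →
    (chart j b).2 = (trans i j (proj b) : V ≃ₗᵢ[ℝ] V) (chart i b).2

namespace BundleAtlas

variable {V : Type*} [NormedAddCommGroup V] [InnerProductSpace ℝ V]
  {G : Subgroup (V ≃ₗᵢ[ℝ] V)} {EL : Type*} [NormedAddCommGroup EL] [NormedSpace ℝ EL]
  {L : Type*} [TopologicalSpace L] [ChartedSpace EL L] {B : Type*} [TopologicalSpace B]
  (𝒯 : BundleAtlas G EL L B)

/-- The coordinate domain of `base i`. -/
def dom (i : L) : Set EL := {y | y ∈ (chartAt EL i).target ∧ (chartAt EL i).symm y ∈ 𝒯.base i}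

/-- The coordinate change of the base, from the chart at `i` to the chart at `j`. -/
def baseChange (i j : L) : EL → EL := chartAt EL j ∘ (chartAt EL i).symm

/-- The transition function from `chart i` to `chart j`, in the coordinates of `chart i`. -/
def transCoord (i j : L) (y : EL) : V →L[ℝ] V :=
  ((𝒯.trans i j ((chartAt EL i).symm y) : V ≃ₗᵢ[ℝ] V) : V →L[ℝ] V)

theorem isOpen_dom (i : L) : IsOpen (𝒯.dom i) :=
  (chartAt EL i).isOpen_inter_preimage_symm (𝒯.isOpen_base i)

theorem mem_target {i : L} {z : EL × V} : z ∈ (𝒯.chart i).target ↔ z.1 ∈ 𝒯.dom i := by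
  rw [𝒯.target_eq]; rfl

theorem mem_source {i : L} {b : B} : b ∈ (𝒯.chart i).source ↔ 𝒯.proj b ∈ 𝒯.base i := by
  rw [𝒯.source_eq]; rfl

theorem proj_symm {i : L} {z : EL × V} (hz : z.1 ∈ 𝒯.dom i) :
    𝒯.proj ((𝒯.chart i).symm z) = (chartAt EL i).symm z.1 := by
  have h1 := (𝒯.chart i).map_target (𝒯.mem_target.2 hz)
  rw [𝒯.mem_source] at h1
  have h2 := 𝒯.fst_chart i _ h1
  rw [(𝒯.chart i).right_inv (𝒯.mem_target.2 hz)] at h2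
  rw [h2, (chartAt EL i).left_inv (𝒯.base_subset i h1)]

theorem chartAt_mem_dom {i x : L} (hx : x ∈ 𝒯.base i) : chartAt EL i x ∈ 𝒯.dom i :=
  ⟨(chartAt EL i).map_source (𝒯.base_subset i hx), by
    rwa [(chartAt EL i).left_inv (𝒯.base_subset i hx)]⟩

theorem proj_symm_chartAt {i x : L} (hx : x ∈ 𝒯.base i) (v : V) :
    𝒯.proj ((𝒯.chart i).symm (chartAt EL i x, v)) = x := by
  rw [𝒯.proj_symm (𝒯.chartAt_mem_dom hx)]
  exact (chartAt EL i).left_inv (𝒯.base_subset i hx)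

theorem chart_symm_apply {i : L} {z : EL × V} (hz : z.1 ∈ 𝒯.dom i) :
    𝒯.chart i ((𝒯.chart i).symm z) = z := (𝒯.chart i).right_inv (𝒯.mem_target.2 hz)

theorem symm_chart_apply {i : L} {b : B} (hb : 𝒯.proj b ∈ 𝒯.base i) :
    (𝒯.chart i).symm (𝒯.chart i b) = b := (𝒯.chart i).left_inv (𝒯.mem_source.2 hb)

theorem chart_eq {i : L} {b : B} (hb : 𝒯.proj b ∈ 𝒯.base i) :
    𝒯.chart i b = (chartAt EL i (𝒯.proj b), (𝒯.chart i b).2) :=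
  Prod.ext (𝒯.fst_chart i b hb) rfl

theorem chart_fst_mem_dom {i : L} {b : B} (hb : 𝒯.proj b ∈ 𝒯.base i) :
    (𝒯.chart i b).1 ∈ 𝒯.dom i := by
  rw [𝒯.fst_chart i b hb]; exact 𝒯.chartAt_mem_dom hb

theorem chart_change {i j : L} {z : EL × V} (hz : z.1 ∈ 𝒯.dom i)
    (hj : (chartAt EL i).symm z.1 ∈ 𝒯.base j) :
    𝒯.chart j ((𝒯.chart i).symm z) =
      ((baseChange i j z.1 : EL), 𝒯.transCoord i j z.1 z.2) := by
  have h1 := 𝒯.proj_symm hz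
  have h2 : 𝒯.proj ((𝒯.chart i).symm z) ∈ 𝒯.base i := by rw [h1]; exact hz.2
  have h3 : 𝒯.proj ((𝒯.chart i).symm z) ∈ 𝒯.base j := by rw [h1]; exact hj
  refine Prod.ext ?_ ?_
  · rw [𝒯.fst_chart j _ h3, h1]; rfl
  · rw [𝒯.snd_chart i j _ h2 h3, h1, 𝒯.chart_symm_apply hz]; rfl

theorem isOpen_overlap (i j : L) :
    IsOpen (𝒯.dom i ∩ (chartAt EL i).symm ⁻¹' 𝒯.base j) := by
  have : 𝒯.dom i ∩ (chartAt EL i).symm ⁻¹' 𝒯.base j =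
      (chartAt EL i).target ∩ (chartAt EL i).symm ⁻¹' (𝒯.base i ∩ 𝒯.base j) := by
    ext y; exact and_assoc
  rw [this]
  exact (chartAt EL i).isOpen_inter_preimage_symm ((𝒯.isOpen_base i).inter (𝒯.isOpen_base j))

theorem inner_transCoord (i j : L) (y : EL) (v w : V) :
    inner ℝ (𝒯.transCoord i j y v) (𝒯.transCoord i j y w) = inner ℝ v w :=
  ((𝒯.trans i j ((chartAt EL i).symm y) : V ≃ₗᵢ[ℝ] V)).inner_map_map v w

/-- The cocycle identity. -/
theorem transCoord_comp {i j k : L} {y : EL} (hy : y ∈ 𝒯.dom i)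
    (hj : (chartAt EL i).symm y ∈ 𝒯.base j) (hk : (chartAt EL i).symm y ∈ 𝒯.base k) (v : V) :
    𝒯.transCoord j k (baseChange i j y) (𝒯.transCoord i j y v) = 𝒯.transCoord i k y v := by
  have h1 := congrArg Prod.snd (𝒯.chart_change (z := (y, v)) hy hk)
  have hp : 𝒯.proj ((𝒯.chart i).symm (y, v)) = (chartAt EL i).symm y := 𝒯.proj_symm hy
  have h2 := 𝒯.snd_chart j k ((𝒯.chart i).symm (y, v)) (hp ▸ hj) (hp ▸ hk)
  rw [𝒯.chart_change (z := (y, v)) hy hj, hp] at h2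
  rw [h1] at h2
  simp only at h2
  rw [h2, transCoord]
  have h3 : (chartAt EL j).symm (baseChange i j y) = (chartAt EL i).symm y :=
    (chartAt EL j).left_inv (𝒯.base_subset j hj)
  rw [h3]
  rfl

theorem transCoord_self {i : L} {y : EL} (hy : y ∈ 𝒯.dom i) (v : V) :
    𝒯.transCoord i i y v = v := by
  have h1 := congrArg Prod.snd (𝒯.chart_change (z := (y, v)) hy hy.2)
  rw [𝒯.chart_symm_apply (z := (y, v)) hy] at h1
  exact h1.symm

theorem continuous_proj : Continuous 𝒯.proj := by
  refine continuous_iff_continuousAt.2 fun b ↦ ?_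
  have hb := 𝒯.mem_base (𝒯.proj b)
  set i := 𝒯.proj b with hi
  have h1 : ContinuousAt (fun b' ↦ (chartAt EL i).symm (𝒯.chart i b').1) b := by
    have hs : b ∈ (𝒯.chart i).source := 𝒯.mem_source.2 hb
    refine ContinuousAt.comp (g := (chartAt EL i).symm) ?_
      (continuousAt_fst.comp ((𝒯.chart i).continuousAt hs))
    exact (chartAt EL i).continuousAt_symm (𝒯.chart_fst_mem_dom hb).1
  refine h1.congr ?_
  filter_upwards [(𝒯.chart i).open_source.mem_nhds (𝒯.mem_source.2 hb)] with b' hb'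
  rw [𝒯.mem_source] at hb'
  rw [𝒯.fst_chart i b' hb', (chartAt EL i).left_inv (𝒯.base_subset i hb')]

include 𝒯 in
theorem t2Space [T2Space L] : T2Space B := by
  refine ⟨fun b b' hne ↦ ?_⟩
  by_cases hp : 𝒯.proj b = 𝒯.proj b'
  · have hb : b ∈ (𝒯.chart (𝒯.proj b)).source := 𝒯.mem_source.2 (𝒯.mem_base _)
    have hb' : b' ∈ (𝒯.chart (𝒯.proj b)).source := 𝒯.mem_source.2 (hp ▸ 𝒯.mem_base _)
    obtain ⟨u, v, hu, hv, h1, h2, h3⟩ :=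
      t2_separation ((𝒯.chart (𝒯.proj b)).injOn.ne hb hb' hne)
    exact ⟨_, _, (𝒯.chart _).isOpen_inter_preimage hu, (𝒯.chart _).isOpen_inter_preimage hv,
      ⟨hb, h1⟩, ⟨hb', h2⟩, (h3.preimage _).mono inter_subset_right inter_subset_right⟩
  · obtain ⟨u, v, hu, hv, h1, h2, h3⟩ := t2_separation hp
    exact ⟨_, _, hu.preimage 𝒯.continuous_proj, hv.preimage 𝒯.continuous_proj, h1, h2,
      h3.preimage _⟩

theorem exists_countable_cover [SecondCountableTopology L] :
    ∃ s : Set L, s.Countable ∧ ∀ x, ∃ i ∈ s, x ∈ 𝒯.base i := by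
  obtain ⟨s, hs, h⟩ := TopologicalSpace.countable_cover_nhds
    fun x ↦ (𝒯.isOpen_base x).mem_nhds (𝒯.mem_base x)
  refine ⟨s, hs, fun x ↦ ?_⟩
  have : x ∈ ⋃ i ∈ s, 𝒯.base i := h ▸ mem_univ x
  simpa using this

include 𝒯 in
theorem secondCountableTopology [FiniteDimensional ℝ EL] [FiniteDimensional ℝ V]
    [SecondCountableTopology L] : SecondCountableTopology B := by
  obtain ⟨s, hs, h⟩ := 𝒯.exists_countable_cover
  have : Countable s := hs.to_subtype
  have : ∀ i : s, SecondCountableTopology (𝒯.chart i).source := fun i ↦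
    (𝒯.chart i).toHomeomorphSourceTarget.secondCountableTopology
  refine TopologicalSpace.secondCountableTopology_of_countable_cover
    (fun i : s ↦ (𝒯.chart i).open_source) ?_
  refine eq_univ_of_forall fun b ↦ ?_
  obtain ⟨i, hi, hb⟩ := h (𝒯.proj b)
  exact mem_iUnion.2 ⟨⟨i, hi⟩, 𝒯.mem_source.2 hb⟩

/-- The charted space structure given by the local trivializations. -/
@[reducible] def chartedSpace : ChartedSpace (EL × V) B where
  atlas := range 𝒯.chart
  chartAt b := 𝒯.chart (𝒯.proj b)
  mem_chart_source _ := 𝒯.mem_source.2 (𝒯.mem_base _)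
  chart_mem_atlas _ := mem_range_self _

theorem contDiffAt_baseChange [IsManifold 𝓘(ℝ, EL) ∞ L] {i j : L} {y : EL}
    (hy : y ∈ (chartAt EL i).target) (hj : (chartAt EL i).symm y ∈ (chartAt EL j).source) :
    ContDiffAt ℝ ∞ (baseChange i j) y := by
  have := contDiffAt_coordChange (E := EL) i j (y := y) (by simpa using hy) (by simpa using hj)
  simpa [baseChange, mfld_simps] using this

theorem contDiffAt_transCoord [IsManifold 𝓘(ℝ, EL) ∞ L] {i j : L} {y : EL} (hy : y ∈ 𝒯.dom i)
    (hj : (chartAt EL i).symm y ∈ 𝒯.base j) : ContDiffAt ℝ ∞ (𝒯.transCoord i j) y := by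
  rw [← contMDiffAt_iff_contDiffAt]
  have h1 := (𝒯.contMDiffOn_trans i j).contMDiffAt
    (((𝒯.isOpen_base i).inter (𝒯.isOpen_base j)).mem_nhds ⟨hy.2, hj⟩)
  have h2 := contMDiffAt_extChartAt_symm (E := EL) i (y := y) (by simpa using hy.1)
  simp only [mfld_simps] at h2
  exact h1.comp y h2

theorem isManifold [IsManifold 𝓘(ℝ, EL) ∞ L] :
    @IsManifold ℝ _ (EL × V) _ _ (EL × V) _ 𝓘(ℝ, EL × V) ∞ B _ 𝒯.chartedSpace := by
  let _ := 𝒯.chartedSpace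
  refine isManifold_of_contDiffOn _ _ _ ?_
  rintro _ _ ⟨i, rfl⟩ ⟨j, rfl⟩
  simp only [modelWithCornersSelf_coe, modelWithCornersSelf_coe_symm, range_id, inter_univ,
    Function.id_comp, Function.comp_id, preimage_id]
  rintro z hz
  have hz' : z ∈ (𝒯.chart i).target ∧ (𝒯.chart i).symm z ∈ (𝒯.chart j).source := by
    simpa [mfld_simps] using hz
  rw [𝒯.mem_target, 𝒯.mem_source] at hz'
  obtain ⟨h1, h2⟩ := hz'
  rw [𝒯.proj_symm h1] at h2
  have h3 : ContDiffAt ℝ ∞ (fun z : EL × V ↦ ((baseChange i j z.1 : EL),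
      𝒯.transCoord i j z.1 z.2)) z :=
    ((contDiffAt_baseChange h1.1 (𝒯.base_subset j h2)).comp z contDiffAt_fst).prodMk
      (((𝒯.contDiffAt_transCoord h1 h2).comp z contDiffAt_fst).clm_apply contDiffAt_snd)
  refine (h3.congr_of_eventuallyEq ?_).contDiffWithinAt
  filter_upwards [((𝒯.isOpen_overlap i j).preimage continuous_fst).mem_nhds ⟨h1, h2⟩] with z' hz'
  exact 𝒯.chart_change hz'.1 hz'.2

end BundleAtlas

section Leaf

variable {V : Type*} [NormedAddCommGroup V] [InnerProductSpace ℝ V] {𝓕 : Set (Set V)}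

theorem leafIsometries_apply_mem_iff {S : Set V} (hS : S ∈ 𝓕) (g : leafIsometries 𝓕) (v : V) :
    (g : V ≃ₗᵢ[ℝ] V) v ∈ S ↔ v ∈ S := by
  have h : ((g : V ≃ₗᵢ[ℝ] V) : V → V) '' S = S := g.2 S hS
  constructor
  · intro hv
    rw [← h] at hv
    obtain ⟨v', hv', he⟩ := hv
    rwa [← (g : V ≃ₗᵢ[ℝ] V).injective he]
  · intro hv
    rw [← h]
    exact ⟨v, hv, rfl⟩

namespace BundleAtlas

variable {EL : Type*} [NormedAddCommGroup EL] [NormedSpace ℝ EL]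
  {L : Type*} [TopologicalSpace L] [ChartedSpace EL L] {B : Type*} [TopologicalSpace B]

/-- The subset of the bundle whose intersection with each fibre corresponds to `S`. -/
def leaf {G : Subgroup (V ≃ₗᵢ[ℝ] V)} (𝒯 : BundleAtlas G EL L B) (S : Set V) : Set B :=
  {b | (𝒯.chart (𝒯.proj b) b).2 ∈ S}

variable (𝒯 : BundleAtlas (leafIsometries 𝓕) EL L B)

theorem mem_leaf_iff {S : Set V} (hS : S ∈ 𝓕) {i : L} {b : B} (hb : 𝒯.proj b ∈ 𝒯.base i) :
    b ∈ 𝒯.leaf S ↔ (𝒯.chart i b).2 ∈ S := by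
  rw [𝒯.snd_chart (𝒯.proj b) i b (𝒯.mem_base _) hb, leafIsometries_apply_mem_iff hS]
  rfl

theorem symm_mem_leaf_iff {S : Set V} (hS : S ∈ 𝓕) {i : L} {z : EL × V} (hz : z.1 ∈ 𝒯.dom i) :
    (𝒯.chart i).symm z ∈ 𝒯.leaf S ↔ z.2 ∈ S := by
  rw [𝒯.mem_leaf_iff hS (i := i) (by rw [𝒯.proj_symm hz]; exact hz.2), 𝒯.chart_symm_apply hz]

end BundleAtlas

end Leaf

/-! ### Local trivializations of the associated bundle -/

section Principal

variable {V : Type*} [NormedAddCommGroup V] [InnerProductSpace ℝ V]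
  {G : Subgroup (V ≃ₗᵢ[ℝ] V)}
  {EL : Type*} [NormedAddCommGroup EL] [NormedSpace ℝ EL]
  {L : Type*} [TopologicalSpace L] [ChartedSpace EL L]
  {EG : Type*} [NormedAddCommGroup EG] [NormedSpace ℝ EG]
  [TopologicalSpace G] [ChartedSpace EG G]
  {EP : Type*} [NormedAddCommGroup EP] [NormedSpace ℝ EP]
  {P : Type*} [TopologicalSpace P] [ChartedSpace EP P]
  [MulAction (MulOpposite G) P] {pr : P → L}

namespace IsPrincipalBundle

variable (hP : IsPrincipalBundle (EL := EL) (EP := EP) EG G pr)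

/-- The domain of a chosen trivialization of the principal bundle near a point of the base. -/
def trivBase (i : L) : Set L := (hP.exists_trivialization i).choose

theorem isOpen_trivBase (i : L) : IsOpen (hP.trivBase i) :=
  (hP.exists_trivialization i).choose_spec.1

theorem mem_trivBase (i : L) : i ∈ hP.trivBase i := (hP.exists_trivialization i).choose_spec.2.1

/-- A chosen trivialization of the principal bundle near a point of the base. -/
def triv (i : L) : PartialDiffeomorph 𝓘(ℝ, EP) (𝓘(ℝ, EL).prod 𝓘(ℝ, EG)) P (L × G) ∞ :=
  (hP.exists_trivialization i).choose_spec.2.2.choose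

theorem triv_spec (i : L) : (hP.triv i).source = pr ⁻¹' hP.trivBase i ∧
    (hP.triv i).target = hP.trivBase i ×ˢ univ ∧
    (∀ p ∈ (hP.triv i).source, (hP.triv i p).1 = pr p) ∧
    ∀ p ∈ (hP.triv i).source, ∀ g : G,
      (hP.triv i (MulOpposite.op g • p)).2 = (hP.triv i p).2 * g :=
  (hP.exists_trivialization i).choose_spec.2.2.choose_spec

theorem triv_fst {i : L} {p : P} (hp : pr p ∈ hP.trivBase i) : (hP.triv i p).1 = pr p :=
  (hP.triv_spec i).2.2.1 p ((hP.triv_spec i).1 ▸ hp)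

theorem triv_smul {i : L} {p : P} (hp : pr p ∈ hP.trivBase i) (g : G) :
    (hP.triv i (MulOpposite.op g • p)).2 = (hP.triv i p).2 * g :=
  (hP.triv_spec i).2.2.2 p ((hP.triv_spec i).1 ▸ hp) g

/-- The local section of the principal bundle through the element `g` of the structure group. -/
def section' (i : L) (x : L) (g : G) : P := (hP.triv i).toPartialEquiv.symm (x, g)

theorem triv_section {i x : L} (hx : x ∈ hP.trivBase i) (g : G) :
    hP.triv i (hP.section' i x g) = (x, g) :=
  (hP.triv i).toPartialEquiv.right_inv ((hP.triv_spec i).2.1 ▸ ⟨hx, mem_univ _⟩)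

theorem pr_section {i x : L} (hx : x ∈ hP.trivBase i) (g : G) :
    pr (hP.section' i x g) = x := by
  have h1 : hP.section' i x g ∈ (hP.triv i).source :=
    (hP.triv i).toPartialEquiv.map_target ((hP.triv_spec i).2.1 ▸ ⟨hx, mem_univ _⟩)
  rw [← (hP.triv_spec i).2.2.1 _ h1, hP.triv_section hx]

theorem section_triv {i : L} {p : P} (hp : pr p ∈ hP.trivBase i) :
    hP.section' i (pr p) (hP.triv i p).2 = p := by
  have h1 : p ∈ (hP.triv i).source := (hP.triv_spec i).1 ▸ hp
  have h2 : hP.triv i p = (pr p, (hP.triv i p).2) := Prod.ext (hP.triv_fst hp) rfl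
  rw [section', ← h2]
  exact (hP.triv i).toPartialEquiv.left_inv h1

theorem section_mul {i x : L} (hx : x ∈ hP.trivBase i) (g k : G) :
    MulOpposite.op k • hP.section' i x g = hP.section' i x (g * k) := by
  have h1 := hP.pr_section hx g
  have h2 : pr (MulOpposite.op k • hP.section' i x g) = x := by rw [hP.proj_action, h1]
  have h3 := hP.section_triv (i := i) (p := MulOpposite.op k • hP.section' i x g) (h2.symm ▸ hx)
  rw [← h3, h2, hP.triv_smul (h1.symm ▸ hx), hP.triv_section hx]

theorem contMDiffAt_triv {i : L} {p : P} (hp : pr p ∈ hP.trivBase i) :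
    ContMDiffAt 𝓘(ℝ, EP) (𝓘(ℝ, EL).prod 𝓘(ℝ, EG)) ∞ (hP.triv i) p :=
  (hP.triv i).contMDiffOn_toFun.contMDiffAt
    ((hP.triv i).open_source.mem_nhds ((hP.triv_spec i).1 ▸ hp))

theorem contMDiffAt_section {i x : L} (hx : x ∈ hP.trivBase i) (g : G) :
    ContMDiffAt 𝓘(ℝ, EL) 𝓘(ℝ, EP) ∞ (fun x ↦ hP.section' i x g) x := by
  have h1 : ContMDiffAt (𝓘(ℝ, EL).prod 𝓘(ℝ, EG)) 𝓘(ℝ, EP) ∞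
      (hP.triv i).toPartialEquiv.symm (x, g) :=
    (hP.triv i).contMDiffOn_invFun.contMDiffAt
      ((hP.triv i).open_target.mem_nhds ((hP.triv_spec i).2.1 ▸ ⟨hx, mem_univ _⟩))
  exact h1.comp x (contMDiffAt_id.prodMk contMDiffAt_const)

end IsPrincipalBundle

omit [TopologicalSpace G] [TopologicalSpace P] in
theorem AssocBundle.mk_eq_mk {p : P} {v : V} (g : G) :
    AssocBundle.mk G (MulOpposite.op g • p, v) = AssocBundle.mk G (p, (g : V ≃ₗᵢ[ℝ] V) v) :=
  (Quotient.sound (s := assocSetoid G P) ⟨g, rfl, rfl⟩ :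
    Quotient.mk (assocSetoid G P) (p, (g : V ≃ₗᵢ[ℝ] V) v) = _).symm

omit [TopologicalSpace G] [TopologicalSpace P] in
theorem AssocBundle.mk_surjective : Function.Surjective (AssocBundle.mk (P := P) G) :=
  Quotient.mk_surjective

omit [TopologicalSpace G] in
theorem AssocBundle.isQuotientMap_mk : Topology.IsQuotientMap (AssocBundle.mk (P := P) G) :=
  isQuotientMap_quotient_mk'

namespace IsPrincipalBundle

variable (hP : IsPrincipalBundle (EL := EL) (EP := EP) EG G pr)

/-- The fibre coordinate of the associated bundle given by a trivialization of the principal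
bundle; it is only meaningful over the domain of the trivialization. -/
def fibreCoord (i : L) (b : AssocBundle G P) : V :=
  ((hP.triv i (Quotient.out b).1).2 : V ≃ₗᵢ[ℝ] V) (Quotient.out b).2

theorem fibreCoord_mk {i : L} {p : P} (hp : pr p ∈ hP.trivBase i) (v : V) :
    hP.fibreCoord i (AssocBundle.mk G (p, v)) = ((hP.triv i p).2 : V ≃ₗᵢ[ℝ] V) v := by
  obtain ⟨g, h1, h2⟩ := Quotient.mk_out (s := assocSetoid G P) (p, v)
  simp only at h1 h2
  set a := Quotient.out (AssocBundle.mk G (p, v)) with ha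
  have h1' : p = MulOpposite.op g • a.1 := h1
  have h2' : a.2 = (g : V ≃ₗᵢ[ℝ] V) v := h2
  have h3 : pr a.1 = pr p := by rw [h1', hP.proj_action]
  rw [fibreCoord, ← ha, h2']
  conv_rhs => rw [h1', hP.triv_smul (h3.symm ▸ hp)]
  rfl

/-- The associated bundle is locally trivial over the coordinate domains. -/
def bundleAtlas (hG : IsLieSubgroupStructure (EG := EG) G) [IsManifold 𝓘(ℝ, EL) ∞ L] :
    BundleAtlas G EL L (AssocBundle G P) where
  proj := AssocBundle.proj pr hP.proj_action
  base i := hP.trivBase i ∩ (chartAt EL i).source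
  isOpen_base i := (hP.isOpen_trivBase i).inter (chartAt EL i).open_source
  mem_base i := ⟨hP.mem_trivBase i, mem_chart_source EL i⟩
  base_subset i := inter_subset_right
  chart i :=
    { toFun := fun b ↦ (chartAt EL i (AssocBundle.proj pr hP.proj_action b), hP.fibreCoord i b)
      invFun := fun z ↦ AssocBundle.mk G (hP.section' i ((chartAt EL i).symm z.1) 1, z.2)
      source := AssocBundle.proj pr hP.proj_action ⁻¹' (hP.trivBase i ∩ (chartAt EL i).source)
      target := {z | z.1 ∈ (chartAt EL i).target ∧
        (chartAt EL i).symm z.1 ∈ hP.trivBase i ∩ (chartAt EL i).source}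
      map_source' := by
        intro b hb
        refine ⟨(chartAt EL i).map_source hb.2, ?_⟩
        simp only
        rw [(chartAt EL i).left_inv hb.2]
        exact hb
      map_target' := by
        rintro z ⟨h1, h2⟩
        show pr (hP.section' i ((chartAt EL i).symm z.1) 1) ∈ hP.trivBase i ∩ (chartAt EL i).source
        rw [hP.pr_section h2.1]
        exact h2
      left_inv' := by
        intro b hb
        obtain ⟨⟨p, v⟩, rfl⟩ := AssocBundle.mk_surjective b
        have hp : pr p ∈ hP.trivBase i := hb.1
        have h1 : (chartAt EL i).symm (chartAt EL i (pr p)) = pr p :=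
          (chartAt EL i).left_inv hb.2
        show AssocBundle.mk G (hP.section' i ((chartAt EL i).symm (chartAt EL i (pr p))) 1,
          hP.fibreCoord i (AssocBundle.mk G (p, v))) = _
        rw [h1, hP.fibreCoord_mk hp, ← AssocBundle.mk_eq_mk, hP.section_mul hp, one_mul,
          hP.section_triv hp]
      right_inv' := by
        rintro ⟨y, v⟩ ⟨h1, h2⟩
        simp only at h1 h2
        have h3 := hP.pr_section h2.1 1
        refine Prod.ext ?_ ?_
        · show chartAt EL i (pr (hP.section' i ((chartAt EL i).symm y) 1)) = y
          rw [h3, (chartAt EL i).right_inv h1]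
        · show hP.fibreCoord i (AssocBundle.mk G (hP.section' i ((chartAt EL i).symm y) 1, v)) = v
          rw [hP.fibreCoord_mk (h3.symm ▸ h2.1), hP.triv_section h2.1]
          rfl
      open_source := by
        refine ((hP.isOpen_trivBase i).inter (chartAt EL i).open_source).preimage ?_
        exact AssocBundle.isQuotientMap_mk.continuous_iff.2
          (hP.contMDiff_proj.continuous.comp continuous_fst)
      open_target := ((chartAt EL i).isOpen_inter_preimage_symm
        ((hP.isOpen_trivBase i).inter (chartAt EL i).open_source)).preimage continuous_fst
      continuousOn_toFun := by
        have hpc : Continuous (AssocBundle.proj pr hP.proj_action) :=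
          AssocBundle.isQuotientMap_mk.continuous_iff.2
            (hP.contMDiff_proj.continuous.comp continuous_fst)
        have ho : IsOpen (AssocBundle.proj pr hP.proj_action ⁻¹'
            (hP.trivBase i ∩ (chartAt EL i).source)) :=
          ((hP.isOpen_trivBase i).inter (chartAt EL i).open_source).preimage hpc
        rw [AssocBundle.isQuotientMap_mk.continuousOn_isOpen_iff ho]
        rintro ⟨p, v⟩ hpv
        have hp : pr p ∈ hP.trivBase i ∩ (chartAt EL i).source := hpv
        refine ContinuousAt.continuousWithinAt (ContinuousAt.prodMk ?_ ?_)
        · show ContinuousAt (fun a : P × V ↦ chartAt EL i (pr a.1)) (p, v)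
          exact ContinuousAt.comp (g := chartAt EL i) ((chartAt EL i).continuousAt hp.2)
            (hP.contMDiff_proj.continuous.continuousAt.comp continuousAt_fst)
        · have h1 : ContinuousAt (fun a : P × V ↦
              (((hP.triv i a.1).2 : V ≃ₗᵢ[ℝ] V) : V →L[ℝ] V) a.2) (p, v) := by
            refine ContinuousAt.clm_apply ?_ continuousAt_snd
            refine hG.contMDiff_coe.continuous.continuousAt.comp (continuousAt_snd.comp ?_)
            exact ContinuousAt.comp (g := hP.triv i) (hP.contMDiffAt_triv hp.1).continuousAt
              continuousAt_fst
          refine h1.congr ?_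
          have h2 : ∀ᶠ a : P × V in 𝓝 (p, v), pr a.1 ∈ hP.trivBase i :=
            (hP.contMDiff_proj.continuous.continuousAt.comp continuousAt_fst).preimage_mem_nhds
              ((hP.isOpen_trivBase i).mem_nhds hp.1)
          filter_upwards [h2] with a ha
          exact (hP.fibreCoord_mk ha a.2).symm
      continuousOn_invFun := by
        rintro z ⟨h1, h2⟩
        refine ContinuousAt.continuousWithinAt ?_
        refine AssocBundle.isQuotientMap_mk.continuous.continuousAt.comp
          (ContinuousAt.prodMk ?_ continuousAt_snd)
        refine ContinuousAt.comp (g := fun x ↦ hP.section' i x 1)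
          (hP.contMDiffAt_section h2.1 1).continuousAt ?_
        exact ContinuousAt.comp (g := (chartAt EL i).symm)
          ((chartAt EL i).continuousAt_symm h1) continuousAt_fst }
  source_eq _ := rfl
  target_eq _ := rfl
  fst_chart _ _ _ := rfl
  trans i j x := (hP.triv j (hP.section' i x 1)).2
  contMDiffOn_trans i j := by
    rintro x ⟨hi, hj⟩
    refine ContMDiffAt.contMDiffWithinAt ?_
    refine hG.contMDiff_coe.contMDiffAt.comp x ?_
    have h1 : ContMDiffAt 𝓘(ℝ, EL) (𝓘(ℝ, EL).prod 𝓘(ℝ, EG)) ∞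
        (fun x ↦ hP.triv j (hP.section' i x 1)) x :=
      (hP.contMDiffAt_triv (by rw [hP.pr_section hi.1]; exact hj.1)).comp x
        (hP.contMDiffAt_section hi.1 1)
    exact contMDiffAt_snd.comp x h1
  snd_chart i j b hi hj := by
    obtain ⟨⟨p, v⟩, rfl⟩ := AssocBundle.mk_surjective b
    have hpi : pr p ∈ hP.trivBase i := hi.1
    have hpj : pr p ∈ hP.trivBase j := hj.1
    show hP.fibreCoord j (AssocBundle.mk G (p, v)) =
      ((hP.triv j (hP.section' i (pr p) 1)).2 : V ≃ₗᵢ[ℝ] V)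
        (hP.fibreCoord i (AssocBundle.mk G (p, v)))
    rw [hP.fibreCoord_mk hpi, hP.fibreCoord_mk hpj]
    conv_lhs => rw [← hP.section_triv hpi, ← one_mul (hP.triv i p).2, ← hP.section_mul hpi,
      hP.triv_smul (by rw [hP.pr_section hpi]; exact hpj)]
    rfl

end IsPrincipalBundle

end Principal

/-! ### The quotient map and the leaves of the associated bundle -/

section QuotientMap

variable {V : Type*} [NormedAddCommGroup V] [InnerProductSpace ℝ V]
  {G : Subgroup (V ≃ₗᵢ[ℝ] V)}
  {EL : Type*} [NormedAddCommGroup EL] [NormedSpace ℝ EL]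
  {L : Type*} [TopologicalSpace L] [ChartedSpace EL L] [IsManifold 𝓘(ℝ, EL) ∞ L]
  {EG : Type*} [NormedAddCommGroup EG] [NormedSpace ℝ EG]
  [TopologicalSpace G] [ChartedSpace EG G]
  {EP : Type*} [NormedAddCommGroup EP] [NormedSpace ℝ EP]
  {P : Type*} [TopologicalSpace P] [ChartedSpace EP P]
  [MulAction (MulOpposite G) P] {pr : P → L}

namespace IsPrincipalBundle

variable (hP : IsPrincipalBundle (EL := EL) (EP := EP) EG G pr)
  (hG : IsLieSubgroupStructure (EG := EG) G)
  [ChartedSpace (EL × V) (AssocBundle G P)]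
  (hB : ∀ b : AssocBundle G P, chartAt (EL × V) b =
    (hP.bundleAtlas hG).chart ((hP.bundleAtlas hG).proj b))

include hB in
theorem contMDiff_mk : ContMDiff (𝓘(ℝ, EP).prod 𝓘(ℝ, V)) 𝓘(ℝ, EL × V) ∞
    (AssocBundle.mk (P := P) G) := by
  rintro ⟨p, v⟩
  rw [contMDiffAt_iff_target]
  refine ⟨AssocBundle.isQuotientMap_mk.continuous.continuousAt, ?_⟩
  have hx : pr p ∈ hP.trivBase (pr p) := hP.mem_trivBase _
  have h2 : ContMDiffAt (𝓘(ℝ, EP).prod 𝓘(ℝ, V)) 𝓘(ℝ, V) ∞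
      (fun a : P × V ↦ (((hP.triv (pr p) a.1).2 : V ≃ₗᵢ[ℝ] V) : V →L[ℝ] V) a.2) (p, v) := by
    refine ContMDiffAt.clm_apply ?_ contMDiffAt_snd
    refine hG.contMDiff_coe.contMDiffAt.comp (p, v) ?_
    exact contMDiffAt_snd.comp (p, v) ((hP.contMDiffAt_triv hx).comp (p, v) contMDiffAt_fst)
  have h1 : ContMDiffAt (𝓘(ℝ, EP).prod 𝓘(ℝ, V)) 𝓘(ℝ, EL) ∞
      (fun a : P × V ↦ extChartAt 𝓘(ℝ, EL) (pr p) (pr a.1)) (p, v) :=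
    ContMDiffAt.comp (p, v) (contMDiffAt_extChartAt)
      (hP.contMDiff_proj.contMDiffAt.comp (p, v) contMDiffAt_fst)
  refine (h1.prodMk_space h2).congr_of_eventuallyEq ?_
  have h3 : ∀ᶠ a : P × V in 𝓝 (p, v), pr a.1 ∈ hP.trivBase (pr p) :=
    (hP.contMDiff_proj.continuous.continuousAt.comp continuousAt_fst).preimage_mem_nhds
      ((hP.isOpen_trivBase _).mem_nhds hx)
  filter_upwards [h3] with a ha
  simp only [extChartAt, hB, Function.comp_apply, mfld_simps]
  exact Prod.ext rfl (hP.fibreCoord_mk ha a.2)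

include hB in
theorem surjective_mfderiv_mk [IsManifold 𝓘(ℝ, EL × V) ∞ (AssocBundle G P)] (a : P × V) :
    Function.Surjective (mfderiv (𝓘(ℝ, EP).prod 𝓘(ℝ, V)) 𝓘(ℝ, EL × V)
      (AssocBundle.mk (P := P) G) a) := by
  obtain ⟨p, v⟩ := a
  set i := pr p with hi
  have hx : i ∈ hP.trivBase i := hP.mem_trivBase _
  set b := AssocBundle.mk G (p, v) with hb
  set g := (hP.triv i p).2 with hg
  set z₀ : EL × V := (chartAt EL i i, (g : V ≃ₗᵢ[ℝ] V) v) with hz₀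
  have hz₀' : extChartAt 𝓘(ℝ, EL × V) b b = z₀ := by
    simp only [extChartAt, hB, mfld_simps]
    exact Prod.ext rfl (hP.fibreCoord_mk hx v)
  -- a local section of the quotient map
  let σ : EL × V → P × V := fun z ↦ (hP.section' i ((chartAt EL i).symm z.1) g,
    ((g⁻¹ : G) : V ≃ₗᵢ[ℝ] V) z.2)
  have hσ0 : σ z₀ = (p, v) := by
    refine Prod.ext ?_ ?_
    · show hP.section' i ((chartAt EL i).symm (chartAt EL i i)) g = p
      rw [(chartAt EL i).left_inv (mem_chart_source EL i)]
      exact hP.section_triv hx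
    · exact (g : V ≃ₗᵢ[ℝ] V).symm_apply_apply v
  have h0 : (chartAt EL i).symm z₀.1 = i := (chartAt EL i).left_inv (mem_chart_source EL i)
  have hσ : ContMDiffAt 𝓘(ℝ, EL × V) (𝓘(ℝ, EP).prod 𝓘(ℝ, V)) ∞ σ z₀ := by
    refine ContMDiffAt.prodMk ?_ ?_
    · have h1 : ContMDiffAt 𝓘(ℝ, EL) 𝓘(ℝ, EL) ∞ (chartAt EL i).symm z₀.1 := by
        have := contMDiffAt_extChartAt_symm (E := EL) i (mem_extChartAt_target i)
        simpa only [mfld_simps] using this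
      have h2 : ContMDiffAt 𝓘(ℝ, EL × V) 𝓘(ℝ, EL) ∞ (Prod.fst : EL × V → EL) z₀ :=
        contDiff_fst.contMDiff.contMDiffAt
      have h3 := hP.contMDiffAt_section (x := (chartAt EL i).symm z₀.1) (by rw [h0]; exact hx) g
      exact ContMDiffAt.comp z₀ (g := fun x ↦ hP.section' i x g)
        (f := fun z : EL × V ↦ (chartAt EL i).symm z.1) h3 (ContMDiffAt.comp z₀ h1 h2)
    · exact ((((g⁻¹ : G) : V ≃ₗᵢ[ℝ] V) : V →L[ℝ] V).contDiff.comp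
        contDiff_snd).contMDiff.contMDiffAt
  have hcomp : (AssocBundle.mk G ∘ σ) =ᶠ[𝓝 z₀] (extChartAt 𝓘(ℝ, EL × V) b).symm := by
    have h1 := ((hP.bundleAtlas hG).chart i).open_target.mem_nhds
      (((hP.bundleAtlas hG).chart i).map_source
        ((hP.bundleAtlas hG).mem_source.2 ((hP.bundleAtlas hG).mem_base i) : b ∈ _))
    have h2 : (hP.bundleAtlas hG).chart i b = z₀ := Prod.ext rfl (hP.fibreCoord_mk hx v)
    rw [h2] at h1
    filter_upwards [h1] with z hz
    simp only [extChartAt, hB, mfld_simps]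
    show AssocBundle.mk G (hP.section' i ((chartAt EL i).symm z.1) g,
      ((g⁻¹ : G) : V ≃ₗᵢ[ℝ] V) z.2) = AssocBundle.mk G (hP.section' i ((chartAt EL i).symm z.1) 1,
        z.2)
    have h3 := ((hP.bundleAtlas hG).mem_target.1 hz).2.1
    rw [← one_mul g, ← hP.section_mul h3, one_mul, AssocBundle.mk_eq_mk]
    congr 2
    exact (g : V ≃ₗᵢ[ℝ] V).apply_symm_apply z.2
  have hmk : MDifferentiableAt (𝓘(ℝ, EP).prod 𝓘(ℝ, V)) 𝓘(ℝ, EL × V)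
      (AssocBundle.mk (P := P) G) (σ z₀) :=
    (hP.contMDiff_mk hG hB).mdifferentiable (by simp) _
  have hd := mfderiv_comp z₀ hmk (hσ.mdifferentiableAt (by simp))
  rw [hcomp.mfderiv_eq] at hd
  have hsymm := mfderiv_extChartAt_symm_eq (E := EL × V) b (mem_extChartAt_target b)
  rw [hz₀'] at hsymm
  have hid : fderiv ℝ (extChartAt 𝓘(ℝ, EL × V) ((extChartAt 𝓘(ℝ, EL × V) b).symm z₀) ∘
        (extChartAt 𝓘(ℝ, EL × V) b).symm) z₀ = ContinuousLinearMap.id ℝ _ := by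
    have h1 : (extChartAt 𝓘(ℝ, EL × V) b).symm z₀ = b := by
      rw [← hz₀']; exact extChartAt_to_inv b
    rw [h1]
    have h2 : (extChartAt 𝓘(ℝ, EL × V) b ∘ (extChartAt 𝓘(ℝ, EL × V) b).symm) =ᶠ[𝓝 z₀] id := by
      have h3 := extChartAt_target_mem_nhds (I := 𝓘(ℝ, EL × V)) b
      rw [hz₀'] at h3
      filter_upwards [h3] with z hz
      exact (extChartAt 𝓘(ℝ, EL × V) b).right_inv hz
    rw [h2.fderiv_eq, fderiv_id]
  rw [← hσ0]
  intro w
  refine ⟨mfderiv 𝓘(ℝ, EL × V) (𝓘(ℝ, EP).prod 𝓘(ℝ, V)) σ z₀ (w : EL × V), ?_⟩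
  have h1 := DFunLike.congr_fun hd (w : EL × V)
  refine h1.symm.trans ?_
  refine (DFunLike.congr_fun hsymm (w : EL × V)).trans ?_
  rw [hid]
  rfl

end IsPrincipalBundle

end QuotientMap

section Leaves

variable {V : Type*} [NormedAddCommGroup V] [InnerProductSpace ℝ V] {𝓕 : Set (Set V)}
  {EL : Type*} [NormedAddCommGroup EL] [NormedSpace ℝ EL]
  {L : Type*} [TopologicalSpace L] [ChartedSpace EL L] [IsManifold 𝓘(ℝ, EL) ∞ L]
  {EG : Type*} [NormedAddCommGroup EG] [NormedSpace ℝ EG]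
  [TopologicalSpace (leafIsometries 𝓕)] [ChartedSpace EG (leafIsometries 𝓕)]
  {EP : Type*} [NormedAddCommGroup EP] [NormedSpace ℝ EP]
  {P : Type*} [TopologicalSpace P] [ChartedSpace EP P]
  [MulAction (MulOpposite (leafIsometries 𝓕)) P] {pr : P → L}

namespace IsPrincipalBundle

variable (hP : IsPrincipalBundle (EL := EL) (EP := EP) EG (leafIsometries 𝓕) pr)
  (hG : IsLieSubgroupStructure (EG := EG) (leafIsometries 𝓕))

/-- The leaf of the associated bundle given by `S` consists of the classes `[p, v]` with `v ∈ S`. -/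
theorem mk_mem_leaf_iff {S : Set V} (hS : S ∈ 𝓕) (p : P) (v : V) :
    AssocBundle.mk (leafIsometries 𝓕) (p, v) ∈ (hP.bundleAtlas hG).leaf S ↔ v ∈ S := by
  have h : ((hP.bundleAtlas hG).chart (pr p) (AssocBundle.mk (leafIsometries 𝓕) (p, v))).2 =
      ((hP.triv (pr p) p).2 : V ≃ₗᵢ[ℝ] V) v := hP.fibreCoord_mk (hP.mem_trivBase _) v
  show ((hP.bundleAtlas hG).chart (pr p) (AssocBundle.mk (leafIsometries 𝓕) (p, v))).2 ∈ S ↔ _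
  rw [h, leafIsometries_apply_mem_iff hS]

variable {p₀ : P}

/-- The leaves of `P ×_G 𝓕₀` are the sets associated to the (possibly disconnected) leaves of
`𝓕`, because the structure group is transitive on the components of these. -/
theorem assocFoliation_eq (h𝓕 : Setoid.IsPartition 𝓕)
    (hH : ∀ S ∈ 𝓕, ∀ x ∈ S, ∀ y ∈ S, ∃ g : leafIsometries 𝓕,
      (Quotient.mk (pathSetoid _) g : ZerothHomotopy (leafIsometries 𝓕)) ∈
        monodromyImage pr p₀ ∧ JoinedIn S ((g : V ≃ₗᵢ[ℝ] V) x) y) :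
    assocFoliation (P := P) (leafIsometries 𝓕) (connectedLeaves 𝓕) =
      (hP.bundleAtlas hG).leaf '' 𝓕 := by
  have key : ∀ S ∈ 𝓕, ∀ x ∈ S, AssocBundle.mk (leafIsometries 𝓕) ''
      ((univ : Set P) ×ˢ pathComponentIn S x) = (hP.bundleAtlas hG).leaf S := by
    intro S hS x hx
    apply Subset.antisymm
    · rintro _ ⟨⟨p, v⟩, ⟨-, hv⟩, rfl⟩
      exact (hP.mk_mem_leaf_iff hG hS p v).2 (pathComponentIn_subset hv)
    · intro b hb
      obtain ⟨⟨p, v⟩, rfl⟩ := AssocBundle.mk_surjective b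
      rw [hP.mk_mem_leaf_iff hG hS] at hb
      obtain ⟨g, -, hg⟩ := hH S hS x hx v hb
      refine ⟨(MulOpposite.op g • p, (g : V ≃ₗᵢ[ℝ] V).symm v), ⟨mem_univ _, ?_⟩, ?_⟩
      · have h1 := JoinedIn.map hg (f := (g : V ≃ₗᵢ[ℝ] V).symm)
          (g : V ≃ₗᵢ[ℝ] V).symm.continuous
        rw [LinearIsometryEquiv.symm_apply_apply] at h1
        refine h1.mono ?_
        rintro _ ⟨w, hw, rfl⟩
        exact (leafIsometries_apply_mem_iff hS g⁻¹ w).2 hw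
      · rw [AssocBundle.mk_eq_mk, LinearIsometryEquiv.apply_symm_apply]
  ext D
  constructor
  · rintro ⟨_, ⟨S, hS, x, hx, rfl⟩, rfl⟩
    exact ⟨S, hS, (key S hS x hx).symm⟩
  · rintro ⟨S, hS, rfl⟩
    obtain ⟨x, hx⟩ := Setoid.nonempty_of_mem_partition h𝓕 hS
    exact ⟨_, ⟨S, hS, x, hx, rfl⟩, (key S hS x hx).symm⟩

/-- Two points of a leaf over the base point of the monodromy are joined in the leaf. -/
theorem joinedIn_leaf_base (hH : ∀ S ∈ 𝓕, ∀ x ∈ S, ∀ y ∈ S, ∃ g : leafIsometries 𝓕,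
      (Quotient.mk (pathSetoid _) g : ZerothHomotopy (leafIsometries 𝓕)) ∈
        monodromyImage pr p₀ ∧ JoinedIn S ((g : V ≃ₗᵢ[ℝ] V) x) y)
    {S : Set V} (hS : S ∈ 𝓕) {v w : V} (hv : v ∈ S) (hw : w ∈ S) :
    JoinedIn ((hP.bundleAtlas hG).leaf S) (AssocBundle.mk (leafIsometries 𝓕) (p₀, v))
      (AssocBundle.mk (leafIsometries 𝓕) (p₀, w)) := by
  obtain ⟨g, ⟨γ, g', γ', -, hgg⟩, hg⟩ := hH S hS v hv w hw
  have hmk : Continuous (AssocBundle.mk (P := P) (leafIsometries 𝓕)) :=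
    AssocBundle.isQuotientMap_mk.continuous
  have hj : Joined g g' := Quotient.exact hgg
  have h1 : JoinedIn ((hP.bundleAtlas hG).leaf S) (AssocBundle.mk (leafIsometries 𝓕) (p₀, v))
      (AssocBundle.mk (leafIsometries 𝓕) (p₀, (g' : V ≃ₗᵢ[ℝ] V) v)) := by
    rw [← AssocBundle.mk_eq_mk]
    have h2 : JoinedIn univ p₀ (MulOpposite.op g' • p₀) := ⟨γ', fun _ ↦ mem_univ _⟩
    refine (JoinedIn.map h2 (f := fun p ↦ AssocBundle.mk (leafIsometries 𝓕) (p, v))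
      (hmk.comp (by fun_prop))).mono ?_
    rintro _ ⟨p, -, rfl⟩
    exact (hP.mk_mem_leaf_iff hG hS _ _).2 hv
  have h2 : JoinedIn ((hP.bundleAtlas hG).leaf S)
      (AssocBundle.mk (leafIsometries 𝓕) (p₀, (g : V ≃ₗᵢ[ℝ] V) v))
      (AssocBundle.mk (leafIsometries 𝓕) (p₀, (g' : V ≃ₗᵢ[ℝ] V) v)) := by
    obtain ⟨c⟩ := hj
    have h3 : JoinedIn univ g g' := ⟨c, fun _ ↦ mem_univ _⟩
    have h4 : Continuous fun g : leafIsometries 𝓕 ↦ (((g : V ≃ₗᵢ[ℝ] V) : V →L[ℝ] V) v) :=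
      hG.contMDiff_coe.continuous.clm_apply continuous_const
    refine (JoinedIn.map h3 (f := fun g : leafIsometries 𝓕 ↦
      AssocBundle.mk (leafIsometries 𝓕) (p₀, ((g : V ≃ₗᵢ[ℝ] V) : V →L[ℝ] V) v))
      (hmk.comp (by fun_prop))).mono ?_
    rintro _ ⟨k, -, rfl⟩
    exact (hP.mk_mem_leaf_iff hG hS _ _).2 ((leafIsometries_apply_mem_iff hS k v).2 hv)
  have h3 : JoinedIn ((hP.bundleAtlas hG).leaf S)
      (AssocBundle.mk (leafIsometries 𝓕) (p₀, (g : V ≃ₗᵢ[ℝ] V) v))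
      (AssocBundle.mk (leafIsometries 𝓕) (p₀, w)) := by
    refine (JoinedIn.map hg (f := fun v ↦ AssocBundle.mk (leafIsometries 𝓕) (p₀, v))
      (hmk.comp (by fun_prop))).mono ?_
    rintro _ ⟨v, hv, rfl⟩
    exact (hP.mk_mem_leaf_iff hG hS _ _).2 hv
  exact (h1.trans h2.symm).trans h3

end IsPrincipalBundle

namespace BundleAtlas

variable {B : Type*} [TopologicalSpace B] (𝒯 : BundleAtlas (leafIsometries 𝓕) EL L B)

omit [IsManifold 𝓘(ℝ, EL) ∞ L] [TopologicalSpace (leafIsometries 𝓕)] in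
theorem isPartition_leaf [Nonempty L] (h𝓕 : Setoid.IsPartition 𝓕) :
    Setoid.IsPartition (𝒯.leaf '' 𝓕) := by
  refine ⟨?_, fun b ↦ ?_⟩
  · rintro ⟨S, hS, h⟩
    obtain ⟨x⟩ := ‹Nonempty L›
    obtain ⟨v, hv⟩ := Setoid.nonempty_of_mem_partition h𝓕 hS
    have h1 := (𝒯.symm_mem_leaf_iff hS (i := x) (z := (chartAt EL x x, v))
      (𝒯.chartAt_mem_dom (𝒯.mem_base x))).2 hv
    rw [h] at h1
    exact h1
  · obtain ⟨S, ⟨hS, hb⟩, hu⟩ := h𝓕.2 (𝒯.chart (𝒯.proj b) b).2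
    refine ⟨𝒯.leaf S, ⟨mem_image_of_mem _ hS, hb⟩, ?_⟩
    rintro _ ⟨⟨S', hS', rfl⟩, hb'⟩
    rw [hu S' ⟨hS', hb'⟩]

omit [IsManifold 𝓘(ℝ, EL) ∞ L] [TopologicalSpace (leafIsometries 𝓕)] in
/-- A leaf is path connected as soon as its intersection with one fibre lies in a path component of
the leaf, since paths of the connected base lift to the leaf. -/
theorem isPathConnected_leaf [ConnectedSpace L] [LocallyPathConnectedSpace L]
    {S : Set V} (hS : S ∈ 𝓕) {b₀ : B} (hb₀ : b₀ ∈ 𝒯.leaf S)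
    (h : ∀ b ∈ 𝒯.leaf S, 𝒯.proj b = 𝒯.proj b₀ → JoinedIn (𝒯.leaf S) b₀ b) :
    IsPathConnected (𝒯.leaf S) := by
  let A : Set L := {x | ∀ b ∈ 𝒯.leaf S, 𝒯.proj b = x → JoinedIn (𝒯.leaf S) b₀ b}
  -- the condition defining `A` is locally constant
  have key : ∀ x, ∃ W ∈ 𝓝 x, ∀ y ∈ W, ∀ y' ∈ W, y ∈ A → y' ∈ A := by
    intro x
    obtain ⟨W, ⟨hW, hWc⟩, hWb⟩ := (path_connected_basis x).mem_iff.1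
      ((𝒯.isOpen_base x).mem_nhds (𝒯.mem_base x))
    refine ⟨W, hW, fun y hy y' hy' hyA b hb hby ↦ ?_⟩
    have hbb : 𝒯.proj b ∈ 𝒯.base x := hby ▸ hWb hy'
    have hc : ContinuousOn (fun z ↦ (𝒯.chart x).symm (chartAt EL x z, (𝒯.chart x b).2)) W := by
      refine (𝒯.chart x).continuousOn_symm.comp (((chartAt EL x).continuousOn.mono
        (hWb.trans (𝒯.base_subset x))).prodMk continuousOn_const) ?_
      intro z hz
      exact 𝒯.mem_target.2 (𝒯.chartAt_mem_dom (hWb hz))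
    have h1 := (hWc.joinedIn y hy y' hy').map_continuousOn hc
    have hmem : ∀ z ∈ W, (𝒯.chart x).symm (chartAt EL x z, (𝒯.chart x b).2) ∈ 𝒯.leaf S :=
      fun z hz ↦ (𝒯.symm_mem_leaf_iff hS (𝒯.chartAt_mem_dom (hWb hz))).2
        ((𝒯.mem_leaf_iff hS hbb).1 hb)
    have h2 : JoinedIn (𝒯.leaf S) _ _ := h1.mono (by
      rintro _ ⟨z, hz, rfl⟩
      exact hmem z hz)
    have h3 : (𝒯.chart x).symm (chartAt EL x y', (𝒯.chart x b).2) = b := by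
      rw [← hby, ← 𝒯.chart_eq hbb, 𝒯.symm_chart_apply hbb]
    rw [h3] at h2
    exact (hyA _ (hmem y hy) (𝒯.proj_symm_chartAt (hWb hy) _)).trans h2
  have hA : IsClopen A := by
    refine ⟨⟨isOpen_iff_mem_nhds.2 fun x hx ↦ ?_⟩, isOpen_iff_mem_nhds.2 fun x hx ↦ ?_⟩ <;>
      obtain ⟨W, hW, h1⟩ := key x <;> refine Filter.mem_of_superset hW fun y hy ↦ ?_
    · exact fun hyA ↦ hx (h1 y hy x (mem_of_mem_nhds hW) hyA)
    · exact h1 x (mem_of_mem_nhds hW) y hy hx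
  have hAu : A = univ := hA.eq_univ ⟨𝒯.proj b₀, h⟩
  exact ⟨b₀, hb₀, fun {b} hb ↦ (hAu ▸ mem_univ (𝒯.proj b) : 𝒯.proj b ∈ A) b hb rfl⟩

end BundleAtlas

namespace IsPrincipalBundle

variable (hP : IsPrincipalBundle (EL := EL) (EP := EP) EG (leafIsometries 𝓕) pr)
  (hG : IsLieSubgroupStructure (EG := EG) (leafIsometries 𝓕)) {p₀ : P}

/-- The leaves of the associated bundle are path connected: the components of the leaf in the fibre
over the base point are joined by the monodromy, and paths of the base lift to the leaf. -/
theorem isPathConnected_leaf [ConnectedSpace L] (h𝓕 : Setoid.IsPartition 𝓕)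
    (hH : ∀ S ∈ 𝓕, ∀ x ∈ S, ∀ y ∈ S, ∃ g : leafIsometries 𝓕,
      (Quotient.mk (pathSetoid _) g : ZerothHomotopy (leafIsometries 𝓕)) ∈
        monodromyImage pr p₀ ∧ JoinedIn S ((g : V ≃ₗᵢ[ℝ] V) x) y)
    {S : Set V} (hS : S ∈ 𝓕) : IsPathConnected ((hP.bundleAtlas hG).leaf S) := by
  obtain ⟨v, hv⟩ := Setoid.nonempty_of_mem_partition h𝓕 hS
  have : LocallyPathConnectedSpace L := ChartedSpace.locallyPathConnectedSpace EL L
  refine (hP.bundleAtlas hG).isPathConnected_leaf hS ((hP.mk_mem_leaf_iff hG hS p₀ v).2 hv) ?_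
  intro b hb hpb
  obtain ⟨⟨p, w⟩, rfl⟩ := AssocBundle.mk_surjective b
  have hw := (hP.mk_mem_leaf_iff hG hS p w).1 hb
  have hpp : pr p = pr p₀ := hpb
  have h0 := hP.mem_trivBase (pr p₀)
  set g := (hP.triv (pr p₀) p₀).2⁻¹ * (hP.triv (pr p₀) p).2 with hg
  have h1 : MulOpposite.op g • p₀ = p := by
    rw [← hP.section_triv (p := MulOpposite.op g • p₀) (i := pr p₀)
      (by rw [hP.proj_action]; exact h0), hP.triv_smul h0, hP.proj_action, hg, mul_inv_cancel_left]
    conv_rhs => rw [← hP.section_triv (p := p) (i := pr p₀) (by rw [hpp]; exact h0), hpp]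
  rw [← h1, AssocBundle.mk_eq_mk]
  exact hP.joinedIn_leaf_base hG hH hS hv ((leafIsometries_apply_mem_iff hS g w).2 hw)

end IsPrincipalBundle

end Leaves

/-! ### Averages of flat connections -/

theorem contDiffOn_bilinear_iff {D E F : Type*} [NormedAddCommGroup D] [NormedSpace ℝ D]
    [NormedAddCommGroup E] [NormedSpace ℝ E] [FiniteDimensional ℝ E]
    [NormedAddCommGroup F] [NormedSpace ℝ F] {f : D → E →L[ℝ] E →L[ℝ] F} {s : Set D} :
    ContDiffOn ℝ ∞ f s ↔ ∀ u w, ContDiffOn ℝ ∞ (fun z ↦ f z u w) s := by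
  rw [contDiffOn_clm_apply]
  exact forall_congr' fun u ↦ contDiffOn_clm_apply

section Average

variable {EL : Type*} [NormedAddCommGroup EL] [NormedSpace ℝ EL] [FiniteDimensional ℝ EL]
  {L : Type*} [TopologicalSpace L] [ChartedSpace EL L] [IsManifold 𝓘(ℝ, EL) ∞ L]
  (ρ : SmoothPartitionOfUnity L 𝓘(ℝ, EL) L univ)
  {F : Type*} [NormedAddCommGroup F] [NormedSpace ℝ F]

/-- The average of a family of functions of the coordinates at `i`, with respect to a partition of
unity on the manifold. -/
def average (i : L) (q : L → EL → F) (y : EL) : F :=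
  ∑ᶠ k, ρ k ((chartAt EL i).symm y) • q k y

omit [FiniteDimensional ℝ EL] [IsManifold 𝓘(ℝ, EL) ∞ L] in
theorem average_eq_sum (i : L) (q : L → EL → F) (y : EL) :
    average ρ i q y = ∑ k ∈ ρ.finsupport ((chartAt EL i).symm y),
      ρ k ((chartAt EL i).symm y) • q k y :=
  (ρ.sum_finsupport_smul_eq_finsum _ (fun k _ ↦ q k y)).symm

omit [FiniteDimensional ℝ EL] in
/-- Near a given point only finitely many terms of the average are nonzero, and those are smooth. -/
theorem contDiffAt_average {i : L} {q : L → EL → F} {y : EL} (hy : y ∈ (chartAt EL i).target)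
    {U : L → Set L} (hU : ρ.IsSubordinate U)
    (hq : ∀ k, (chartAt EL i).symm y ∈ U k → ContDiffAt ℝ ∞ (q k) y) :
    ContDiffAt ℝ ∞ (average ρ i q) y := by
  set x := (chartAt EL i).symm y with hx
  have hxs : x ∈ (chartAt EL i).source := (chartAt EL i).map_target hy
  have hxy : chartAt EL i x = y := (chartAt EL i).right_inv hy
  have h1 : ContMDiffAt 𝓘(ℝ, EL) 𝓘(ℝ, F) ∞
      (fun x ↦ ∑ᶠ k, ρ k x • q k (chartAt EL i x)) x := by
    refine ρ.contMDiffAt_finsum (g := fun k x ↦ q k (chartAt EL i x)) fun k hk ↦ ?_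
    have h2 : ContMDiffAt 𝓘(ℝ, EL) 𝓘(ℝ, EL) ∞ (chartAt EL i) x := by
      have := contMDiffAt_extChartAt' (I := 𝓘(ℝ, EL)) (n := ∞) hxs
      simpa only [mfld_simps] using this
    refine ContMDiffAt.comp x (g := q k) ?_ h2
    rw [hxy]
    exact (hq k (hU k hk)).contMDiffAt
  have h3 : ContMDiffAt 𝓘(ℝ, EL) 𝓘(ℝ, EL) ∞ (chartAt EL i).symm y := by
    have := contMDiffAt_extChartAt_symm (E := EL) i (y := y) (by simpa using hy)
    simpa only [mfld_simps] using this
  have h4 := (ContMDiffAt.comp y h1 h3).contDiffAt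
  refine h4.congr_of_eventuallyEq ?_
  filter_upwards [(chartAt EL i).open_target.mem_nhds hy] with y' hy'
  show average ρ i q y' = ∑ᶠ k, ρ k ((chartAt EL i).symm y') •
    q k (chartAt EL i ((chartAt EL i).symm y'))
  rw [(chartAt EL i).right_inv hy']
  rfl

omit [FiniteDimensional ℝ EL] [IsManifold 𝓘(ℝ, EL) ∞ L] in
theorem mem_of_mem_finsupport {U : L → Set L} (hU : ρ.IsSubordinate U) {x k : L}
    (hk : k ∈ ρ.finsupport x) : x ∈ U k :=
  hU k (subset_tsupport _ ((ρ.mem_finsupport x).1 hk))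

end Average

namespace BundleAtlas

variable {V : Type*} [NormedAddCommGroup V] [InnerProductSpace ℝ V]
  {EL : Type*} [NormedAddCommGroup EL] [NormedSpace ℝ EL]
  {L : Type*} [TopologicalSpace L] [ChartedSpace EL L]

omit [NormedSpace ℝ EL] in
theorem baseChange_mem {i j : L} {y : EL}
    (hj : (chartAt EL i).symm y ∈ (chartAt EL j).source) :
    (chartAt EL j).symm (baseChange i j y) = (chartAt EL i).symm y :=
  (chartAt EL j).left_inv hj

omit [NormedSpace ℝ EL] in
theorem baseChange_baseChange {i j k : L} {y : EL}
    (hj : (chartAt EL i).symm y ∈ (chartAt EL j).source) :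
    baseChange j k (baseChange i j y) = baseChange i k y := by
  show chartAt EL k ((chartAt EL j).symm (baseChange i j y)) = _
  rw [baseChange_mem hj]
  rfl

omit [NormedSpace ℝ EL] in
theorem baseChange_self {i : L} {y : EL} (hy : y ∈ (chartAt EL i).target) :
    baseChange i i y = y := (chartAt EL i).right_inv hy

theorem fderiv_baseChange_comp [IsManifold 𝓘(ℝ, EL) ∞ L] {i j k : L} {y : EL}
    (hy : y ∈ (chartAt EL i).target)
    (hj : (chartAt EL i).symm y ∈ (chartAt EL j).source)
    (hk : (chartAt EL i).symm y ∈ (chartAt EL k).source) (u : EL) :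
    fderiv ℝ (baseChange j k) (baseChange i j y) (fderiv ℝ (baseChange i j) y u) =
      fderiv ℝ (baseChange i k) y u := by
  have h1 : (baseChange j k ∘ baseChange i j) =ᶠ[𝓝 y] (baseChange i k : EL → EL) := by
    have ho := (chartAt EL i).isOpen_inter_preimage_symm (chartAt EL j).open_source
    filter_upwards [ho.mem_nhds ⟨hy, hj⟩] with y' hy'
    exact baseChange_baseChange hy'.2
  have h2 : DifferentiableAt ℝ (baseChange i j : EL → EL) y :=
    (contDiffAt_baseChange hy hj).differentiableAt (by simp)
  have h3 : DifferentiableAt ℝ (baseChange j k : EL → EL) (baseChange i j y) :=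
    (contDiffAt_baseChange ((chartAt EL j).map_source hj)
      (by rw [← baseChange_mem hj] at hk; exact hk)).differentiableAt (by simp)
  rw [← h1.fderiv_eq, fderiv_comp y h3 h2]
  rfl

theorem fderiv_baseChange_self {i : L} {y : EL} (hy : y ∈ (chartAt EL i).target) (u : EL) :
    fderiv ℝ (baseChange i i) y u = u := by
  have h1 : (baseChange i i : EL → EL) =ᶠ[𝓝 y] id := by
    filter_upwards [(chartAt EL i).open_target.mem_nhds hy] with y' hy'
    exact baseChange_self hy'
  rw [h1.fderiv_eq, fderiv_id]
  rfl

variable {B : Type*} [TopologicalSpace B]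

/-- The flat connection given by the local trivialization at `k`, in the local trivialization at
`i`. -/
def flatConn {G : Subgroup (V ≃ₗᵢ[ℝ] V)} (𝒯 : BundleAtlas G EL L B) (i k : L) (y : EL) :
    EL →L[ℝ] V →L[ℝ] V :=
  (ContinuousLinearMap.compL ℝ V V V (𝒯.transCoord k i (baseChange i k y))).comp
    (fderiv ℝ (𝒯.transCoord i k) y)

section

variable {G : Subgroup (V ≃ₗᵢ[ℝ] V)} (𝒯 : BundleAtlas G EL L B)

theorem flatConn_apply (i k : L) (y u : EL) (v : V) : 𝒯.flatConn i k y u v =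
    𝒯.transCoord k i (baseChange i k y) (fderiv ℝ (𝒯.transCoord i k) y u v) := rfl

/-- The transition functions in the two directions are inverse to each other. -/
theorem transCoord_transCoord {i k : L} {y : EL} (hy : y ∈ 𝒯.dom i)
    (hk : (chartAt EL i).symm y ∈ 𝒯.base k) (v : V) :
    𝒯.transCoord k i (baseChange i k y) (𝒯.transCoord i k y v) = v := by
  rw [𝒯.transCoord_comp hy hk hy.2, 𝒯.transCoord_self hy]

theorem baseChange_mem_dom {i k : L} {y : EL}
    (hk : (chartAt EL i).symm y ∈ 𝒯.base k) : (baseChange i k y : EL) ∈ 𝒯.dom k :=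
  𝒯.chartAt_mem_dom hk

variable [IsManifold 𝓘(ℝ, EL) ∞ L]

set_option synthInstance.maxHeartbeats 200000 in
theorem contDiffAt_flatConn {i k : L} {y : EL} (hy : y ∈ 𝒯.dom i)
    (hk : (chartAt EL i).symm y ∈ 𝒯.base k) : ContDiffAt ℝ ∞ (𝒯.flatConn i k) y := by
  have h1 : ContDiffAt ℝ ∞ (fun y ↦ 𝒯.transCoord k i (baseChange i k y)) y := by
    refine ContDiffAt.comp y (g := 𝒯.transCoord k i) ?_
      (contDiffAt_baseChange hy.1 (𝒯.base_subset k hk))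
    refine 𝒯.contDiffAt_transCoord (𝒯.baseChange_mem_dom hk) ?_
    rw [baseChange_mem (𝒯.base_subset k hk)]
    exact hy.2
  have h2 : ContDiffAt ℝ ∞ (fderiv ℝ (𝒯.transCoord i k)) y :=
    (𝒯.contDiffAt_transCoord hy hk).fderiv_right (by simp)
  exact ((ContinuousLinearMap.compL ℝ V V V).contDiff.contDiffAt.comp y h1).clm_comp h2

theorem hasFDerivAt_transCoord {i k : L} {y : EL} (hy : y ∈ 𝒯.dom i)
    (hk : (chartAt EL i).symm y ∈ 𝒯.base k) :
    HasFDerivAt (𝒯.transCoord i k) (fderiv ℝ (𝒯.transCoord i k) y) y :=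
  ((𝒯.contDiffAt_transCoord hy hk).differentiableAt (by simp)).hasFDerivAt

/-- The derivative of the cocycle identity. -/
theorem fderiv_transCoord_comp {i j k : L} {y : EL} (hy : y ∈ 𝒯.dom i)
    (hj : (chartAt EL i).symm y ∈ 𝒯.base j) (hk : (chartAt EL i).symm y ∈ 𝒯.base k)
    (u : EL) (v : V) :
    fderiv ℝ (𝒯.transCoord i k) y u v =
      fderiv ℝ (𝒯.transCoord j k) (baseChange i j y) (fderiv ℝ (baseChange i j) y u)
        (𝒯.transCoord i j y v) +
      𝒯.transCoord j k (baseChange i j y) (fderiv ℝ (𝒯.transCoord i j) y u v) := by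
  have hjs := 𝒯.base_subset j hj
  have h1 : HasFDerivAt (baseChange i j : EL → EL) (fderiv ℝ (baseChange i j) y) y :=
    ((contDiffAt_baseChange hy.1 hjs).differentiableAt (by simp)).hasFDerivAt
  have h2 := (𝒯.hasFDerivAt_transCoord (𝒯.baseChange_mem_dom hj)
    (by rw [baseChange_mem hjs]; exact hk)).comp y h1
  have h3 := (𝒯.hasFDerivAt_transCoord hy hj).clm_apply (hasFDerivAt_const v y)
  have h4 := (𝒯.hasFDerivAt_transCoord hy hk).clm_apply (hasFDerivAt_const v y)
  have h5 := h2.clm_apply h3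
  have h6 : (fun y ↦ 𝒯.transCoord i k y v) =ᶠ[𝓝 y]
      fun y ↦ (𝒯.transCoord j k ∘ baseChange i j) y (𝒯.transCoord i j y v) := by
    filter_upwards [((𝒯.isOpen_overlap i j).inter (𝒯.isOpen_overlap i k)).mem_nhds
      ⟨⟨hy, hj⟩, ⟨hy, hk⟩⟩] with y' hy'
    exact (𝒯.transCoord_comp hy'.1.1 hy'.1.2 hy'.2.2 v).symm
  have h7 := h4.unique (h5.congr_of_eventuallyEq h6)
  have h8 := DFunLike.congr_fun h7 u
  simpa [add_comm] using h8

/-- The flat connections are compatible with the changes of the trivialization. -/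
theorem flatConn_compat {i j k : L} {y : EL} (hy : y ∈ 𝒯.dom i)
    (hj : (chartAt EL i).symm y ∈ 𝒯.base j) (hk : (chartAt EL i).symm y ∈ 𝒯.base k)
    (u : EL) (v : V) :
    𝒯.transCoord i j y (𝒯.flatConn i k y u v) =
      𝒯.flatConn j k (baseChange i j y) (fderiv ℝ (baseChange i j) y u) (𝒯.transCoord i j y v) +
        fderiv ℝ (𝒯.transCoord i j) y u v := by
  have hjs := 𝒯.base_subset j hj
  have hks := 𝒯.base_subset k hk
  have h1 := 𝒯.transCoord_comp (i := k) (j := i) (k := j) (𝒯.baseChange_mem_dom hk)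
    (by rw [baseChange_mem hks]; exact hy.2) (by rw [baseChange_mem hks]; exact hj)
    (fderiv ℝ (𝒯.transCoord i k) y u v)
  rw [baseChange_baseChange hks, baseChange_self hy.1] at h1
  rw [flatConn_apply, h1, 𝒯.fderiv_transCoord_comp hy hj hk, map_add, flatConn_apply,
    baseChange_baseChange hjs]
  congr 1
  have h2 := 𝒯.transCoord_transCoord (i := j) (k := k) (𝒯.baseChange_mem_dom hj)
    (by rw [baseChange_mem hjs]; exact hk) (fderiv ℝ (𝒯.transCoord i j) y u v)
  rwa [baseChange_baseChange hjs] at h2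

/-- A flat connection is isometric: the transition maps preserve the inner product, and one
differentiates. -/
theorem inner_flatConn {i k : L} {y : EL} (hy : y ∈ 𝒯.dom i)
    (hk : (chartAt EL i).symm y ∈ 𝒯.base k) (u : EL) (v : V) :
    inner ℝ (𝒯.flatConn i k y u v) v = 0 := by
  have h1 := (𝒯.hasFDerivAt_transCoord hy hk).clm_apply (hasFDerivAt_const v y)
  have h2 := h1.inner ℝ h1
  have h3 : (fun y ↦ inner ℝ (𝒯.transCoord i k y v) (𝒯.transCoord i k y v)) =
      fun _ ↦ inner ℝ v v := funext fun y ↦ 𝒯.inner_transCoord i k y v v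
  rw [h3] at h2
  have h4 := DFunLike.congr_fun (h2.unique (hasFDerivAt_const _ y)) u
  have h5 : inner ℝ (𝒯.transCoord i k y v) (fderiv ℝ (𝒯.transCoord i k) y u v) = 0 := by
    have h6 : inner ℝ (𝒯.transCoord i k y v) (fderiv ℝ (𝒯.transCoord i k) y u v) +
      inner ℝ (fderiv ℝ (𝒯.transCoord i k) y u v) (𝒯.transCoord i k y v) = 0 := by
      simpa using h4
    rw [real_inner_comm (fderiv ℝ (𝒯.transCoord i k) y u v)] at h6
    rw [real_inner_comm]
    linarith
  conv_lhs => rw [flatConn_apply, ← 𝒯.transCoord_transCoord hy hk v]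
  rw [𝒯.inner_transCoord, real_inner_comm, 𝒯.transCoord_transCoord hy hk]
  exact h5

end

variable {𝓕 : Set (Set V)} (𝒯 : BundleAtlas (leafIsometries 𝓕) EL L B)
  [IsManifold 𝓘(ℝ, EL) ∞ L]

omit [NormedAddCommGroup EL] [NormedSpace ℝ EL] [TopologicalSpace L] [ChartedSpace EL L]
  [TopologicalSpace B] [IsManifold 𝓘(ℝ, EL) ∞ L] in
theorem apply_mem_leafTangent (g : leafIsometries 𝓕) {S : Set V} (hS : S ∈ 𝓕) {v w : V}
    (hw : w ∈ leafTangent S v) :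
    (g : V ≃ₗᵢ[ℝ] V) w ∈ leafTangent S ((g : V ≃ₗᵢ[ℝ] V) v) := by
  let A : V →L[ℝ] V := ((g : V ≃ₗᵢ[ℝ] V) : V →L[ℝ] V)
  refine leafTangent_le ((leafTangent S (A v)).comap A.toLinearMap) (fun γ hγ hγS h0 ↦ ?_) hw
  refine mem_leafTangent_of_curve (γ := fun t ↦ A (γ t)) one_pos
    (A.contDiff.comp hγ).contDiffOn (fun t _ ↦ (leafIsometries_apply_mem_iff hS g _).2 (hγS t))
    (by simp only [h0]) ?_
  exact A.hasFDerivAt.comp_hasDerivAt 0 (hγ.differentiable (by simp) 0).hasDerivAt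

omit [IsManifold 𝓘(ℝ, EL) ∞ L] in
theorem transCoord_mem_leafTangent (i k : L) (y : EL) {S : Set V} (hS : S ∈ 𝓕) {v w : V}
    (hw : w ∈ leafTangent S v) :
    𝒯.transCoord i k y w ∈ leafTangent S (𝒯.transCoord i k y v) :=
  apply_mem_leafTangent _ hS hw

/-- As the structure group preserves each leaf, `y ↦ transCoord i k y v` is a map to the leaf of
`v`, and so its derivatives are tangent to it. -/
theorem fderiv_transCoord_mem_leafTangent {i k : L} {y : EL} (hy : y ∈ 𝒯.dom i)
    (hk : (chartAt EL i).symm y ∈ 𝒯.base k) {S : Set V} (hS : S ∈ 𝓕) {v : V} (hv : v ∈ S)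
    (u : EL) : fderiv ℝ (𝒯.transCoord i k) y u v ∈ leafTangent S (𝒯.transCoord i k y v) := by
  have h0 : y + (0 : ℝ) • u = y := by rw [zero_smul, add_zero]
  obtain ⟨ε, hε, hball⟩ := Metric.mem_nhds_iff.1
    (((by fun_prop : Continuous fun t : ℝ ↦ y + t • u).continuousAt (x := 0)).preimage_mem_nhds
      (t := 𝒯.dom i ∩ (chartAt EL i).symm ⁻¹' 𝒯.base k)
      (by rw [h0]; exact (𝒯.isOpen_overlap i k).mem_nhds ⟨hy, hk⟩))
  refine mem_leafTangent_of_curve (γ := fun t : ℝ ↦ 𝒯.transCoord i k (y + t • u) v) hε ?_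
    (fun t _ ↦ (leafIsometries_apply_mem_iff hS _ _).2 hv) (by simp only [h0]) ?_
  · intro t ht
    have h1 := hball (show t ∈ Metric.ball 0 ε by rwa [Real.ball_eq_Ioo, zero_sub, zero_add])
    have h2 : ContDiffAt ℝ ∞ (fun t : ℝ ↦ 𝒯.transCoord i k (y + t • u)) t :=
      ContDiffAt.comp t (g := 𝒯.transCoord i k) (𝒯.contDiffAt_transCoord h1.1 h1.2)
        (by fun_prop)
    exact (h2.clm_apply contDiffAt_const).contDiffWithinAt
  · have h1 : HasDerivAt (fun t : ℝ ↦ y + t • u) u 0 := by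
      simpa using ((hasDerivAt_id (0 : ℝ)).smul_const u).const_add y
    have h2 : HasFDerivAt (fun y ↦ 𝒯.transCoord i k y v)
        ((fderiv ℝ (𝒯.transCoord i k) y).flip v) (y + (0 : ℝ) • u) := by
      rw [h0]
      have := (𝒯.hasFDerivAt_transCoord hy hk).clm_apply (hasFDerivAt_const v y)
      rwa [ContinuousLinearMap.comp_zero, zero_add] at this
    exact HasFDerivAt.comp_hasDerivAt (l := fun y ↦ 𝒯.transCoord i k y v)
      (f := fun t : ℝ ↦ y + t • u) 0 h2 h1

/-- A flat connection is tangent to the leaves. -/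
theorem flatConn_mem_leafTangent {i k : L} {y : EL} (hy : y ∈ 𝒯.dom i)
    (hk : (chartAt EL i).symm y ∈ 𝒯.base k) {S : Set V} (hS : S ∈ 𝓕) {v : V} (hv : v ∈ S)
    (u : EL) : 𝒯.flatConn i k y u v ∈ leafTangent S v := by
  have h := 𝒯.transCoord_mem_leafTangent k i (baseChange i k y) hS
    (𝒯.fderiv_transCoord_mem_leafTangent hy hk hS hv u)
  rwa [𝒯.transCoord_transCoord hy hk] at h

end BundleAtlas

/-! ### The connection metric -/

/-- The continuous bilinear forms on a normed space. -/
abbrev ContinuousBilinForm (E : Type*) [NormedAddCommGroup E] [NormedSpace ℝ E] : Type _ :=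
  E →L[ℝ] E →L[ℝ] ℝ

/-- A Riemannian metric on the base and a connection on the bundle, in the coordinates of the local
trivializations: `form i` is the metric in the chart at `i`, and the horizontal spaces in `chart i`
are given by `w + conn i y u v = 0`. The connection is isometric, and it is tangent to the
leaves. -/
structure BundleGeometry {V : Type*} [NormedAddCommGroup V] [InnerProductSpace ℝ V]
    {𝓕 : Set (Set V)} {EL : Type*} [NormedAddCommGroup EL] [NormedSpace ℝ EL]
    {L : Type*} [TopologicalSpace L] [ChartedSpace EL L] {B : Type*} [TopologicalSpace B]
    (𝒯 : BundleAtlas (leafIsometries 𝓕) EL L B) where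
  /-- The metric of the base. -/
  form : L → EL → EL →L[ℝ] EL →L[ℝ] ℝ
  form_symm : ∀ i, ∀ y ∈ (chartAt EL i).target, ∀ u w, form i y u w = form i y w u
  form_pos : ∀ i, ∀ y ∈ (chartAt EL i).target, ∀ u, u ≠ 0 → 0 < form i y u u
  contDiffOn_form : ∀ i, ContDiffOn ℝ ∞ (form i) (chartAt EL i).target
  form_compat : ∀ i j, ∀ y ∈ (chartAt EL i).target,
    (chartAt EL i).symm y ∈ (chartAt EL j).source → ∀ u w,
      form j (BundleAtlas.baseChange i j y) (fderiv ℝ (BundleAtlas.baseChange i j) y u)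
        (fderiv ℝ (BundleAtlas.baseChange i j) y w) = form i y u w
  /-- The connection form. -/
  conn : L → EL → EL →L[ℝ] V →L[ℝ] V
  contDiffOn_conn : ∀ i, ContDiffOn ℝ ∞ (conn i) (𝒯.dom i)
  inner_conn : ∀ i, ∀ y ∈ 𝒯.dom i, ∀ u v, inner ℝ (conn i y u v) v = 0
  conn_mem : ∀ i, ∀ y ∈ 𝒯.dom i, ∀ S ∈ 𝓕, ∀ v ∈ S, ∀ u, conn i y u v ∈ leafTangent S v
  conn_compat : ∀ i j, ∀ y ∈ 𝒯.dom i, (chartAt EL i).symm y ∈ 𝒯.base j → ∀ u v,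
    𝒯.transCoord i j y (conn i y u v) =
      conn j (BundleAtlas.baseChange i j y) (fderiv ℝ (BundleAtlas.baseChange i j) y u)
        (𝒯.transCoord i j y v) + fderiv ℝ (𝒯.transCoord i j) y u v

namespace BundleAtlas

section Form

variable {EL : Type*} [NormedAddCommGroup EL] [NormedSpace ℝ EL] [FiniteDimensional ℝ EL]
  {L : Type*} [TopologicalSpace L] [ChartedSpace EL L]

/-- The Euclidean metric of the chart at `k`, in the coordinates at `i`. -/
def flatForm (i k : L) (y : EL) : EL →L[ℝ] EL →L[ℝ] ℝ :=
  (innerSL ℝ (E := EuclideanSpace ℝ (Fin (Module.finrank ℝ EL)))).bilinearComp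
    ((toEuclidean (E := EL)).toContinuousLinearMap.comp (fderiv ℝ (baseChange i k) y))
    ((toEuclidean (E := EL)).toContinuousLinearMap.comp (fderiv ℝ (baseChange i k) y))

theorem flatForm_apply (i k : L) (y u w : EL) : flatForm i k y u w =
    inner ℝ (toEuclidean (fderiv ℝ (baseChange i k) y u))
      (toEuclidean (fderiv ℝ (baseChange i k) y w)) := rfl

variable [IsManifold 𝓘(ℝ, EL) ∞ L]

theorem contDiffAt_flatForm {i k : L} {y : EL} (hy : y ∈ (chartAt EL i).target)
    (hk : (chartAt EL i).symm y ∈ (chartAt EL k).source) :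
    ContDiffAt ℝ ∞ (flatForm i k) y := by
  have ho := (chartAt EL i).isOpen_inter_preimage_symm (chartAt EL k).open_source
  refine ContDiffOn.contDiffAt ?_ (ho.mem_nhds ⟨hy, hk⟩)
  rw [contDiffOn_bilinear_iff]
  rintro u w y' ⟨hy', hk'⟩
  have h1 : ContDiffAt ℝ ∞ (fderiv ℝ (baseChange i k : EL → EL)) y' :=
    (contDiffAt_baseChange hy' hk').fderiv_right (by simp)
  have h2 : ∀ u, ContDiffAt ℝ ∞ (fun y : EL ↦ toEuclidean (fderiv ℝ (baseChange i k) y u)) y' :=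
    fun u ↦ (toEuclidean (E := EL)).contDiff.contDiffAt.comp y' (h1.clm_apply contDiffAt_const)
  exact ((h2 u).inner ℝ (h2 w)).contDiffWithinAt

end Form

variable {V : Type*} [NormedAddCommGroup V] [InnerProductSpace ℝ V] {𝓕 : Set (Set V)}
  {EL : Type*} [NormedAddCommGroup EL] [NormedSpace ℝ EL] [FiniteDimensional ℝ EL]
  {L : Type*} [TopologicalSpace L] [ChartedSpace EL L] [IsManifold 𝓘(ℝ, EL) ∞ L]
  {B : Type*} [TopologicalSpace B] (𝒯 : BundleAtlas (leafIsometries 𝓕) EL L B)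

/-- Averaging the flat metrics and connections of the local trivializations. -/
theorem exists_bundleGeometry [T2Space L] [SecondCountableTopology L] :
    Nonempty (BundleGeometry 𝒯) := by
  have : LocallyCompactSpace L := ChartedSpace.locallyCompactSpace EL L
  obtain ⟨ρ, hρ⟩ := SmoothPartitionOfUnity.exists_isSubordinate 𝓘(ℝ, EL) (s := (univ : Set L))
    isClosed_univ 𝒯.base 𝒯.isOpen_base fun x _ ↦ mem_iUnion.2 ⟨x, 𝒯.mem_base x⟩
  have hsum : ∀ x, ∑ k ∈ ρ.finsupport x, ρ k x = 1 := fun x ↦ ρ.sum_finsupport x (mem_univ x)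
  have hmem : ∀ x, ∀ k ∈ ρ.finsupport x, x ∈ 𝒯.base k := fun x k hk ↦
    mem_of_mem_finsupport ρ hρ hk
  have hform : ∀ (i : L) (y u w : EL), average ρ i (flatForm i) y u w =
      ∑ k ∈ ρ.finsupport ((chartAt EL i).symm y), ρ k ((chartAt EL i).symm y) *
        flatForm i k y u w := fun i y u w ↦ by
    simp [average_eq_sum]
  have hconn : ∀ (i : L) (y u : EL) (v : V), average ρ i (𝒯.flatConn i) y u v =
      ∑ k ∈ ρ.finsupport ((chartAt EL i).symm y), ρ k ((chartAt EL i).symm y) •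
        𝒯.flatConn i k y u v := fun i y u v ↦ by
    simp [average_eq_sum]
  refine ⟨{
    form := fun i ↦ average ρ i (flatForm i)
    form_symm := ?_
    form_pos := ?_
    contDiffOn_form := ?_
    form_compat := ?_
    conn := fun i ↦ average ρ i (𝒯.flatConn i)
    contDiffOn_conn := ?_
    inner_conn := ?_
    conn_mem := ?_
    conn_compat := ?_ }⟩
  · intro i y hy u w
    rw [hform, hform]
    refine Finset.sum_congr rfl fun k _ ↦ ?_
    rw [flatForm_apply, flatForm_apply, real_inner_comm]
  · intro i y hy u hu
    rw [hform]
    have hnn : ∀ k ∈ ρ.finsupport ((chartAt EL i).symm y), 0 < ρ k ((chartAt EL i).symm y) *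
        flatForm i k y u u := by
      intro k hk
      refine mul_pos ((ρ.nonneg k _).lt_of_ne' ((ρ.mem_finsupport _).1 hk)) ?_
      have hks := 𝒯.base_subset k (hmem _ k hk)
      rw [flatForm_apply]
      refine real_inner_self_pos.2 fun h0 ↦ hu ?_
      have h1 : fderiv ℝ (baseChange i k) y u = 0 := by simpa using h0
      have h2 := fderiv_baseChange_comp hy hks ((chartAt EL i).map_target hy) u
      rw [h1, fderiv_baseChange_self hy, map_zero] at h2
      exact h2.symm
    refine Finset.sum_pos hnn ?_
    rw [Finset.nonempty_iff_ne_empty]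
    intro h
    have := hsum ((chartAt EL i).symm y)
    rw [h] at this
    simp at this
  · intro i y hy
    exact (contDiffAt_average ρ hy hρ fun k hk ↦
      contDiffAt_flatForm hy (𝒯.base_subset k hk)).contDiffWithinAt
  · intro i j y hy hj u w
    rw [hform, hform, baseChange_mem hj]
    refine Finset.sum_congr rfl fun k hk ↦ ?_
    have hks := 𝒯.base_subset k (hmem _ k hk)
    rw [flatForm_apply, flatForm_apply, fderiv_baseChange_comp hy hj hks,
      fderiv_baseChange_comp hy hj hks]
  · intro i y hy
    exact (contDiffAt_average ρ hy.1 hρ fun k hk ↦ 𝒯.contDiffAt_flatConn hy hk).contDiffWithinAt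
  · intro i y hy u v
    rw [hconn, sum_inner]
    refine Finset.sum_eq_zero fun k hk ↦ ?_
    rw [real_inner_smul_left, 𝒯.inner_flatConn hy (hmem _ k hk), mul_zero]
  · intro i y hy S hS v hv u
    rw [hconn]
    exact Submodule.sum_mem _ fun k hk ↦ Submodule.smul_mem _ _
      (𝒯.flatConn_mem_leafTangent hy (hmem _ k hk) hS hv u)
  · intro i j y hy hj u v
    rw [hconn, hconn, baseChange_mem (𝒯.base_subset j hj), map_sum]
    conv_rhs => rw [← one_smul ℝ (fderiv ℝ (𝒯.transCoord i j) y u v),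
      ← hsum ((chartAt EL i).symm y), Finset.sum_smul, ← Finset.sum_add_distrib]
    refine Finset.sum_congr rfl fun k hk ↦ ?_
    rw [map_smul, 𝒯.flatConn_compat hy hj (hmem _ k hk), smul_add]

end BundleAtlas

namespace BundleAtlas

variable {V : Type*} [NormedAddCommGroup V] [InnerProductSpace ℝ V] {G : Subgroup (V ≃ₗᵢ[ℝ] V)}
  {EL : Type*} [NormedAddCommGroup EL] [NormedSpace ℝ EL]
  {L : Type*} [TopologicalSpace L] [ChartedSpace EL L]
  {B : Type*} [TopologicalSpace B] (𝒯 : BundleAtlas G EL L B)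

theorem fderiv_chartChange [IsManifold 𝓘(ℝ, EL) ∞ L] {i j : L} {z : EL × V} (hz : z.1 ∈ 𝒯.dom i)
    (hj : (chartAt EL i).symm z.1 ∈ 𝒯.base j) (u : EL × V) :
    fderiv ℝ (𝒯.chart j ∘ (𝒯.chart i).symm) z u =
      (fderiv ℝ (baseChange i j) z.1 u.1,
        𝒯.transCoord i j z.1 u.2 + fderiv ℝ (𝒯.transCoord i j) z.1 u.1 z.2) := by
  have h1 : HasFDerivAt (baseChange i j : EL → EL) (fderiv ℝ (baseChange i j) z.1) z.1 :=
    ((contDiffAt_baseChange hz.1 (𝒯.base_subset j hj)).differentiableAt (by simp)).hasFDerivAt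
  have h2 := (𝒯.hasFDerivAt_transCoord hz hj).comp z (hasFDerivAt_fst (p := z))
  have h3 := (h1.comp z (hasFDerivAt_fst (p := z))).prodMk
    (h2.clm_apply (hasFDerivAt_snd (p := z)))
  have h4 : (𝒯.chart j ∘ (𝒯.chart i).symm) =ᶠ[𝓝 z] fun z ↦
      ((baseChange i j ∘ Prod.fst) z, ((𝒯.transCoord i j ∘ Prod.fst) z) z.2) := by
    filter_upwards [((𝒯.isOpen_overlap i j).preimage continuous_fst).mem_nhds ⟨hz, hj⟩] with z' hz'
    exact 𝒯.chart_change hz'.1 hz'.2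
  rw [(h3.congr_of_eventuallyEq h4).fderiv]
  rfl

variable [ChartedSpace (EL × V) B] {𝒯}

theorem extChartAt_coe (hB : ∀ b : B, chartAt (EL × V) b = 𝒯.chart (𝒯.proj b)) (b : B) :
    (extChartAt 𝓘(ℝ, EL × V) b : B → EL × V) = 𝒯.chart (𝒯.proj b) := by
  simp only [extChartAt, hB, mfld_simps]

theorem extChartAt_symm_coe (hB : ∀ b : B, chartAt (EL × V) b = 𝒯.chart (𝒯.proj b)) (b : B) :
    ((extChartAt 𝓘(ℝ, EL × V) b).symm : EL × V → B) = (𝒯.chart (𝒯.proj b)).symm := by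
  simp only [extChartAt, hB, mfld_simps]

theorem mem_extChartAt_target (hB : ∀ b : B, chartAt (EL × V) b = 𝒯.chart (𝒯.proj b)) {b : B}
    {z : EL × V} : z ∈ (extChartAt 𝓘(ℝ, EL × V) b).target ↔ z.1 ∈ 𝒯.dom (𝒯.proj b) := by
  simp only [extChartAt, hB, mfld_simps, 𝒯.mem_target]

theorem mem_extChartAt_source (hB : ∀ b : B, chartAt (EL × V) b = 𝒯.chart (𝒯.proj b)) {b b' : B} :
    b' ∈ (extChartAt 𝓘(ℝ, EL × V) b).source ↔ 𝒯.proj b' ∈ 𝒯.base (𝒯.proj b) := by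
  simp only [extChartAt, hB, mfld_simps, 𝒯.mem_source]

end BundleAtlas

namespace BundleGeometry

variable {V : Type*} [NormedAddCommGroup V] [InnerProductSpace ℝ V] {𝓕 : Set (Set V)}
  {EL : Type*} [NormedAddCommGroup EL] [NormedSpace ℝ EL]
  {L : Type*} [TopologicalSpace L] [ChartedSpace EL L]
  {B : Type*} [TopologicalSpace B] {𝒯 : BundleAtlas (leafIsometries 𝓕) EL L B}
  (Γ : BundleGeometry 𝒯)

/-- The vertical part of a tangent vector of the bundle, in the coordinates of `chart i`. -/
def vert (i : L) (z : EL × V) : EL × V →L[ℝ] V :=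
  ContinuousLinearMap.snd ℝ EL V +
    ((Γ.conn i z.1).flip z.2).comp (ContinuousLinearMap.fst ℝ EL V)

theorem vert_apply (i : L) (z u : EL × V) : Γ.vert i z u = u.2 + Γ.conn i z.1 u.1 z.2 := rfl

/-- The metric of the bundle, in the coordinates of `chart i`: the horizontal and the vertical
spaces are orthogonal, the former with the metric of the base and the latter with the metric of
`V`. -/
def totalForm (i : L) (z : EL × V) : ContinuousBilinForm (EL × V) :=
  (Γ.form i z.1).bilinearComp (ContinuousLinearMap.fst ℝ EL V) (ContinuousLinearMap.fst ℝ EL V) +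
    ((innerSL ℝ : V →L[ℝ] V →L[ℝ] ℝ).bilinearComp (Γ.vert i z) (Γ.vert i z) :
      EL × V →L[ℝ] EL × V →L[ℝ] ℝ)

theorem totalForm_apply (i : L) (z u w : EL × V) : Γ.totalForm i z u w =
    Γ.form i z.1 u.1 w.1 + inner ℝ (Γ.vert i z u) (Γ.vert i z w) := rfl

theorem contDiffOn_vert (i : L) (u : EL × V) :
    ContDiffOn ℝ ∞ (fun z ↦ Γ.vert i z u) {z | z.1 ∈ 𝒯.dom i} :=
  contDiffOn_const.add ((((Γ.contDiffOn_conn i).comp contDiffOn_fst fun _ hz ↦ hz).clm_apply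
    contDiffOn_const).clm_apply contDiffOn_snd)

theorem contDiffOn_totalForm [FiniteDimensional ℝ V] [FiniteDimensional ℝ EL] (i : L) :
    ContDiffOn ℝ ∞ (Γ.totalForm i) {z | z.1 ∈ 𝒯.dom i} := by
  rw [contDiffOn_bilinear_iff]
  intro u w
  exact (((((Γ.contDiffOn_form i).comp contDiffOn_fst fun _ hz ↦ hz.1).clm_apply
    contDiffOn_const).clm_apply contDiffOn_const)).add
    ((Γ.contDiffOn_vert i u).inner ℝ (Γ.contDiffOn_vert i w))

theorem totalForm_symm {i : L} {z : EL × V} (hz : z.1 ∈ 𝒯.dom i) (u w : EL × V) :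
    Γ.totalForm i z u w = Γ.totalForm i z w u := by
  rw [totalForm_apply, totalForm_apply, Γ.form_symm i _ hz.1, real_inner_comm]

theorem form_nonneg {i : L} {y : EL} (hy : y ∈ (chartAt EL i).target) (u : EL) :
    0 ≤ Γ.form i y u u := by
  rcases eq_or_ne u 0 with rfl | hu
  · simp
  · exact (Γ.form_pos i y hy u hu).le

theorem totalForm_pos {i : L} {z : EL × V} (hz : z.1 ∈ 𝒯.dom i) (u : EL × V) (hu : u ≠ 0) :
    0 < Γ.totalForm i z u u := by
  rw [totalForm_apply]
  by_cases h : u.1 = 0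
  · have h2 : u.2 ≠ 0 := fun h2 ↦ hu (Prod.ext h h2)
    have h3 : Γ.vert i z u = u.2 := by rw [vert_apply, h]; simp
    rw [h3, h]
    have := real_inner_self_pos.2 h2
    simpa using this
  · exact add_pos_of_pos_of_nonneg (Γ.form_pos i _ hz.1 _ h) real_inner_self_nonneg

variable [IsManifold 𝓘(ℝ, EL) ∞ L]

/-- The vertical part of a tangent vector is independent of the trivialization, up to the transition
maps of the fibre. -/
theorem vert_chartChange {i j : L} {z : EL × V} (hz : z.1 ∈ 𝒯.dom i)
    (hj : (chartAt EL i).symm z.1 ∈ 𝒯.base j) (u : EL × V) :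
    Γ.vert j (𝒯.chart j ((𝒯.chart i).symm z))
      (fderiv ℝ (𝒯.chart j ∘ (𝒯.chart i).symm) z u) =
        𝒯.transCoord i j z.1 (Γ.vert i z u) := by
  rw [𝒯.fderiv_chartChange hz hj, 𝒯.chart_change hz hj, vert_apply, vert_apply, map_add,
    Γ.conn_compat i j _ hz hj]
  simp only
  abel

/-- The forms `totalForm i` agree on overlaps, because the transition maps of the fibre are
isometries. -/
theorem totalForm_chartChange {i j : L} {z : EL × V} (hz : z.1 ∈ 𝒯.dom i)
    (hj : (chartAt EL i).symm z.1 ∈ 𝒯.base j) (u w : EL × V) :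
    Γ.totalForm j (𝒯.chart j ((𝒯.chart i).symm z))
      (fderiv ℝ (𝒯.chart j ∘ (𝒯.chart i).symm) z u)
      (fderiv ℝ (𝒯.chart j ∘ (𝒯.chart i).symm) z w) = Γ.totalForm i z u w := by
  rw [totalForm_apply, totalForm_apply, Γ.vert_chartChange hz hj, Γ.vert_chartChange hz hj,
    𝒯.inner_transCoord, 𝒯.fderiv_chartChange hz hj, 𝒯.fderiv_chartChange hz hj,
    𝒯.chart_change hz hj, Γ.form_compat i j _ hz.1 (𝒯.base_subset j hj)]

variable [FiniteDimensional ℝ EL]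

/-- The forms `form i` are the coordinate expressions of a Riemannian metric of the base. -/
theorem exists_baseMetric : ∃ gL : Bundle.ContMDiffRiemannianMetric 𝓘(ℝ, EL) ∞ EL
    (fun x : L ↦ TangentSpace 𝓘(ℝ, EL) x),
    ∀ (x : L) (u w : EL), gL.inner x u w = Γ.form x (chartAt EL x x) u w := by
  obtain ⟨gL, h1, -⟩ := exists_metric_of_charts (E := EL) (M := L) Γ.form
    (fun i y hy ↦ Γ.form_symm i y (by simpa using hy))
    (fun i y hy ↦ Γ.form_pos i y (by simpa using hy))
    (fun i ↦ (Γ.contDiffOn_form i).mono fun y hy ↦ by simpa using hy)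
    (fun i j y hy hj u w ↦ by
      simp only [mfld_simps] at hy hj ⊢
      exact Γ.form_compat i j y hy hj u w)
  exact ⟨gL, fun x u w ↦ h1 x u w⟩

variable [FiniteDimensional ℝ V] [ChartedSpace (EL × V) B] [IsManifold 𝓘(ℝ, EL × V) ∞ B]

/-- The forms `totalForm i` are the coordinate expressions of a Riemannian metric of the bundle. -/
theorem exists_totalMetric (hB : ∀ b : B, chartAt (EL × V) b = 𝒯.chart (𝒯.proj b)) :
    ∃ g : Bundle.ContMDiffRiemannianMetric 𝓘(ℝ, EL × V) ∞ (EL × V)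
      (fun b : B ↦ TangentSpace 𝓘(ℝ, EL × V) b),
    (∀ (b : B) (u w : EL × V), g.inner b u w =
      Γ.totalForm (𝒯.proj b) (𝒯.chart (𝒯.proj b) b) u w) ∧
    ∀ (b : B) (z : EL × V), z.1 ∈ 𝒯.dom (𝒯.proj b) → ∀ u w,
      chartMetric g.toRiemannianMetric b z u w = Γ.totalForm (𝒯.proj b) z u w := by
  obtain ⟨g, h1, h2⟩ := exists_metric_of_charts (E := EL × V) (M := B)
    (fun b ↦ Γ.totalForm (𝒯.proj b))
    (fun b z hz ↦ Γ.totalForm_symm ((BundleAtlas.mem_extChartAt_target hB).1 hz))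
    (fun b z hz ↦ Γ.totalForm_pos ((BundleAtlas.mem_extChartAt_target hB).1 hz))
    (fun b ↦ (Γ.contDiffOn_totalForm _).mono fun z hz ↦ (BundleAtlas.mem_extChartAt_target hB).1 hz)
    (fun b b' z hz hb' u w ↦ by
      have hz' := (BundleAtlas.mem_extChartAt_target hB).1 hz
      rw [BundleAtlas.mem_extChartAt_source hB, BundleAtlas.extChartAt_symm_coe hB,
        𝒯.proj_symm hz'] at hb'
      rw [BundleAtlas.extChartAt_symm_coe hB, BundleAtlas.extChartAt_coe hB]
      exact Γ.totalForm_chartChange hz' hb' u w)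
  refine ⟨g, fun b u w ↦ ?_, fun b z hz ↦ h2 b z ((BundleAtlas.mem_extChartAt_target hB).2 hz)⟩
  rw [h1, BundleAtlas.extChartAt_coe hB]

end BundleGeometry

/-! ### Tangent spaces of the leaves and vertical vector fields -/

namespace BundleAtlas

variable {V : Type*} [NormedAddCommGroup V] [InnerProductSpace ℝ V] {𝓕 : Set (Set V)}
  {EL : Type*} [NormedAddCommGroup EL] [NormedSpace ℝ EL]
  {L : Type*} [TopologicalSpace L] [ChartedSpace EL L] [IsManifold 𝓘(ℝ, EL) ∞ L]
  {B : Type*} [TopologicalSpace B] {𝒯 : BundleAtlas (leafIsometries 𝓕) EL L B}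
  [ChartedSpace (EL × V) B] [IsManifold 𝓘(ℝ, EL × V) ∞ B]

omit [IsManifold 𝓘(ℝ, EL) ∞ L] in
/-- A curve whose fibre coordinate stays in `S` is a curve in the leaf given by `S`, so that its
coordinate velocity is tangent to that leaf. -/
theorem mem_tangentSpaceOf_leaf_of_curve
    (hB : ∀ b : B, chartAt (EL × V) b = 𝒯.chart (𝒯.proj b))
    {S : Set V} (hS : S ∈ 𝓕) {b : B} {c : ℝ → EL × V} {ε : ℝ} (hε : 0 < ε)
    (hc : ContDiffOn ℝ ∞ c (Ioo (-ε) ε)) (hcd : ∀ t ∈ Ioo (-ε) ε, (c t).1 ∈ 𝒯.dom (𝒯.proj b))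
    (hcS : ∀ t ∈ Ioo (-ε) ε, (c t).2 ∈ S) (h0 : c 0 = 𝒯.chart (𝒯.proj b) b) {w : EL × V}
    (hw : HasDerivAt c w 0) :
    (w : TangentSpace 𝓘(ℝ, EL × V) b) ∈ tangentSpaceOf (E := EL × V) (𝒯.leaf S) b := by
  have hmem : (0 : ℝ) ∈ Ioo (-ε) ε := ⟨by linarith, hε⟩
  refine mem_tangentSpaceOf_of_curve (E := EL × V)
    (γ := fun t ↦ (𝒯.chart (𝒯.proj b)).symm (c t)) hε ?_ ?_ ?_ ?_
  · intro t ht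
    have h1 := contMDiffAt_extChartAt_symm (E := EL × V) b
      ((mem_extChartAt_target hB).2 (hcd t ht))
    rw [extChartAt_symm_coe hB] at h1
    exact (h1.comp t (hc.contDiffAt (isOpen_Ioo.mem_nhds ht)).contMDiffAt).contMDiffWithinAt
  · intro t ht
    exact (𝒯.symm_mem_leaf_iff hS (hcd t ht)).2 (hcS t ht)
  · show (𝒯.chart (𝒯.proj b)).symm (c 0) = b
    rw [h0, 𝒯.symm_chart_apply (𝒯.mem_base _)]
  · refine hw.congr_of_eventuallyEq ?_
    filter_upwards [isOpen_Ioo.mem_nhds hmem] with t ht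
    rw [extChartAt_coe hB]
    exact 𝒯.chart_symm_apply (hcd t ht)

omit [IsManifold 𝓘(ℝ, EL) ∞ L] in
/-- The tangent space of a leaf of the bundle contains all the directions of the base. -/
theorem mem_tangentSpaceOf_leaf_iff
    (hB : ∀ b : B, chartAt (EL × V) b = 𝒯.chart (𝒯.proj b))
    {S : Set V} (hS : S ∈ 𝓕) {b : B} (hb : b ∈ 𝒯.leaf S) (w : EL × V) :
    (w : TangentSpace 𝓘(ℝ, EL × V) b) ∈ tangentSpaceOf (E := EL × V) (𝒯.leaf S) b ↔
      w.2 ∈ leafTangent S (𝒯.chart (𝒯.proj b) b).2 := by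
  set i := 𝒯.proj b with hi
  have hbi : 𝒯.proj b ∈ 𝒯.base i := 𝒯.mem_base i
  set z₀ := 𝒯.chart i b with hz₀
  have hz₀d : z₀.1 ∈ 𝒯.dom i := 𝒯.chart_fst_mem_dom hbi
  constructor
  · intro hw
    refine tangentSpaceOf_le (E := EL × V)
      ((leafTangent S z₀.2).comap (LinearMap.snd ℝ EL V)) (fun γ hγ hγS h0 ↦ ?_) hw
    show (deriv (fun s ↦ extChartAt 𝓘(ℝ, EL × V) b (γ s)) 0).2 ∈ leafTangent S z₀.2
    rw [extChartAt_coe hB]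
    have hγ0 : 𝒯.proj (γ 0) ∈ 𝒯.base i := by rw [h0]; exact hbi
    obtain ⟨ε, hε, hball⟩ := Metric.mem_nhds_iff.1
      ((𝒯.continuous_proj.comp hγ.continuous).continuousAt.preimage_mem_nhds
        ((𝒯.isOpen_base i).mem_nhds hγ0))
    have hball' : ∀ t ∈ Ioo (-ε) ε, 𝒯.proj (γ t) ∈ 𝒯.base i := fun t ht ↦
      hball (show t ∈ Metric.ball 0 ε by rwa [Real.ball_eq_Ioo, zero_sub, zero_add])
    have hc : ContDiffOn ℝ ∞ (fun t ↦ 𝒯.chart i (γ t)) (Ioo (-ε) ε) := by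
      intro t ht
      have h1 : ContMDiffAt 𝓘(ℝ, EL × V) 𝓘(ℝ, EL × V) ∞ (extChartAt 𝓘(ℝ, EL × V) b) (γ t) :=
        contMDiffAt_extChartAt' (by
          have := (mem_extChartAt_source (b := b) hB).2 (hball' t ht)
          simpa using this)
      rw [extChartAt_coe hB] at h1
      exact ((h1.comp t hγ.contMDiffAt).contDiffAt).contDiffWithinAt
    have hmem : (0 : ℝ) ∈ Ioo (-ε) ε := ⟨by linarith, hε⟩
    have hd : HasDerivAt (fun t ↦ 𝒯.chart i (γ t)) (deriv (fun t ↦ 𝒯.chart i (γ t)) 0) 0 :=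
      ((hc.contDiffAt (isOpen_Ioo.mem_nhds hmem)).differentiableAt (by simp)).hasDerivAt
    refine mem_leafTangent_of_curve (γ := fun t ↦ (𝒯.chart i (γ t)).2) hε
      (contDiff_snd.comp_contDiffOn hc) (fun t ht ↦ ?_) ?_ ?_
    · exact (𝒯.mem_leaf_iff hS (hball' t ht)).1 (hγS t)
    · rw [h0]
    · exact (ContinuousLinearMap.snd ℝ EL V).hasFDerivAt.comp_hasDerivAt 0 hd
  · intro hw
    let T : Submodule ℝ (EL × V) := tangentSpaceOf (E := EL × V) (𝒯.leaf S) b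
    have h1 : ((w.1, 0) : EL × V) ∈ T := by
      obtain ⟨ε, hε, hball⟩ := Metric.mem_nhds_iff.1
        (((by fun_prop : Continuous fun t : ℝ ↦ z₀.1 + t • w.1).continuousAt
          (x := 0)).preimage_mem_nhds (t := 𝒯.dom i)
          (by rw [zero_smul, add_zero]; exact (𝒯.isOpen_dom i).mem_nhds hz₀d))
      refine mem_tangentSpaceOf_leaf_of_curve hB hS (c := fun t ↦ (z₀.1 + t • w.1, z₀.2)) hε
        (by fun_prop) (fun t ht ↦ hball
          (show t ∈ Metric.ball 0 ε by rwa [Real.ball_eq_Ioo, zero_sub, zero_add]))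
        (fun _ _ ↦ hb) (by simp [hz₀]; rfl) ?_
      have := ((hasDerivAt_id (0 : ℝ)).smul_const w.1).const_add z₀.1
      rw [one_smul] at this
      exact this.prodMk (hasDerivAt_const _ _)
    have h2 : ((0, w.2) : EL × V) ∈ T := by
      refine leafTangent_le (Submodule.comap (LinearMap.inr ℝ EL V)
        T) ?_ hw
      intro γ hγ hγS h0
      refine mem_tangentSpaceOf_leaf_of_curve hB hS (c := fun t ↦ (z₀.1, γ t)) one_pos
        (contDiffOn_const.prodMk hγ.contDiffOn) (fun _ _ ↦ hz₀d) (fun t _ ↦ hγS t)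
        (by rw [h0]) ?_
      exact (hasDerivAt_const _ _).prodMk (hγ.differentiable (by simp) 0).hasDerivAt
    have h3 : ((w.1, 0) : EL × V) + (0, w.2) ∈ T := T.add_mem h1 h2
    rw [Prod.mk_add_mk, add_zero, zero_add] at h3
    exact h3

/-- The vertical fields of the fibre extend to vertical fields of the bundle. -/
theorem exists_isVertical [FiniteDimensional ℝ EL] [FiniteDimensional ℝ V] [T2Space B]
    (hB : ∀ b : B, chartAt (EL × V) b = 𝒯.chart (𝒯.proj b))
    (h𝓕 : IsDisconnectedInfinitesimalFoliation 𝓕) {S : Set V} (hS : S ∈ 𝓕) {b : B}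
    (hb : b ∈ 𝒯.leaf S) (w : TangentSpace 𝓘(ℝ, EL × V) b)
    (hw : w ∈ tangentSpaceOf (E := EL × V) (𝒯.leaf S) b) :
    ∃ X : ∀ b : B, TangentSpace 𝓘(ℝ, EL × V) b, IsVertical (𝒯.leaf '' 𝓕) X ∧ X b = w := by
  have hw' := (mem_tangentSpaceOf_leaf_iff hB hS hb w).1 hw
  obtain ⟨X₀, hX₀, hX₀b, hX₀t⟩ := h𝓕.exists_vertical hS hb hw'
  obtain ⟨ρ⟩ : Nonempty (SmoothBumpFunction 𝓘(ℝ, EL × V) b) := inferInstance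
  let W : EL × V → EL × V := fun z ↦ ((w : EL × V).1, X₀ z.2)
  have hW : ContDiff ℝ ∞ W := contDiff_const.prodMk (hX₀.comp contDiff_snd)
  refine ⟨fun b' ↦ ρ b' • (trivializationAt (EL × V) (TangentSpace 𝓘(ℝ, EL × V)) b).symm b'
    (W (extChartAt 𝓘(ℝ, EL × V) b b')), ⟨?_, ?_⟩, ?_⟩
  · exact contMDiff_cutoff_vectorField (E := EL × V) b ρ.contMDiff
      (by simpa using ρ.tsupport_subset_chartAt_source) hW
  · rintro _ ⟨S', hS', rfl⟩ b' hb'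
    by_cases hs : b' ∈ (extChartAt 𝓘(ℝ, EL × V) b).source
    · refine Submodule.smul_mem _ _ ?_
      have hbase := (mem_extChartAt_source hB).1 hs
      have hd := 𝒯.chart_fst_mem_dom hbase
      have hpp : 𝒯.proj b' = (chartAt EL (𝒯.proj b)).symm (𝒯.chart (𝒯.proj b) b').1 := by
        rw [← 𝒯.proj_symm hd, 𝒯.symm_chart_apply hbase]
      have hj : (chartAt EL (𝒯.proj b)).symm (𝒯.chart (𝒯.proj b) b').1 ∈
          𝒯.base (𝒯.proj b') := by
        rw [← hpp]; exact 𝒯.mem_base _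
      have h2 : (𝒯.chart (𝒯.proj b) b').2 ∈ S' := (𝒯.mem_leaf_iff hS' hbase).1 hb'
      have h3 : (𝒯.chart (𝒯.proj b') b').2 = 𝒯.transCoord (𝒯.proj b) (𝒯.proj b')
          (𝒯.chart (𝒯.proj b) b').1 (𝒯.chart (𝒯.proj b) b').2 := by
        have := congrArg Prod.snd (𝒯.chart_change hd hj)
        rwa [𝒯.symm_chart_apply hbase] at this
      refine (mem_tangentSpaceOf_leaf_iff hB hS' hb' _).2 ?_
      rw [trivializationAt_symm_eq (E := EL × V) hs, extChartAt_coe hB, extChartAt_coe hB,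
        extChartAt_symm_coe hB, 𝒯.fderiv_chartChange hd hj, h3]
      exact Submodule.add_mem _ (𝒯.transCoord_mem_leafTangent _ _ _ hS' (hX₀t S' hS' _ h2))
        (𝒯.fderiv_transCoord_mem_leafTangent hd hj hS' h2 _)
    · have h0 : ρ b' = 0 := by
        by_contra h0
        exact hs (by simpa using ρ.support_subset_source h0)
      show ρ b' • _ ∈ _
      rw [h0, zero_smul]
      exact Submodule.zero_mem _
  · have h1 : ρ b = 1 := ρ.eq_one
    show ρ b • (trivializationAt (EL × V) (TangentSpace 𝓘(ℝ, EL × V)) b).symm b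
      (W (extChartAt 𝓘(ℝ, EL × V) b b)) = w
    rw [h1, one_smul]
    have hbase := 𝒯.mem_base (𝒯.proj b)
    refine (trivializationAt_symm_eq (E := EL × V) (_root_.mem_extChartAt_source b) _).trans ?_
    rw [extChartAt_coe hB, extChartAt_symm_coe hB]
    have hid : (𝒯.chart (𝒯.proj b) ∘ (𝒯.chart (𝒯.proj b)).symm) =ᶠ[𝓝 (𝒯.chart (𝒯.proj b) b)]
        id := by
      filter_upwards [(𝒯.chart (𝒯.proj b)).open_target.mem_nhds
        (𝒯.mem_target.2 (𝒯.chart_fst_mem_dom hbase))] with z hz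
      exact (𝒯.chart (𝒯.proj b)).right_inv hz
    rw [hid.fderiv_eq, fderiv_id]
    exact Prod.ext rfl hX₀b

end BundleAtlas

/-! ### The leaves as immersed submanifolds -/

section LeafAtlas

variable {V : Type*} [NormedAddCommGroup V] [InnerProductSpace ℝ V] {𝓕 : Set (Set V)}
  {EL : Type*} [NormedAddCommGroup EL] [NormedSpace ℝ EL]
  {L : Type*} [TopologicalSpace L] [ChartedSpace EL L]
  {B : Type*} [TopologicalSpace B] (𝒯 : BundleAtlas (leafIsometries 𝓕) EL L B) (S : Set V)

/-- Local trivializations of a leaf of the bundle: the restrictions of those of the bundle, with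
fibre the leaf `S` of the fibre, in its manifold topology. -/
structure LeafAtlas [TopologicalSpace (LeafCarrier S)]
    [TopologicalSpace (LeafCarrier (𝒯.leaf S))] where
  /-- The local trivialization over `base i`. -/
  chart : L → OpenPartialHomeomorph (LeafCarrier (𝒯.leaf S)) (EL × LeafCarrier S)
  source_eq : ∀ i, (chart i).source = {ℓ | 𝒯.proj ℓ.val ∈ 𝒯.base i}
  target_eq : ∀ i, (chart i).target = {z | z.1 ∈ 𝒯.dom i}
  val_chart : ∀ i ℓ, 𝒯.proj ℓ.val ∈ 𝒯.base i →
    ((chart i ℓ).1, (chart i ℓ).2.val) = 𝒯.chart i ℓ.val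

namespace BundleAtlas

open Classical in
/-- The local trivialization of a leaf, as a map; off `base i` the value is arbitrary. -/
def leafCoord (i : L) (ℓ : LeafCarrier (𝒯.leaf S)) : EL × LeafCarrier S :=
  ((𝒯.chart i ℓ.val).1, if h : (𝒯.chart i ℓ.val).2 ∈ S then ⟨_, h⟩ else ⟨_, ℓ.2⟩)

open Classical in
/-- The inverse of `leafCoord`. -/
def leafCoordSymm [Nonempty (LeafCarrier (𝒯.leaf S))] (i : L) (z : EL × LeafCarrier S) :
    LeafCarrier (𝒯.leaf S) :=
  if h : (𝒯.chart i).symm (z.1, z.2.val) ∈ 𝒯.leaf S then ⟨_, h⟩ else Classical.arbitrary _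

variable {S}

theorem val_leafCoord (hS : S ∈ 𝓕) {i : L} {ℓ : LeafCarrier (𝒯.leaf S)}
    (h : 𝒯.proj ℓ.val ∈ 𝒯.base i) :
    ((𝒯.leafCoord S i ℓ).1, (𝒯.leafCoord S i ℓ).2.val) = 𝒯.chart i ℓ.val := by
  have h1 : (𝒯.chart i ℓ.val).2 ∈ S := (𝒯.mem_leaf_iff hS h).1 ℓ.2
  refine Prod.ext rfl ?_
  exact congrArg LeafCarrier.val (dif_pos h1)

theorem val_leafCoordSymm [Nonempty (LeafCarrier (𝒯.leaf S))] (hS : S ∈ 𝓕) {i : L}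
    {z : EL × LeafCarrier S} (hz : z.1 ∈ 𝒯.dom i) :
    (𝒯.leafCoordSymm S i z).val = (𝒯.chart i).symm (z.1, z.2.val) := by
  have h1 : (𝒯.chart i).symm (z.1, z.2.val) ∈ 𝒯.leaf S :=
    (𝒯.symm_mem_leaf_iff hS (z := (z.1, z.2.val)) hz).2 z.2.val_mem
  exact congrArg LeafCarrier.val (dif_pos h1)

theorem leafCoordSymm_mem [Nonempty (LeafCarrier (𝒯.leaf S))] (hS : S ∈ 𝓕) {i : L}
    {z : EL × LeafCarrier S} (hz : z.1 ∈ 𝒯.dom i) :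
    𝒯.proj (𝒯.leafCoordSymm S i z).val = (chartAt EL i).symm z.1 := by
  rw [𝒯.val_leafCoordSymm hS hz, 𝒯.proj_symm (z := (z.1, z.2.val)) hz]

/-- `leafCoord` and its inverse, over `base i`. -/
def leafPartialEquiv [Nonempty (LeafCarrier (𝒯.leaf S))] (hS : S ∈ 𝓕) (i : L) :
    PartialEquiv (LeafCarrier (𝒯.leaf S)) (EL × LeafCarrier S) where
  toFun := 𝒯.leafCoord S i
  invFun := 𝒯.leafCoordSymm S i
  source := {ℓ | 𝒯.proj ℓ.val ∈ 𝒯.base i}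
  target := {z | z.1 ∈ 𝒯.dom i}
  map_source' ℓ hℓ := by
    have := congrArg Prod.fst (𝒯.val_leafCoord hS hℓ)
    simp only at this
    simp only [mem_ofPred_eq, this]
    exact 𝒯.chart_fst_mem_dom hℓ
  map_target' z hz := by
    simp only [mem_ofPred_eq, 𝒯.leafCoordSymm_mem hS hz]
    exact hz.2
  left_inv' ℓ hℓ := by
    apply LeafCarrier.val_injective
    have h1 := 𝒯.val_leafCoord hS hℓ
    rw [𝒯.val_leafCoordSymm hS, h1, 𝒯.symm_chart_apply hℓ]
    rw [congrArg Prod.fst h1]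
    exact 𝒯.chart_fst_mem_dom hℓ
  right_inv' z hz := by
    have h1 : 𝒯.proj (𝒯.leafCoordSymm S i z).val ∈ 𝒯.base i := by
      rw [𝒯.leafCoordSymm_mem hS hz]
      exact hz.2
    have h2 := 𝒯.val_leafCoord hS h1
    rw [𝒯.val_leafCoordSymm hS hz, 𝒯.chart_symm_apply (z := (z.1, z.2.val)) hz] at h2
    exact Prod.ext (Prod.mk.inj h2).1 (LeafCarrier.val_injective (Prod.mk.inj h2).2)

/-- The manifold topology of a leaf of the bundle. The changes of the local trivializations are
continuous for it, since a map to a leaf of the fibre that is continuous as a map to `V` is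
continuous for the manifold topology. -/
theorem exists_leafAtlas [FiniteDimensional ℝ EL] [IsManifold 𝓘(ℝ, EL) ∞ L]
    {k : ℕ} [TopologicalSpace (LeafCarrier S)]
    [ChartedSpace (EuclideanSpace ℝ (Fin k)) (LeafCarrier S)]
    (h𝓕 : IsDisconnectedInfinitesimalFoliation 𝓕) (hS : S ∈ 𝓕)
    (hI : IsImmersedStructure (E := V) S k) [Nonempty (LeafCarrier (𝒯.leaf S))] :
    ∃ _ : TopologicalSpace (LeafCarrier (𝒯.leaf S)), Nonempty (LeafAtlas 𝒯 S) := by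
  have : LocallyConnectedSpace (LeafCarrier S) :=
    ChartedSpace.locallyConnectedSpace (EuclideanSpace ℝ (Fin k)) _
  have hsrc : ∀ i j, ((𝒯.leafPartialEquiv hS i).symm.trans (𝒯.leafPartialEquiv hS j)).source =
      Prod.fst ⁻¹' (𝒯.dom i ∩ (chartAt EL i).symm ⁻¹' 𝒯.base j) := by
    intro i j
    ext z
    constructor
    · rintro ⟨h1, h2⟩
      refine ⟨h1, ?_⟩
      have h3 : 𝒯.proj (𝒯.leafCoordSymm S i z).val ∈ 𝒯.base j := h2
      rwa [𝒯.leafCoordSymm_mem hS h1] at h3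
    · rintro ⟨h1, h2⟩
      refine ⟨h1, ?_⟩
      show 𝒯.proj (𝒯.leafCoordSymm S i z).val ∈ 𝒯.base j
      rw [𝒯.leafCoordSymm_mem hS h1]
      exact h2
  have hopen : ∀ i j, IsOpen ((𝒯.leafPartialEquiv hS i).symm.trans
      (𝒯.leafPartialEquiv hS j)).source := fun i j ↦ by
    rw [hsrc]
    exact (𝒯.isOpen_overlap i j).preimage continuous_fst
  let C : ChartedSpaceCore (EL × LeafCarrier S) (LeafCarrier (𝒯.leaf S)) :=
    { atlas := range (𝒯.leafPartialEquiv hS)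
      chartAt := fun ℓ ↦ 𝒯.leafPartialEquiv hS (𝒯.proj ℓ.val)
      mem_chart_source := fun ℓ ↦ 𝒯.mem_base _
      chart_mem_atlas := fun ℓ ↦ mem_range_self _
      open_source := by
        rintro _ _ ⟨i, rfl⟩ ⟨j, rfl⟩
        exact hopen i j
      continuousOn_toFun := by
        rintro _ _ ⟨i, rfl⟩ ⟨j, rfl⟩
        have hval : ∀ z : EL × LeafCarrier S,
            z.1 ∈ 𝒯.dom i ∩ (chartAt EL i).symm ⁻¹' 𝒯.base j →
            ((𝒯.leafCoord S j (𝒯.leafCoordSymm S i z)).1,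
              (𝒯.leafCoord S j (𝒯.leafCoordSymm S i z)).2.val) =
              ((baseChange i j z.1 : EL), 𝒯.transCoord i j z.1 z.2.val) := by
          rintro z ⟨h1, h2⟩
          rw [𝒯.val_leafCoord hS (by rw [𝒯.leafCoordSymm_mem hS h1]; exact h2),
            𝒯.val_leafCoordSymm hS h1, 𝒯.chart_change (z := (z.1, z.2.val)) h1 h2]
        have hvalc : Continuous (LeafCarrier.val (S := S)) := hI.contMDiff_val.continuous
        have hcont : ∀ z : EL × LeafCarrier S,
            z.1 ∈ 𝒯.dom i ∩ (chartAt EL i).symm ⁻¹' 𝒯.base j → ContinuousAt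
              (fun z : EL × LeafCarrier S ↦
                ((baseChange i j z.1 : EL), 𝒯.transCoord i j z.1 z.2.val)) z := by
          rintro z ⟨h1, h2⟩
          refine ContinuousAt.prodMk ?_ ?_
          · exact ContinuousAt.comp (g := (baseChange i j : EL → EL))
              (contDiffAt_baseChange h1.1 (𝒯.base_subset j h2)).continuousAt continuousAt_fst
          · exact ContinuousAt.clm_apply (ContinuousAt.comp (g := 𝒯.transCoord i j)
              (𝒯.contDiffAt_transCoord h1 h2).continuousAt continuousAt_fst)
              (hvalc.continuousAt.comp continuousAt_snd)
        intro z hz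
        rw [hsrc] at hz
        have hnhds : ∀ z : EL × LeafCarrier S,
            z.1 ∈ 𝒯.dom i ∩ (chartAt EL i).symm ⁻¹' 𝒯.base j → ∀ᶠ z' in 𝓝 z,
              z'.1 ∈ 𝒯.dom i ∩ (chartAt EL i).symm ⁻¹' 𝒯.base j := fun z hz ↦
          ((𝒯.isOpen_overlap i j).preimage continuous_fst).mem_nhds hz
        have hcong : ∀ z : EL × LeafCarrier S,
            z.1 ∈ 𝒯.dom i ∩ (chartAt EL i).symm ⁻¹' 𝒯.base j →
            ContinuousAt (fun z ↦ ((𝒯.leafCoord S j (𝒯.leafCoordSymm S i z)).1,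
              (𝒯.leafCoord S j (𝒯.leafCoordSymm S i z)).2.val)) z := fun z hz ↦
          (hcont z hz).congr ((hnhds z hz).mono fun z' hz' ↦ (hval z' hz').symm)
        refine ContinuousAt.continuousWithinAt (ContinuousAt.prodMk (hcong z hz).fst ?_)
        refine continuousAt_of_continuousAt_val h𝓕 hS hI ?_
        filter_upwards [hnhds z hz] with z' hz'
        exact (hcong z' hz').snd }
  refine ⟨C.toTopologicalSpace, ⟨?_⟩⟩
  let _ := C.toTopologicalSpace
  exact
    { chart := fun i ↦ C.openPartialHomeomorph (𝒯.leafPartialEquiv hS i) (mem_range_self i)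
      source_eq := fun i ↦ rfl
      target_eq := fun i ↦ rfl
      val_chart := fun i ℓ h ↦ 𝒯.val_leafCoord hS h }

end BundleAtlas

end LeafAtlas

namespace LeafAtlas

variable {V : Type*} [NormedAddCommGroup V] [InnerProductSpace ℝ V] {𝓕 : Set (Set V)}
  {EL : Type*} [NormedAddCommGroup EL] [NormedSpace ℝ EL]
  {L : Type*} [TopologicalSpace L] [ChartedSpace EL L]
  {B : Type*} [TopologicalSpace B] {𝒯 : BundleAtlas (leafIsometries 𝓕) EL L B} {S : Set V}
  [TopologicalSpace (LeafCarrier S)] [TopologicalSpace (LeafCarrier (𝒯.leaf S))]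
  (Λ : LeafAtlas 𝒯 S)

theorem mem_source {i : L} {ℓ : LeafCarrier (𝒯.leaf S)} :
    ℓ ∈ (Λ.chart i).source ↔ 𝒯.proj ℓ.val ∈ 𝒯.base i := by
  rw [Λ.source_eq]; rfl

theorem mem_target {i : L} {z : EL × LeafCarrier S} :
    z ∈ (Λ.chart i).target ↔ z.1 ∈ 𝒯.dom i := by
  rw [Λ.target_eq]; rfl

theorem val_symm {i : L} {z : EL × LeafCarrier S} (hz : z.1 ∈ 𝒯.dom i) :
    ((Λ.chart i).symm z).val = (𝒯.chart i).symm (z.1, z.2.val) := by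
  have h1 := Λ.mem_source.1 ((Λ.chart i).map_target (Λ.mem_target.2 hz))
  have h2 := Λ.val_chart i _ h1
  rw [(Λ.chart i).right_inv (Λ.mem_target.2 hz)] at h2
  rw [h2, 𝒯.symm_chart_apply h1]

theorem proj_symm {i : L} {z : EL × LeafCarrier S} (hz : z.1 ∈ 𝒯.dom i) :
    𝒯.proj ((Λ.chart i).symm z).val = (chartAt EL i).symm z.1 := by
  rw [Λ.val_symm hz, 𝒯.proj_symm (z := (z.1, z.2.val)) hz]

theorem val_chart_symm {i j : L} {z : EL × LeafCarrier S} (hz : z.1 ∈ 𝒯.dom i)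
    (hj : (chartAt EL i).symm z.1 ∈ 𝒯.base j) :
    ((Λ.chart j ((Λ.chart i).symm z)).1, (Λ.chart j ((Λ.chart i).symm z)).2.val) =
      ((BundleAtlas.baseChange i j z.1 : EL), 𝒯.transCoord i j z.1 z.2.val) := by
  rw [Λ.val_chart j _ (by rw [Λ.proj_symm hz]; exact hj), Λ.val_symm hz,
    𝒯.chart_change (z := (z.1, z.2.val)) hz hj]

include Λ in
theorem continuous_val (hv : Continuous (LeafCarrier.val (S := S))) :
    Continuous (LeafCarrier.val (S := 𝒯.leaf S)) := by
  refine continuous_iff_continuousAt.2 fun ℓ ↦ ?_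
  set i := 𝒯.proj ℓ.val
  have hℓ : ℓ ∈ (Λ.chart i).source := Λ.mem_source.2 (𝒯.mem_base _)
  have h1 : ContinuousAt (fun ℓ ↦ (𝒯.chart i).symm ((Λ.chart i ℓ).1, (Λ.chart i ℓ).2.val)) ℓ := by
    have h2 := (Λ.chart i).continuousAt hℓ
    refine ContinuousAt.comp (g := (𝒯.chart i).symm) ((𝒯.chart i).continuousAt_symm ?_)
      (h2.fst.prodMk (hv.continuousAt.comp h2.snd))
    exact 𝒯.mem_target.2 (Λ.mem_target.1 ((Λ.chart i).map_source hℓ))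
  refine h1.congr ?_
  filter_upwards [(Λ.chart i).open_source.mem_nhds hℓ] with ℓ' hℓ'
  rw [Λ.val_chart i ℓ' (Λ.mem_source.1 hℓ'), 𝒯.symm_chart_apply (Λ.mem_source.1 hℓ')]

include Λ in
theorem secondCountableTopology [FiniteDimensional ℝ EL] [SecondCountableTopology L]
    [SecondCountableTopology (LeafCarrier S)] :
    SecondCountableTopology (LeafCarrier (𝒯.leaf S)) := by
  obtain ⟨s, hs, h⟩ := 𝒯.exists_countable_cover
  have : Countable s := hs.to_subtype
  have : ∀ i : s, SecondCountableTopology (Λ.chart i).source := fun i ↦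
    (Λ.chart i).toHomeomorphSourceTarget.secondCountableTopology
  refine TopologicalSpace.secondCountableTopology_of_countable_cover
    (fun i : s ↦ (Λ.chart i).open_source) ?_
  refine eq_univ_of_forall fun b ↦ ?_
  obtain ⟨i, hi, hb⟩ := h (𝒯.proj b.val)
  exact mem_iUnion.2 ⟨⟨i, hi⟩, Λ.mem_source.2 hb⟩

section Charted

variable {k : ℕ} [ChartedSpace (EuclideanSpace ℝ (Fin k)) (LeafCarrier S)]

include Λ in
/-- A path of the bundle that stays in a leaf is continuous for the manifold topology of the
leaf. -/
theorem connectedSpace (h𝓕 : IsDisconnectedInfinitesimalFoliation 𝓕) (hS : S ∈ 𝓕)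
    (hI : IsImmersedStructure (E := V) S k) (hc : IsPathConnected (𝒯.leaf S)) :
    ConnectedSpace (LeafCarrier (𝒯.leaf S)) := by
  have hlift : ∀ γ : ℝ → LeafCarrier (𝒯.leaf S), Continuous (fun t ↦ (γ t).val) →
      Continuous γ := by
    intro γ hγ
    refine continuous_iff_continuousAt.2 fun t ↦ ?_
    set i := 𝒯.proj (γ t).val
    have hev : ∀ᶠ t' in 𝓝 t, 𝒯.proj (γ t').val ∈ 𝒯.base i :=
      (𝒯.continuous_proj.comp hγ).continuousAt.preimage_mem_nhds
        ((𝒯.isOpen_base i).mem_nhds (𝒯.mem_base i))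
    have h1 : ∀ᶠ t' in 𝓝 t, ContinuousAt
        (fun t ↦ ((Λ.chart i (γ t)).1, (Λ.chart i (γ t)).2.val)) t' := by
      filter_upwards [hev.eventually_nhds] with t' ht'
      have h2 : ContinuousAt (fun t ↦ 𝒯.chart i (γ t).val) t' :=
        ContinuousAt.comp (g := 𝒯.chart i) (f := fun t ↦ (γ t).val)
          ((𝒯.chart i).continuousAt (𝒯.mem_source.2 ht'.self_of_nhds)) hγ.continuousAt
      exact h2.congr (ht'.mono fun s hs ↦ (Λ.val_chart i _ hs).symm)
    have h3 : ContinuousAt (fun t ↦ Λ.chart i (γ t)) t := by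
      refine ContinuousAt.prodMk h1.self_of_nhds.fst ?_
      exact continuousAt_of_continuousAt_val h𝓕 hS hI (h1.mono fun t' ht' ↦ ht'.snd)
    have h4 : γ t ∈ (Λ.chart i).source := Λ.mem_source.2 (𝒯.mem_base i)
    have h5 : ContinuousAt (fun t ↦ (Λ.chart i).symm (Λ.chart i (γ t))) t :=
      ContinuousAt.comp (g := (Λ.chart i).symm)
        ((Λ.chart i).continuousAt_symm ((Λ.chart i).map_source h4)) h3
    refine h5.congr ?_
    filter_upwards [hev] with t' ht'
    exact (Λ.chart i).left_inv (Λ.mem_source.2 ht')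
  obtain ⟨b₀, hb₀, hj⟩ := hc
  have : PathConnectedSpace (LeafCarrier (𝒯.leaf S)) := by
    refine pathConnectedSpace_iff_univ.2 ⟨⟨b₀, hb₀⟩, mem_univ _, fun {b} _ ↦ ?_⟩
    obtain ⟨γ, hγ⟩ := hj b.2
    refine JoinedIn.ofLine (f := fun t ↦ ⟨γ.extend t, ?_⟩) (hlift _ ?_).continuousOn ?_ ?_
      (subset_univ _)
    · exact hγ _
    · exact γ.continuous_extend
    · exact LeafCarrier.val_injective γ.extend_zero
    · exact LeafCarrier.val_injective γ.extend_one
  infer_instance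

/-- The chart of a leaf of the bundle obtained from the local trivialization at `i` and the chart
of the leaf of the fibre at `s`. -/
def leafChart (i : L) (s : LeafCarrier S) : OpenPartialHomeomorph (LeafCarrier (𝒯.leaf S))
    (EL × EuclideanSpace ℝ (Fin k)) :=
  (Λ.chart i).trans ((OpenPartialHomeomorph.refl EL).prod (chartAt _ s))

theorem leafChart_symm_apply (i : L) (s : LeafCarrier S) (q : EL × EuclideanSpace ℝ (Fin k)) :
    (Λ.leafChart i s).symm q = (Λ.chart i).symm (q.1, (chartAt _ s).symm q.2) := rfl

theorem mem_leafChart_source {i : L} {s : LeafCarrier S} {ℓ : LeafCarrier (𝒯.leaf S)} :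
    ℓ ∈ (Λ.leafChart (k := k) i s).source ↔ 𝒯.proj ℓ.val ∈ 𝒯.base i ∧
      (Λ.chart i ℓ).2 ∈ (chartAt (EuclideanSpace ℝ (Fin k)) s).source := by
  simp [leafChart, Λ.mem_source]

theorem mem_leafChart_target {i : L} {s : LeafCarrier S} {q : EL × EuclideanSpace ℝ (Fin k)} :
    q ∈ (Λ.leafChart i s).target ↔ q.1 ∈ 𝒯.dom i ∧
      q.2 ∈ (chartAt (EuclideanSpace ℝ (Fin k)) s).target := by
  simp [leafChart, Λ.mem_target, and_comm]

/-- The inclusion in the bundle, in the coordinates of `leafChart`. -/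
theorem val_leafChart_symm {i : L} {s : LeafCarrier S} {q : EL × EuclideanSpace ℝ (Fin k)}
    (hq : q.1 ∈ 𝒯.dom i) :
    ((Λ.leafChart i s).symm q).val = (𝒯.chart i).symm (q.1, leafParam S s q.2) :=
  Λ.val_symm (z := (q.1, (chartAt _ s).symm q.2)) hq

/-- In coordinates of the leaf of the fibre, a transition function sends `(y, z)` to the point of
the leaf `S` with value `transCoord i j y (leafParam S s z)`. It is smooth as a map to `V`; that it
is smooth as a map to `S` is where weak embeddedness of the leaves enters, in the form of continuity
for the topology of the leaf. -/
theorem contDiffAt_leafChart_change [FiniteDimensional ℝ V] [IsManifold 𝓘(ℝ, EL) ∞ L]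
    (hI : IsImmersedStructure (E := V) S k) {i j : L} {s s' : LeafCarrier S}
    {q : EL × EuclideanSpace ℝ (Fin k)} (hq : q ∈ (Λ.leafChart i s).target)
    (hq' : (Λ.leafChart i s).symm q ∈ (Λ.leafChart (k := k) j s').source) :
    ContDiffAt ℝ ∞ (Λ.leafChart (k := k) j s' ∘ (Λ.leafChart i s).symm) q := by
  have := hI.isManifold
  obtain ⟨h1, h2⟩ := Λ.mem_leafChart_target.1 hq
  obtain ⟨h3, h4⟩ := Λ.mem_leafChart_source.1 hq'
  rw [leafChart_symm_apply] at h3 h4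
  rw [Λ.proj_symm (z := (q.1, (chartAt _ s).symm q.2)) h1] at h3
  have hev : ∀ᶠ q' in 𝓝 q, q'.1 ∈ 𝒯.dom i ∩ (chartAt EL i).symm ⁻¹' 𝒯.base j :=
    ((𝒯.isOpen_overlap i j).preimage continuous_fst).mem_nhds ⟨h1, h3⟩
  have hval : ∀ q' : EL × EuclideanSpace ℝ (Fin k),
      q'.1 ∈ 𝒯.dom i ∩ (chartAt EL i).symm ⁻¹' 𝒯.base j →
      ((Λ.chart j ((Λ.leafChart i s).symm q')).1, (Λ.chart j ((Λ.leafChart i s).symm q')).2.val) =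
        ((BundleAtlas.baseChange i j q'.1 : EL),
          𝒯.transCoord i j q'.1 (leafParam (k := k) S s q'.2)) :=
    fun q' hq' ↦ Λ.val_chart_symm (i := i) (z := (q'.1, (chartAt _ s).symm q'.2)) hq'.1 hq'.2
  have hcd : ContDiffAt ℝ ∞ (fun q' : EL × EuclideanSpace ℝ (Fin k) ↦
      ((BundleAtlas.baseChange i j q'.1 : EL),
        𝒯.transCoord i j q'.1 (leafParam (k := k) S s q'.2))) q := by
    have h5 : ContDiffAt ℝ ∞ (leafParam S s) q.2 :=
      hI.contDiffAt_leafParam (by simpa using h2)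
    exact (ContDiffAt.comp q (BundleAtlas.contDiffAt_baseChange h1.1 (𝒯.base_subset j h3))
      contDiffAt_fst).prodMk (((𝒯.contDiffAt_transCoord h1 h3).comp q contDiffAt_fst).clm_apply
        (h5.comp q contDiffAt_snd))
  have hcd' : ContDiffAt ℝ ∞ (fun q' ↦ ((Λ.chart j ((Λ.leafChart i s).symm q')).1,
      (Λ.chart j ((Λ.leafChart i s).symm q')).2.val)) q :=
    hcd.congr_of_eventuallyEq (hev.mono hval)
  have hcont : ContinuousAt (fun q' ↦ (Λ.chart j ((Λ.leafChart i s).symm q')).2) q := by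
    refine ContinuousAt.snd ?_
    refine ContinuousAt.comp (g := Λ.chart j) ((Λ.chart j).continuousAt ?_)
      ((Λ.leafChart i s).continuousAt_symm hq)
    exact Λ.mem_source.2 (Λ.mem_leafChart_source.1 hq').1
  have h6 : ContMDiffAt 𝓘(ℝ, EL × EuclideanSpace ℝ (Fin k)) (𝓡 k) ∞
      (fun q' ↦ (Λ.chart j ((Λ.leafChart i s).symm q')).2) q :=
    contMDiffAt_of_contMDiffAt_val hI hcont (contDiffAt_snd.comp q hcd').contMDiffAt
  have h7 := contMDiffAt_extChartAt' (I := 𝓡 k) (n := ∞) h4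
  exact (contDiffAt_fst.comp q hcd').prodMk
    (ContMDiffAt.comp (I' := 𝓡 k) q (g := extChartAt (𝓡 k) s') h7 h6).contDiffAt

variable [FiniteDimensional ℝ EL]

/-- The dimension of a leaf of the bundle, if the leaf of the fibre has dimension `k`. -/
abbrev leafDim (EL : Type*) [NormedAddCommGroup EL] [NormedSpace ℝ EL] (k : ℕ) : ℕ :=
  Module.finrank ℝ (EL × EuclideanSpace ℝ (Fin k))

/-- The linear change of coordinates from `EL × ℝᵏ` to the model space of the leaf. -/
def leafLin (EL : Type*) [NormedAddCommGroup EL] [NormedSpace ℝ EL] [FiniteDimensional ℝ EL]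
    (k : ℕ) : (EL × EuclideanSpace ℝ (Fin k)) ≃L[ℝ]
      EuclideanSpace ℝ (Fin (leafDim EL k)) := toEuclidean

/-- The manifold structure of a leaf of the bundle. -/
@[reducible] def chartedSpace : ChartedSpace
    (EuclideanSpace ℝ (Fin (leafDim EL k)))
    (LeafCarrier (𝒯.leaf S)) where
  atlas := range fun p : L × LeafCarrier S ↦
    (Λ.leafChart p.1 p.2).trans (leafLin EL k).toHomeomorph.toOpenPartialHomeomorph
  chartAt ℓ := (Λ.leafChart (𝒯.proj ℓ.val) (Λ.chart (𝒯.proj ℓ.val) ℓ).2).trans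
    (leafLin EL k).toHomeomorph.toOpenPartialHomeomorph
  mem_chart_source ℓ := by
    simp only [mfld_simps, Λ.mem_leafChart_source]
    exact 𝒯.mem_base _
  chart_mem_atlas ℓ := ⟨(𝒯.proj ℓ.val, (Λ.chart (𝒯.proj ℓ.val) ℓ).2), rfl⟩

theorem isManifold [FiniteDimensional ℝ V] [IsManifold 𝓘(ℝ, EL) ∞ L]
    (hI : IsImmersedStructure (E := V) S k) :
    let _ := Λ.chartedSpace (k := k)
    IsManifold (𝓡 (leafDim EL k)) ∞
      (LeafCarrier (𝒯.leaf S)) := by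
  intro _
  refine isManifold_of_contDiffOn _ _ _ ?_
  rintro _ _ ⟨⟨i, s⟩, rfl⟩ ⟨⟨j, s'⟩, rfl⟩
  simp only [modelWithCornersSelf_coe, modelWithCornersSelf_coe_symm, range_id, inter_univ,
    Function.id_comp, Function.comp_id, preimage_id]
  intro z hz
  have hz1 : (leafLin EL k).symm z ∈ (Λ.leafChart i s).target := by
    have := hz.1
    simpa [mfld_simps] using this
  have hz2 : (Λ.leafChart i s).symm ((leafLin EL k).symm z) ∈
      (Λ.leafChart (k := k) j s').source := by
    have := hz.2
    simpa [mfld_simps] using this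
  refine ContDiffAt.contDiffWithinAt ?_
  exact (leafLin EL k).contDiff.contDiffAt.comp z
    ((Λ.contDiffAt_leafChart_change hI hz1 hz2).comp z (leafLin EL k).symm.contDiff.contDiffAt)

end Charted

end LeafAtlas

namespace LeafAtlas

variable {V : Type*} [NormedAddCommGroup V] [InnerProductSpace ℝ V] [FiniteDimensional ℝ V]
  {𝓕 : Set (Set V)}
  {EL : Type*} [NormedAddCommGroup EL] [NormedSpace ℝ EL] [FiniteDimensional ℝ EL]
  {L : Type*} [TopologicalSpace L] [ChartedSpace EL L] [IsManifold 𝓘(ℝ, EL) ∞ L]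
  {B : Type*} [TopologicalSpace B] {𝒯 : BundleAtlas (leafIsometries 𝓕) EL L B} {S : Set V}
  [ChartedSpace (EL × V) B] [IsManifold 𝓘(ℝ, EL × V) ∞ B]
  [TopologicalSpace (LeafCarrier S)] [TopologicalSpace (LeafCarrier (𝒯.leaf S))]
  (Λ : LeafAtlas 𝒯 S) {k : ℕ} [ChartedSpace (EuclideanSpace ℝ (Fin k)) (LeafCarrier S)]

/-- A leaf of the bundle is an immersed submanifold: the inclusion is, in the local
trivializations, the product of the identity of the base with the inclusion of the leaf of the
fibre. -/
theorem isImmersedStructure [T2Space L] [SecondCountableTopology L]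
    (hB : ∀ b : B, chartAt (EL × V) b = 𝒯.chart (𝒯.proj b)) (hS : S ∈ 𝓕)
    (hI : IsImmersedStructure (E := V) S k) :
    let _ := Λ.chartedSpace (k := k)
    IsImmersedStructure (E := EL × V) (𝒯.leaf S)
      (leafDim EL k) := by
  intro _
  have := hI.isManifold
  have := hI.secondCountable
  have := 𝒯.t2Space
  have hcont := Λ.continuous_val hI.contMDiff_val.continuous
  -- the inclusion in the charts at `ℓ`
  let Ψ : LeafCarrier S → EuclideanSpace ℝ (Fin (leafDim EL k)) → EL × V := fun s z ↦
    (((leafLin EL k).symm z).1, leafParam S s ((leafLin EL k).symm z).2)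
  have hz₀ : ∀ ℓ : LeafCarrier (𝒯.leaf S), (leafLin EL k).symm (extChartAt (𝓡 (leafDim EL k)) ℓ ℓ) =
      Λ.leafChart (𝒯.proj ℓ.val) (Λ.chart (𝒯.proj ℓ.val) ℓ).2 ℓ := by
    intro ℓ
    exact (leafLin EL k).symm_apply_apply _
  have hz₀' : ∀ ℓ : LeafCarrier (𝒯.leaf S),
      (leafLin EL k).symm (extChartAt (𝓡 (leafDim EL k)) ℓ ℓ) ∈
      (Λ.leafChart (k := k) (𝒯.proj ℓ.val) (Λ.chart (𝒯.proj ℓ.val) ℓ).2).target := by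
    intro ℓ
    rw [hz₀]
    exact (Λ.leafChart (k := k) _ _).map_source
      (Λ.mem_leafChart_source.2 ⟨𝒯.mem_base _, mem_chart_source _ _⟩)
  have hwritten : ∀ ℓ : LeafCarrier (𝒯.leaf S),
      writtenInExtChartAt (𝓡 (leafDim EL k)) 𝓘(ℝ, EL × V) ℓ (LeafCarrier.val (S := 𝒯.leaf S)) =ᶠ[
        𝓝 (extChartAt (𝓡 (leafDim EL k)) ℓ ℓ)] Ψ (Λ.chart (𝒯.proj ℓ.val) ℓ).2 := by
    intro ℓ
    have h1 : ∀ᶠ z in 𝓝 (extChartAt (𝓡 (leafDim EL k)) ℓ ℓ),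
        ((leafLin EL k).symm z).1 ∈ 𝒯.dom (𝒯.proj ℓ.val) :=
      (continuous_fst.comp (leafLin EL k).symm.continuous).continuousAt.preimage_mem_nhds
        ((𝒯.isOpen_dom _).mem_nhds (Λ.mem_leafChart_target.1 (hz₀' ℓ)).1)
    filter_upwards [h1] with z hz
    show extChartAt 𝓘(ℝ, EL × V) ℓ.val ((Λ.leafChart (𝒯.proj ℓ.val)
      (Λ.chart (𝒯.proj ℓ.val) ℓ).2).symm ((leafLin EL k).symm z)).val = _
    rw [Λ.val_leafChart_symm hz, BundleAtlas.extChartAt_coe hB]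
    exact 𝒯.chart_symm_apply (z := Ψ (Λ.chart (𝒯.proj ℓ.val) ℓ).2 z) hz
  have hsmooth : ∀ ℓ : LeafCarrier (𝒯.leaf S),
      ContDiffAt ℝ ∞ (Ψ (Λ.chart (𝒯.proj ℓ.val) ℓ).2) (extChartAt (𝓡 (leafDim EL k)) ℓ ℓ) := by
    intro ℓ
    have h1 := (Λ.mem_leafChart_target.1 (hz₀' ℓ)).2
    have h2 : ContDiffAt ℝ ∞ (leafParam S (Λ.chart (𝒯.proj ℓ.val) ℓ).2)
        ((leafLin EL k).symm (extChartAt (𝓡 (leafDim EL k)) ℓ ℓ)).2 :=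
      hI.contDiffAt_leafParam (by simpa using h1)
    have h3 : ContDiffAt ℝ ∞ (leafLin EL k).symm (extChartAt (𝓡 (leafDim EL k)) ℓ ℓ) :=
      (leafLin EL k).symm.contDiff.contDiffAt
    exact (contDiffAt_fst.comp _ h3).prodMk
      (ContDiffAt.comp _ (g := leafParam S (Λ.chart (𝒯.proj ℓ.val) ℓ).2) h2
        (contDiffAt_snd.comp _ h3))
  have hderiv : ∀ ℓ : LeafCarrier (𝒯.leaf S), ∃ D : EuclideanSpace ℝ (Fin k) →L[ℝ] V,
      Function.Injective D ∧
      D.range = leafTangent S (𝒯.chart (𝒯.proj ℓ.val) ℓ.val).2 ∧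
      HasMFDerivAt (𝓡 (leafDim EL k)) 𝓘(ℝ, EL × V) (LeafCarrier.val (S := 𝒯.leaf S)) ℓ
        (((ContinuousLinearMap.fst ℝ EL (EuclideanSpace ℝ (Fin k))).prod
          (D.comp (ContinuousLinearMap.snd ℝ EL (EuclideanSpace ℝ (Fin k))))).comp
            (leafLin EL k).symm.toContinuousLinearMap) := by
    intro ℓ
    set s := (Λ.chart (𝒯.proj ℓ.val) ℓ).2 with hs
    have h1 := (Λ.mem_leafChart_target.1 (hz₀' ℓ)).2
    set w₀ := ((leafLin EL k).symm (extChartAt (𝓡 (leafDim EL k)) ℓ ℓ)).2 with hw₀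
    have h1' : w₀ ∈ (extChartAt (𝓡 k) s).target := by simpa using h1
    have h2 : HasFDerivAt (leafParam S s) (fderiv ℝ (leafParam S s) w₀) w₀ :=
      ((hI.contDiffAt_leafParam h1').differentiableAt (by simp)).hasFDerivAt
    obtain ⟨h3, h4⟩ := hI.exists_fderiv_leafParam h1'
    refine ⟨fderiv ℝ (leafParam S s) w₀, h3, ?_, hcont.continuousAt, ?_⟩
    · rw [h4]
      congr 1
      have h5 : w₀ = extChartAt (𝓡 k) s s := congrArg Prod.snd (hz₀ ℓ)
      rw [h5, IsImmersedStructure.leafParam_extChartAt]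
      exact congrArg Prod.snd (Λ.val_chart (𝒯.proj ℓ.val) ℓ (𝒯.mem_base _))
    · refine HasFDerivAt.hasFDerivWithinAt ?_
      refine HasFDerivAt.congr_of_eventuallyEq ?_ (hwritten ℓ)
      have h6 := (leafLin EL k).symm.hasFDerivAt (x := extChartAt (𝓡 (leafDim EL k)) ℓ ℓ)
      exact (hasFDerivAt_fst.comp _ h6).prodMk (h2.comp _ (hasFDerivAt_snd.comp _ h6))
  refine ⟨Λ.isManifold hI, ?_, Λ.secondCountableTopology, ?_, ?_, ?_⟩
  · exact T2Space.of_injective_continuous LeafCarrier.val_injective hcont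
  · intro ℓ
    rw [contMDiffAt_iff]
    exact ⟨hcont.continuousAt,
      ((hsmooth ℓ).congr_of_eventuallyEq (hwritten ℓ)).contDiffWithinAt⟩
  · intro ℓ
    obtain ⟨D, hD, -, h⟩ := hderiv ℓ
    rw [h.mfderiv]
    intro u u' huu
    have h1 := congrArg Prod.fst huu
    have h2 := hD (congrArg Prod.snd huu)
    exact (leafLin EL k).symm.injective (Prod.ext h1 h2)
  · intro ℓ
    obtain ⟨D, -, hD, h⟩ := hderiv ℓ
    rw [h.mfderiv]
    ext w
    refine Iff.trans ?_ (BundleAtlas.mem_tangentSpaceOf_leaf_iff hB hS ℓ.2 w).symm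
    have hD' : leafTangent S (𝒯.chart (𝒯.proj ℓ.val) ℓ.val).2 =
        leafTangent S (𝒯.chart (𝒯.proj ℓ.1) ℓ.1).2 := rfl
    rw [← hD', ← hD]
    constructor
    · rintro ⟨u, rfl⟩
      exact ⟨((leafLin EL k).symm u).2, rfl⟩
    · rintro ⟨u, hu⟩
      refine ⟨leafLin EL k ((w : EL × V).1, u), ?_⟩
      show (((leafLin EL k).symm (leafLin EL k ((w : EL × V).1, u))).1,
        D ((leafLin EL k).symm (leafLin EL k ((w : EL × V).1, u))).2) = (w : EL × V)
      rw [(leafLin EL k).symm_apply_apply]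
      exact Prod.ext rfl hu

end LeafAtlas

theorem BundleAtlas.isConnectedImmersedSubmanifold_leaf
    {V : Type*} [NormedAddCommGroup V] [InnerProductSpace ℝ V] [FiniteDimensional ℝ V]
    {𝓕 : Set (Set V)}
    {EL : Type*} [NormedAddCommGroup EL] [NormedSpace ℝ EL] [FiniteDimensional ℝ EL]
    {L : Type*} [TopologicalSpace L] [ChartedSpace EL L] [IsManifold 𝓘(ℝ, EL) ∞ L]
    [T2Space L] [SecondCountableTopology L]
    {B : Type*} [TopologicalSpace B] {𝒯 : BundleAtlas (leafIsometries 𝓕) EL L B} {S : Set V}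
    [ChartedSpace (EL × V) B] [IsManifold 𝓘(ℝ, EL × V) ∞ B]
    (hB : ∀ b : B, chartAt (EL × V) b = 𝒯.chart (𝒯.proj b))
    (h𝓕 : IsDisconnectedInfinitesimalFoliation 𝓕) (hS : S ∈ 𝓕)
    (hc : IsPathConnected (𝒯.leaf S)) :
    IsConnectedImmersedSubmanifold (EL × V) (𝒯.leaf S) := by
  obtain ⟨k, _, _, hI⟩ := h𝓕.isImmersedSubmanifold S hS
  have : Nonempty (LeafCarrier (𝒯.leaf S)) := hc.nonempty.to_subtype
  obtain ⟨_, ⟨Λ⟩⟩ := 𝒯.exists_leafAtlas h𝓕 hS hI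
  exact ⟨_, _, Λ.chartedSpace, Λ.isImmersedStructure hB hS hI, Λ.connectedSpace h𝓕 hS hI hc⟩

/-! ### Separate conservation of the horizontal and the vertical speed -/

theorem contDiffAt_deriv {E : Type*} [NormedAddCommGroup E] [NormedSpace ℝ E] {c : ℝ → E} {t : ℝ}
    (hc : ContDiffAt ℝ ∞ c t) : ContDiffAt ℝ ∞ (deriv c) t := by
  have h : ContDiffAt ℝ ∞ (fun s ↦ fderiv ℝ c s 1) t :=
    (hc.fderiv_right (by simp)).clm_apply contDiffAt_const
  exact h.congr_of_eventuallyEq (Filter.Eventually.of_forall fun s ↦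
    fderiv_apply_one_eq_deriv.symm)

/-- Conservation of energy: the Euler-Lagrange equation implies that the speed is constant. -/
theorem hasDerivAt_energy {E : Type*} [NormedAddCommGroup E] [NormedSpace ℝ E]
    {q : E → E → E → ℝ} {c : ℝ → E} {t : ℝ}
    (hq : DifferentiableAt ℝ (fun p : E × E × E ↦ q p.1 p.2.1 p.2.2) (c t, deriv c t, deriv c t))
    (hc : ContDiffAt ℝ ∞ c t) {β : LinearMap.BilinForm ℝ E} (hβ : ∀ u w, q (c t) u w = β u w)
    (hsymm : ∀ u w, β u w = β w u)
    (hEL : ∀ w, deriv (fun s ↦ q (c s) (deriv c s) w) t =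
      1 / 2 * fderiv ℝ (fun y ↦ q y (deriv c t) (deriv c t)) (c t) w) :
    HasDerivAt (fun s ↦ q (c s) (deriv c s) (deriv c s)) 0 t := by
  have h1 : HasDerivAt c (deriv c t) t := (hc.differentiableAt (by simp)).hasDerivAt
  have h2 : HasDerivAt (deriv c) (deriv (deriv c) t) t :=
    ((contDiffAt_deriv hc).differentiableAt (by simp)).hasDerivAt
  set u := deriv c t with hu
  set a := deriv (deriv c) t
  obtain ⟨D, hD⟩ := hq
  have h3 : HasDerivAt (fun s ↦ q (c s) (deriv c s) (deriv c s)) (D (u, a, a)) t :=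
    hD.comp_hasDerivAt (f := fun s ↦ (c s, deriv c s, deriv c s)) t
      (h1.prodMk (h2.prodMk h2))
  have h4 : HasDerivAt (fun s ↦ q (c s) (deriv c s) u) (D (u, a, 0)) t :=
    hD.comp_hasDerivAt (f := fun s ↦ (c s, deriv c s, u)) t
      (h1.prodMk (h2.prodMk (hasDerivAt_const t u)))
  have h5 : fderiv ℝ (fun y ↦ q y u u) (c t) u = D (u, 0, 0) := by
    have h6 : HasFDerivAt (fun y ↦ q y u u)
        (D.comp ((ContinuousLinearMap.id ℝ E).prod ((0 : E →L[ℝ] E).prod 0))) (c t) :=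
      hD.comp (f := fun y ↦ (y, u, u)) (c t) ((hasFDerivAt_id (c t)).prodMk
        ((hasFDerivAt_const u (c t)).prodMk (hasFDerivAt_const u (c t))))
    rw [h6.fderiv]
    simp
  have hline : HasDerivAt (fun s : ℝ ↦ u + s • a) a 0 := by
    simpa using ((hasDerivAt_id (0 : ℝ)).smul_const a).const_add u
  have h7 : D (0, a, 0) = β a u := by
    have hD0 : HasFDerivAt (fun p : E × E × E ↦ q p.1 p.2.1 p.2.2) D
        ((fun s : ℝ ↦ (c t, u + s • a, u)) 0) := by simpa using hD
    have h8 := hD0.comp_hasDerivAt (0 : ℝ)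
      ((hasDerivAt_const 0 (c t)).prodMk (hline.prodMk (hasDerivAt_const 0 u)))
    have h9 : HasDerivAt (fun s : ℝ ↦ q (c t) (u + s • a) u) (β a u) 0 := by
      simp only [hβ, map_add, map_smul, LinearMap.add_apply, LinearMap.smul_apply, smul_eq_mul]
      simpa using ((hasDerivAt_id (0 : ℝ)).mul_const (β a u)).const_add (β u u)
    exact h8.unique h9
  have h8 : D (0, 0, a) = β u a := by
    have hD0 : HasFDerivAt (fun p : E × E × E ↦ q p.1 p.2.1 p.2.2) D
        ((fun s : ℝ ↦ (c t, u, u + s • a)) 0) := by simpa using hD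
    have h8 := hD0.comp_hasDerivAt (0 : ℝ)
      ((hasDerivAt_const 0 (c t)).prodMk ((hasDerivAt_const 0 u).prodMk hline))
    have h9 : HasDerivAt (fun s : ℝ ↦ q (c t) u (u + s • a)) (β u a) 0 := by
      simp only [hβ, map_add, map_smul, smul_eq_mul]
      simpa using ((hasDerivAt_id (0 : ℝ)).mul_const (β u a)).const_add (β u u)
    exact h8.unique h9
  have h9 := hEL u
  rw [h4.deriv, h5] at h9
  have h10 : D (u, a, 0) = D (u, 0, 0) + D (0, a, 0) := by rw [← map_add]; simp
  have h11 : D (u, a, a) = D (u, a, 0) + D (0, 0, a) := by rw [← map_add]; simp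
  convert! h3 using 1
  rw [hsymm u a] at h8
  linarith


namespace BundleGeometry

variable {V : Type*} [NormedAddCommGroup V] [InnerProductSpace ℝ V] {𝓕 : Set (Set V)}
  {EL : Type*} [NormedAddCommGroup EL] [NormedSpace ℝ EL]
  {L : Type*} [TopologicalSpace L] [ChartedSpace EL L]
  {B : Type*} [TopologicalSpace B] {𝒯 : BundleAtlas (leafIsometries 𝓕) EL L B}
  (Γ : BundleGeometry 𝒯)

theorem contDiffAt_form_comp {W : Type*} [NormedAddCommGroup W] [NormedSpace ℝ W]
    {i : L} {y u w : W → EL} {p : W} (hp : y p ∈ (chartAt EL i).target)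
    (hy : ContDiffAt ℝ ∞ y p) (hu : ContDiffAt ℝ ∞ u p) (hw : ContDiffAt ℝ ∞ w p) :
    ContDiffAt ℝ ∞ (fun q ↦ Γ.form i (y q) (u q) (w q)) p := by
  have h1 := (Γ.contDiffOn_form i).contDiffAt ((chartAt EL i).open_target.mem_nhds hp)
  exact ((h1.comp p hy).clm_apply hu).clm_apply hw

theorem contDiffAt_vert_comp {W : Type*} [NormedAddCommGroup W] [NormedSpace ℝ W]
    {i : L} {z u : W → EL × V} {p : W} (hp : (z p).1 ∈ 𝒯.dom i)
    (hz : ContDiffAt ℝ ∞ z p) (hu : ContDiffAt ℝ ∞ u p) :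
    ContDiffAt ℝ ∞ (fun q ↦ Γ.vert i (z q) (u q)) p := by
  have h1 := (Γ.contDiffOn_conn i).contDiffAt ((𝒯.isOpen_dom i).mem_nhds hp)
  have h2 : ContDiffAt ℝ ∞ (fun q ↦ (z q).1) p := contDiffAt_fst.comp p hz
  exact (contDiffAt_snd.comp p hu).add (((h1.comp p h2).clm_apply
    (contDiffAt_fst.comp p hu)).clm_apply (contDiffAt_snd.comp p hz))

theorem contDiffAt_totalForm_comp {W : Type*} [NormedAddCommGroup W] [NormedSpace ℝ W]
    {i : L} {z u w : W → EL × V} {p : W} (hp : (z p).1 ∈ 𝒯.dom i)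
    (hz : ContDiffAt ℝ ∞ z p) (hu : ContDiffAt ℝ ∞ u p) (hw : ContDiffAt ℝ ∞ w p) :
    ContDiffAt ℝ ∞ (fun q ↦ Γ.totalForm i (z q) (u q) (w q)) p :=
  (Γ.contDiffAt_form_comp (y := fun q ↦ (z q).1) (u := fun q ↦ (u q).1) (w := fun q ↦ (w q).1)
    hp.1 (contDiffAt_fst.comp p hz) (contDiffAt_fst.comp p hu) (contDiffAt_fst.comp p hw)).add
    ((Γ.contDiffAt_vert_comp hp hz hu).inner ℝ (Γ.contDiffAt_vert_comp hp hz hw))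

/-- The vertical part of the geodesic equation: the vertical velocity `ω` satisfies
`⟨ω', w⟩ = ⟨ω, conn (x') w⟩`. -/
theorem inner_deriv_vert {i : L} {c : ℝ → EL × V} {t : ℝ} (ht : (c t).1 ∈ 𝒯.dom i)
    (hc : ContDiffAt ℝ ∞ c t)
    (hEL : ∀ w, deriv (fun s ↦ Γ.totalForm i (c s) (deriv c s) w) t =
      1 / 2 * fderiv ℝ (fun y ↦ Γ.totalForm i y (deriv c t) (deriv c t)) (c t) w) (w : V) :
    inner ℝ (deriv (fun s ↦ Γ.vert i (c s) (deriv c s)) t) w =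
      inner ℝ (Γ.vert i (c t) (deriv c t)) (Γ.conn i (c t).1 (deriv c t).1 w) := by
  have hω := ((Γ.contDiffAt_vert_comp ht hc (contDiffAt_deriv hc)).differentiableAt
    (by simp)).hasDerivAt
  have hEL' := hEL (0, w)
  have h3 : (fun s ↦ Γ.totalForm i (c s) (deriv c s) (0, w)) =
      fun s ↦ inner ℝ (Γ.vert i (c s) (deriv c s)) w := by
    ext s
    simp [totalForm_apply, vert_apply]
  rw [h3, (hω.inner ℝ (hasDerivAt_const t w)).deriv, inner_zero_right, zero_add] at hEL'
  rw [hEL']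
  -- the derivative of the metric along the vertical line through `c t`
  have hline : HasDerivAt (fun s : ℝ ↦ c t + s • ((0, w) : EL × V)) (0, w) 0 := by
    simpa using ((hasDerivAt_id (0 : ℝ)).smul_const ((0, w) : EL × V)).const_add (c t)
  have hd := (Γ.contDiffAt_totalForm_comp (z := fun y ↦ y) (p := c t) ht contDiffAt_id
    (contDiffAt_const (c := deriv c t)) (contDiffAt_const (c := deriv c t))).differentiableAt
      (by simp)
  have hd' : HasFDerivAt (fun y ↦ Γ.totalForm i y (deriv c t) (deriv c t))
      (fderiv ℝ (fun y ↦ Γ.totalForm i y (deriv c t) (deriv c t)) (c t))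
      (c t + (0 : ℝ) • ((0, w) : EL × V)) := by
    rw [zero_smul, add_zero]
    exact hd.hasFDerivAt
  have h4 := hd'.comp_hasDerivAt (0 : ℝ) hline
  have h5 : ∀ s : ℝ, Γ.vert i (c t + s • ((0, w) : EL × V)) (deriv c t) =
      Γ.vert i (c t) (deriv c t) + s • Γ.conn i (c t).1 (deriv c t).1 w := by
    intro s
    simp [vert_apply, add_assoc]
  have h6 : HasDerivAt (fun s : ℝ ↦ Γ.vert i (c t) (deriv c t) +
      s • Γ.conn i (c t).1 (deriv c t).1 w) (Γ.conn i (c t).1 (deriv c t).1 w) 0 := by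
    simpa using ((hasDerivAt_id (0 : ℝ)).smul_const
      (Γ.conn i (c t).1 (deriv c t).1 w)).const_add (Γ.vert i (c t) (deriv c t))
  have h7 := (h6.inner ℝ h6).const_add (Γ.form i (c t).1 (deriv c t).1 (deriv c t).1)
  have h8 := h4.unique (h7.congr_of_eventuallyEq (Filter.Eventually.of_forall fun s ↦ by
    simp only [Function.comp_apply]
    rw [totalForm_apply, h5]
    simp))
  rw [h8]
  simp only [zero_smul, add_zero]
  rw [real_inner_comm (Γ.vert i (c t) (deriv c t))]
  ring

/-- The horizontal part of the velocity of a geodesic has constant length: the vertical part has, as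
the connection is skew-symmetric, and so has the whole velocity. -/
theorem hasDerivAt_form {i : L} {c : ℝ → EL × V} {t : ℝ} (ht : (c t).1 ∈ 𝒯.dom i)
    (hc : ContDiffAt ℝ ∞ c t)
    (hEL : ∀ w, deriv (fun s ↦ Γ.totalForm i (c s) (deriv c s) w) t =
      1 / 2 * fderiv ℝ (fun y ↦ Γ.totalForm i y (deriv c t) (deriv c t)) (c t) w) :
    HasDerivAt (fun s ↦ Γ.form i (c s).1 (deriv c s).1 (deriv c s).1) 0 t := by
  have hω := ((Γ.contDiffAt_vert_comp ht hc (contDiffAt_deriv hc)).differentiableAt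
    (by simp)).hasDerivAt
  have h3 : DifferentiableAt ℝ (fun p : (EL × V) × (EL × V) × (EL × V) ↦
      Γ.totalForm i p.1 p.2.1 p.2.2) (c t, deriv c t, deriv c t) := by
    exact (Γ.contDiffAt_totalForm_comp (z := fun p : (EL × V) × (EL × V) × (EL × V) ↦ p.1)
      (p := (c t, deriv c t, deriv c t)) ht contDiffAt_fst (contDiffAt_fst.comp _ contDiffAt_snd)
      (contDiffAt_snd.comp _ contDiffAt_snd)).differentiableAt (by simp)
  have h4 := hasDerivAt_energy (q := fun z u w ↦ Γ.totalForm i z u w) h3 hc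
    (β := LinearMap.mk₂ ℝ (fun u w ↦ Γ.totalForm i (c t) u w) (by simp) (by simp) (by simp)
      (by simp)) (fun u w ↦ rfl)
    (fun u w ↦ Γ.totalForm_symm ht u w) hEL
  have h5 := h4.sub (hω.inner ℝ hω)
  have h6 : inner ℝ (deriv (fun s ↦ Γ.vert i (c s) (deriv c s)) t)
      (Γ.vert i (c t) (deriv c t)) = 0 := by
    rw [Γ.inner_deriv_vert ht hc hEL, real_inner_comm, Γ.inner_conn i _ ht]
  rw [real_inner_comm, h6] at h5
  simp only [add_zero, sub_zero] at h5
  refine h5.congr_of_eventuallyEq (Filter.Eventually.of_forall fun s ↦ ?_)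
  simp [totalForm_apply]

end BundleGeometry

/-! ### Geodesics orthogonal to the leaves -/

theorem hasDerivAt_fst {E F : Type*} [NormedAddCommGroup E] [NormedSpace ℝ E]
    [NormedAddCommGroup F] [NormedSpace ℝ F] {c : ℝ → E × F} {c' : E × F} {t : ℝ}
    (hc : HasDerivAt c c' t) : HasDerivAt (fun s ↦ (c s).1) c'.1 t :=
  (hasFDerivAt_fst (𝕜 := ℝ) (p := c t)).comp_hasDerivAt t hc

theorem hasDerivAt_snd {E F : Type*} [NormedAddCommGroup E] [NormedSpace ℝ E]
    [NormedAddCommGroup F] [NormedSpace ℝ F] {c : ℝ → E × F} {c' : E × F} {t : ℝ}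
    (hc : HasDerivAt c c' t) : HasDerivAt (fun s ↦ (c s).2) c'.2 t :=
  (hasFDerivAt_snd (𝕜 := ℝ) (p := c t)).comp_hasDerivAt t hc

namespace BundleGeometry

variable {V : Type*} [NormedAddCommGroup V] [InnerProductSpace ℝ V] {𝓕 : Set (Set V)}
  {EL : Type*} [NormedAddCommGroup EL] [NormedSpace ℝ EL]
  {L : Type*} [TopologicalSpace L] [ChartedSpace EL L]
  {B : Type*} [TopologicalSpace B] {𝒯 : BundleAtlas (leafIsometries 𝓕) EL L B}
  (Γ : BundleGeometry 𝒯) [ChartedSpace (EL × V) B] [IsManifold 𝓘(ℝ, EL × V) ∞ B]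
  {g : Bundle.RiemannianMetric (fun b : B ↦ TangentSpace 𝓘(ℝ, EL × V) b)}
  {γ : ℝ → B} {J : Set ℝ}

omit [ChartedSpace (EL × V) B] [IsManifold 𝓘(ℝ, EL × V) ∞ B] in
theorem totalForm_eq (i : L) (z u w : EL × V) : Γ.totalForm i z u w =
    Γ.form i z.1 u.1 w.1 +
      inner ℝ (u.2 + Γ.conn i z.1 u.1 z.2) (w.2 + Γ.conn i z.1 w.1 z.2) := rfl

/-- The geodesic equation in the coordinates of any of the local trivializations. -/
theorem eulerLagrange_of_isGeodesicOn (hB : ∀ b : B, chartAt (EL × V) b = 𝒯.chart (𝒯.proj b))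
    (hg : ∀ (b : B) (z : EL × V), z.1 ∈ 𝒯.dom (𝒯.proj b) → ∀ u w,
      chartMetric g b z u w = Γ.totalForm (𝒯.proj b) z u w)
    (hJ : IsOpen J) (hγ : IsGeodesicOn g γ J) {t : ℝ} (ht : t ∈ J) {i : L}
    (hi : 𝒯.proj (γ t) ∈ 𝒯.base i) :
    ContDiffAt ℝ ∞ (fun s ↦ 𝒯.chart i (γ s)) t ∧
    ∀ w, deriv (fun s ↦ Γ.totalForm i (𝒯.chart i (γ s))
        (deriv (fun s ↦ 𝒯.chart i (γ s)) s) w) t =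
      1 / 2 * fderiv ℝ (fun y ↦ Γ.totalForm i y (deriv (fun s ↦ 𝒯.chart i (γ s)) t)
        (deriv (fun s ↦ 𝒯.chart i (γ s)) t)) (𝒯.chart i (γ t)) w := by
  obtain ⟨b, rfl⟩ : ∃ b : B, 𝒯.proj b = i :=
    ⟨_, 𝒯.proj_symm_chartAt (𝒯.mem_base i) 0⟩
  have hγt : ContMDiffAt 𝓘(ℝ, ℝ) 𝓘(ℝ, EL × V) ∞ γ t := hγ.1.contMDiffAt (hJ.mem_nhds ht)
  have hs : γ t ∈ (chartAt (EL × V) b).source := by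
    rw [hB]
    exact 𝒯.mem_source.2 hi
  have hev : ∀ᶠ s in 𝓝 t, 𝒯.proj (γ s) ∈ 𝒯.base (𝒯.proj b) :=
    (𝒯.continuous_proj.continuousAt.comp hγt.continuousAt).eventually_mem
      ((𝒯.isOpen_base _).mem_nhds hi)
  have h1 := (contMDiffAt_extChartAt' (I := 𝓘(ℝ, EL × V)) (n := ∞) hs).comp t hγt
  rw [BundleAtlas.extChartAt_coe hB] at h1
  refine ⟨h1.contDiffAt, fun w ↦ ?_⟩
  have h2 := hγ.2 b t ht hs w
  simp only [BundleAtlas.extChartAt_coe hB] at h2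
  have h3 : (fun s ↦ chartMetric g b (𝒯.chart (𝒯.proj b) (γ s))
      (deriv (fun s ↦ 𝒯.chart (𝒯.proj b) (γ s)) s) w) =ᶠ[𝓝 t]
      fun s ↦ Γ.totalForm (𝒯.proj b) (𝒯.chart (𝒯.proj b) (γ s))
        (deriv (fun s ↦ 𝒯.chart (𝒯.proj b) (γ s)) s) w := by
    filter_upwards [hev] with s hs
    exact hg b _ (𝒯.chart_fst_mem_dom hs) _ _
  have h4 : (fun y ↦ chartMetric g b y (deriv (fun s ↦ 𝒯.chart (𝒯.proj b) (γ s)) t)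
      (deriv (fun s ↦ 𝒯.chart (𝒯.proj b) (γ s)) t)) =ᶠ[𝓝 (𝒯.chart (𝒯.proj b) (γ t))]
      fun y ↦ Γ.totalForm (𝒯.proj b) y (deriv (fun s ↦ 𝒯.chart (𝒯.proj b) (γ s)) t)
      (deriv (fun s ↦ 𝒯.chart (𝒯.proj b) (γ s)) t) := by
    filter_upwards [continuous_fst.continuousAt.preimage_mem_nhds
      ((𝒯.isOpen_dom _).mem_nhds (𝒯.chart_fst_mem_dom hi))] with y hy
    exact hg b _ hy _ _
  rw [h3.deriv_eq, h4.fderiv_eq] at h2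
  exact h2

/-- A curve is orthogonal to the leaf of the bundle through one of its points if and only if its
velocity is vertical there, and orthogonal to the leaf in the fibre. -/
theorem isOrthogonalAt_iff (hB : ∀ b : B, chartAt (EL × V) b = 𝒯.chart (𝒯.proj b))
    (hg : ∀ (b : B) (u w : EL × V), g.inner b u w =
      Γ.totalForm (𝒯.proj b) (𝒯.chart (𝒯.proj b) b) u w)
    (h𝓕 : Setoid.IsPartition 𝓕) {t : ℝ}
    (hγ : MDifferentiableAt 𝓘(ℝ, ℝ) 𝓘(ℝ, EL × V) γ t) :
    IsOrthogonalAt g (𝒯.leaf '' 𝓕) γ t ↔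
      (deriv (fun s ↦ 𝒯.chart (𝒯.proj (γ t)) (γ s)) t).1 = 0 ∧
      ∀ S ∈ 𝓕, (𝒯.chart (𝒯.proj (γ t)) (γ t)).2 ∈ S →
        ∀ w ∈ leafTangent S (𝒯.chart (𝒯.proj (γ t)) (γ t)).2,
        inner ℝ (deriv (fun s ↦ 𝒯.chart (𝒯.proj (γ t)) (γ s)) t).2 w = 0 := by
  set i := 𝒯.proj (γ t) with hi
  set c := fun s ↦ 𝒯.chart i (γ s) with hc
  have hd : (c t).1 ∈ 𝒯.dom i := 𝒯.chart_fst_mem_dom (𝒯.mem_base _)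
  have hv : (velocity γ t : EL × V) = deriv c t := by
    refine (mfderiv_curve_eq (E := EL × V) hγ).trans ?_
    rw [BundleAtlas.extChartAt_coe hB]
  have hgv : ∀ w : EL × V, g.inner (γ t) (velocity γ t) w =
      Γ.totalForm i (c t) (deriv c t) w := by
    intro w
    refine (hg (γ t) (velocity γ t) w).trans ?_
    rw [hv]
  have hleaf : ∀ {S : Set V}, γ t ∈ 𝒯.leaf S ↔ (c t).2 ∈ S := Iff.rfl
  constructor
  · intro h
    obtain ⟨S, ⟨hS, hcS⟩, hu⟩ := h𝓕.2 (c t).2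
    have h1 : ∀ w : EL × V, w.2 ∈ leafTangent S (c t).2 →
        Γ.totalForm i (c t) (deriv c t) w = 0 := by
      intro w hw
      rw [← hgv]
      exact h _ ⟨S, hS, rfl⟩ (hleaf.2 hcS) w
        ((BundleAtlas.mem_tangentSpaceOf_leaf_iff hB hS (hleaf.2 hcS) w).2 hw)
    have h2 : (deriv c t).1 = 0 := by
      -- test against the horizontal lift of the velocity of the projection
      have h3 := h1 ((deriv c t).1, -Γ.conn i (c t).1 (deriv c t).1 (c t).2)
        (Submodule.neg_mem _ (Γ.conn_mem i _ hd S hS _ hcS _))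
      rw [totalForm_eq] at h3
      simp only [neg_add_cancel, inner_zero_right, add_zero] at h3
      by_contra h4
      exact (Γ.form_pos i _ hd.1 _ h4).ne' h3
    refine ⟨h2, fun S' hS' hcS' w hw ↦ ?_⟩
    obtain rfl : S = S' := (hu S' ⟨hS', hcS'⟩).symm
    have h3 := h1 (0, w) hw
    rw [totalForm_eq, h2] at h3
    simpa using h3
  · rintro ⟨h1, h2⟩ _ ⟨S, hS, rfl⟩ hb (w : EL × V) hw
    refine (hgv w).trans ?_
    have hw' := (BundleAtlas.mem_tangentSpaceOf_leaf_iff hB hS hb w).1 hw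
    rw [totalForm_eq, h1]
    simp only [map_zero, zero_apply, zero_add, add_zero]
    exact h2 S hS hb _ (Submodule.add_mem _ hw' (Γ.conn_mem i _ hd S hS _ hb _))


omit [ChartedSpace (EL × V) B] [IsManifold 𝓘(ℝ, EL × V) ∞ B] in
/-- The speed of the projection of a curve to the base does not depend on the trivialization. -/
theorem form_deriv_chart [IsManifold 𝓘(ℝ, EL) ∞ L] {t : ℝ} {i j : L}
    (hi : 𝒯.proj (γ t) ∈ 𝒯.base i)
    (hj : 𝒯.proj (γ t) ∈ 𝒯.base j) (hγ : ContinuousAt γ t)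
    (hc : DifferentiableAt ℝ (fun s ↦ 𝒯.chart i (γ s)) t)
    (hc' : DifferentiableAt ℝ (fun s ↦ 𝒯.chart j (γ s)) t) :
    Γ.form j (𝒯.chart j (γ t)).1 (deriv (fun s ↦ 𝒯.chart j (γ s)) t).1
      (deriv (fun s ↦ 𝒯.chart j (γ s)) t).1 =
    Γ.form i (𝒯.chart i (γ t)).1 (deriv (fun s ↦ 𝒯.chart i (γ s)) t).1
      (deriv (fun s ↦ 𝒯.chart i (γ s)) t).1 := by
  have hsymm : ∀ {b : B}, 𝒯.proj b ∈ 𝒯.base i →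
      (chartAt EL i).symm (𝒯.chart i b).1 = 𝒯.proj b := by
    intro b hb
    rw [𝒯.fst_chart i b hb, (chartAt EL i).left_inv (𝒯.base_subset i hb)]
  have hchange : ∀ {b : B}, 𝒯.proj b ∈ 𝒯.base i → 𝒯.proj b ∈ 𝒯.base j →
      (𝒯.chart j b).1 = BundleAtlas.baseChange i j (𝒯.chart i b).1 := by
    intro b hb hb'
    rw [𝒯.fst_chart j b hb', BundleAtlas.baseChange, Function.comp_apply, hsymm hb]
  have hd := 𝒯.chart_fst_mem_dom hi
  have hj' : (chartAt EL i).symm (𝒯.chart i (γ t)).1 ∈ (chartAt EL j).source := by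
    rw [hsymm hi]
    exact 𝒯.base_subset j hj
  have hev : (fun s ↦ (𝒯.chart j (γ s)).1) =ᶠ[𝓝 t]
      fun s ↦ BundleAtlas.baseChange i j (𝒯.chart i (γ s)).1 := by
    have h1 := (𝒯.continuous_proj.continuousAt.comp hγ).eventually_mem
      ((𝒯.isOpen_base i).mem_nhds hi)
    have h2 := (𝒯.continuous_proj.continuousAt.comp hγ).eventually_mem
      ((𝒯.isOpen_base j).mem_nhds hj)
    filter_upwards [h1, h2] with s h1 h2
    exact hchange h1 h2
  have h3 := (BundleAtlas.contDiffAt_baseChange hd.1 hj').differentiableAt (by simp)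
  have h4 := (h3.hasFDerivAt.comp_hasDerivAt t
    (hasDerivAt_fst hc.hasDerivAt)).congr_of_eventuallyEq hev
  rw [(hasDerivAt_fst hc'.hasDerivAt).unique h4, hchange hi hj, Γ.form_compat i j _ hd.1 hj']

variable [IsManifold 𝓘(ℝ, EL) ∞ L]

/-- A geodesic that is vertical at one time stays in a fibre. -/
theorem proj_eq_of_isGeodesicOn [T2Space L]
    (hB : ∀ b : B, chartAt (EL × V) b = 𝒯.chart (𝒯.proj b))
    (hg : ∀ (b : B) (z : EL × V), z.1 ∈ 𝒯.dom (𝒯.proj b) → ∀ u w,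
      chartMetric g b z u w = Γ.totalForm (𝒯.proj b) z u w)
    (hJ : IsOpen J) (hJc : J.OrdConnected) (hγ : IsGeodesicOn g γ J) {t₀ : ℝ} (ht₀ : t₀ ∈ J)
    (h0 : (deriv (fun s ↦ 𝒯.chart (𝒯.proj (γ t₀)) (γ s)) t₀).1 = 0) {t : ℝ} (ht : t ∈ J) :
    𝒯.proj (γ t) = 𝒯.proj (γ t₀) := by
  have hconn : IsPreconnected J := hJc.isPreconnected
  have hcont : ∀ s ∈ J, ContinuousAt γ s := fun s hs ↦
    (hγ.1.contMDiffAt (hJ.mem_nhds hs)).continuousAt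
  have hdiff : ∀ s ∈ J, ∀ {i : L}, 𝒯.proj (γ s) ∈ 𝒯.base i →
      DifferentiableAt ℝ (fun s ↦ 𝒯.chart i (γ s)) s := fun s hs i hi ↦
    (Γ.eulerLagrange_of_isGeodesicOn hB hg hJ hγ hs hi).1.differentiableAt (by simp)
  -- the square of the speed of the projection
  let f : ℝ → ℝ := fun s ↦ Γ.form (𝒯.proj (γ s)) (𝒯.chart (𝒯.proj (γ s)) (γ s)).1
    (deriv (fun r ↦ 𝒯.chart (𝒯.proj (γ s)) (γ r)) s).1
    (deriv (fun r ↦ 𝒯.chart (𝒯.proj (γ s)) (γ r)) s).1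
  have hev : ∀ s ∈ J, ∀ᶠ r in 𝓝 s, r ∈ J ∧ 𝒯.proj (γ r) ∈ 𝒯.base (𝒯.proj (γ s)) := fun s hs ↦
    (hJ.eventually_mem hs).and ((𝒯.continuous_proj.continuousAt.comp (hcont s hs)).eventually_mem
      ((𝒯.isOpen_base _).mem_nhds (𝒯.mem_base _)))
  have hf : ∀ s ∈ J, HasDerivAt f 0 s := by
    intro s hs
    have h1 := Γ.eulerLagrange_of_isGeodesicOn hB hg hJ hγ hs (𝒯.mem_base _)
    refine (Γ.hasDerivAt_form (𝒯.chart_fst_mem_dom (𝒯.mem_base _)) h1.1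
      h1.2).congr_of_eventuallyEq ?_
    filter_upwards [hev s hs] with r hr
    exact Γ.form_deriv_chart hr.2 (𝒯.mem_base _) (hcont r hr.1) (hdiff r hr.1 hr.2)
      (hdiff r hr.1 (𝒯.mem_base _))
  have hf0 : ∀ s ∈ J, f s = 0 := by
    intro s hs
    rw [hJ.is_const_of_deriv_eq_zero hconn
      (fun r hr ↦ (hf r hr).differentiableAt.differentiableWithinAt)
      (fun r hr ↦ (hf r hr).deriv) hs ht₀]
    simp only [f, h0, map_zero]
  -- so the projection is locally constant
  have hloc : ∀ s ∈ J, ∀ᶠ r in 𝓝 s, 𝒯.proj (γ r) = 𝒯.proj (γ s) := by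
    intro s hs
    obtain ⟨ε, hε, hball⟩ := Metric.eventually_nhds_iff_ball.1 (hev s hs)
    have hd : ∀ r ∈ Metric.ball s ε,
        HasDerivAt (fun r ↦ (𝒯.chart (𝒯.proj (γ s)) (γ r)).1) 0 r := by
      intro r hr
      obtain ⟨hrJ, hri⟩ := hball r hr
      have h1 := hasDerivAt_fst (hdiff r hrJ hri).hasDerivAt
      have h2 := (Γ.form_deriv_chart hri (𝒯.mem_base _) (hcont r hrJ) (hdiff r hrJ hri)
        (hdiff r hrJ (𝒯.mem_base _))).symm.trans (hf0 r hrJ)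
      have h3 : (deriv (fun r ↦ 𝒯.chart (𝒯.proj (γ s)) (γ r)) r).1 = 0 := by
        by_contra h3
        exact (Γ.form_pos _ _ (𝒯.chart_fst_mem_dom hri).1 _ h3).ne' h2
      rwa [h3] at h1
    filter_upwards [Metric.ball_mem_nhds s hε] with r hr
    have h1 := Metric.isOpen_ball.is_const_of_deriv_eq_zero (convex_ball s ε).isPreconnected
      (fun r hr ↦ (hd r hr).differentiableAt.differentiableWithinAt)
      (fun r hr ↦ (hd r hr).deriv) hr (Metric.mem_ball_self hε)
    obtain ⟨-, hri⟩ := hball r hr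
    rw [𝒯.fst_chart _ _ hri, 𝒯.fst_chart _ _ (𝒯.mem_base _)] at h1
    exact (chartAt EL (𝒯.proj (γ s))).injOn (𝒯.base_subset _ hri)
      (𝒯.base_subset _ (𝒯.mem_base _)) h1
  exact hconn.induction₂ (fun s r ↦ 𝒯.proj (γ r) = 𝒯.proj (γ s))
    (fun s hs ↦ (hloc s hs).filter_mono nhdsWithin_le_nhds)
    (fun _ _ _ _ _ _ h1 h2 ↦ h2.trans h1) (fun _ _ _ _ h ↦ h.symm) ht₀ ht

/-- A geodesic of the bundle that is orthogonal to a leaf is a straight line in a fibre, so it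
remains orthogonal to the leaves. -/
theorem isOrthogonalAt_of_isGeodesicOn [FiniteDimensional ℝ V] [T2Space L]
    (h𝓕 : IsDisconnectedInfinitesimalFoliation 𝓕)
    (hB : ∀ b : B, chartAt (EL × V) b = 𝒯.chart (𝒯.proj b))
    (hg : ∀ (b : B) (u w : EL × V), g.inner b u w =
      Γ.totalForm (𝒯.proj b) (𝒯.chart (𝒯.proj b) b) u w)
    (hg' : ∀ (b : B) (z : EL × V), z.1 ∈ 𝒯.dom (𝒯.proj b) → ∀ u w,
      chartMetric g b z u w = Γ.totalForm (𝒯.proj b) z u w)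
    (hJ : IsOpen J) (hJc : J.OrdConnected) (hγ : IsGeodesicOn g γ J) {t₀ : ℝ} (ht₀ : t₀ ∈ J)
    (h0 : IsOrthogonalAt g (𝒯.leaf '' 𝓕) γ t₀) {t : ℝ} (ht : t ∈ J) :
    IsOrthogonalAt g (𝒯.leaf '' 𝓕) γ t := by
  have hconn : IsPreconnected J := hJc.isPreconnected
  have hmd : ∀ s ∈ J, MDifferentiableAt 𝓘(ℝ, ℝ) 𝓘(ℝ, EL × V) γ s := fun s hs ↦
    (hγ.1.contMDiffAt (hJ.mem_nhds hs)).mdifferentiableAt (by simp)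
  obtain ⟨h1, h2⟩ := (Γ.isOrthogonalAt_iff hB hg h𝓕.isPartition (hmd t₀ ht₀)).1 h0
  have hproj : ∀ s ∈ J, 𝒯.proj (γ s) = 𝒯.proj (γ t₀) := fun s hs ↦
    Γ.proj_eq_of_isGeodesicOn hB hg' hJ hJc hγ ht₀ h1 hs
  rw [Γ.isOrthogonalAt_iff hB hg h𝓕.isPartition (hmd t ht), hproj t ht]
  set i := 𝒯.proj (γ t₀) with hi
  set c := fun s ↦ 𝒯.chart i (γ s) with hc
  have hbase : ∀ s ∈ J, 𝒯.proj (γ s) ∈ 𝒯.base i := fun s hs ↦ by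
    rw [hproj s hs]
    exact 𝒯.mem_base i
  have hEL := fun s hs ↦ Γ.eulerLagrange_of_isGeodesicOn hB hg' hJ hγ hs (hbase s hs)
  have hcd : ∀ s ∈ J, HasDerivAt c (deriv c s) s := fun s hs ↦
    ((hEL s hs).1.differentiableAt (by simp)).hasDerivAt
  have hfst : ∀ s ∈ J, (deriv c s).1 = 0 := by
    intro s hs
    refine (hasDerivAt_fst (hcd s hs)).unique
      ((hasDerivAt_const s (chartAt EL i i)).congr_of_eventuallyEq ?_)
    filter_upwards [hJ.mem_nhds hs] with r hr
    rw [𝒯.fst_chart i _ (hbase r hr), hproj r hr]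
  have hsnd : ∀ s ∈ J, HasDerivAt (fun r ↦ (deriv c r).2) 0 s := by
    intro s hs
    have h3 := Γ.inner_deriv_vert (𝒯.chart_fst_mem_dom (hbase s hs)) (hEL s hs).1 (hEL s hs).2
    have h4 : (fun r ↦ Γ.vert i (c r) (deriv c r)) =ᶠ[𝓝 s] fun r ↦ (deriv c r).2 := by
      filter_upwards [hJ.mem_nhds hs] with r hr
      rw [vert_apply, hfst r hr]
      simp
    have h5 : deriv (fun r ↦ (deriv c r).2) s = 0 := by
      rw [← h4.deriv_eq]
      refine ext_inner_right ℝ fun w ↦ ?_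
      rw [h3 w]
      have := hfst s hs
      simp only [hc] at this
      rw [this]
      simp
    rw [← h5]
    exact (hasDerivAt_snd ((contDiffAt_deriv (hEL s hs).1).differentiableAt
      (by simp)).hasDerivAt).differentiableAt.hasDerivAt
  have hconst : ∀ s ∈ J, (deriv c s).2 = (deriv c t₀).2 := fun s hs ↦
    hJ.is_const_of_deriv_eq_zero hconn
      (fun r hr ↦ (hsnd r hr).differentiableAt.differentiableWithinAt)
      (fun r hr ↦ (hsnd r hr).deriv) hs ht₀
  have hline : (c t₀).2 + (t - t₀) • (deriv c t₀).2 = (c t).2 := by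
    have h3 : ∀ s ∈ J, HasDerivAt (fun r ↦ (c r).2 - (r - t₀) • (deriv c t₀).2) 0 s := by
      intro s hs
      have h4 := (hasDerivAt_snd (hcd s hs)).sub
        (((hasDerivAt_id s).sub_const t₀).smul_const (deriv c t₀).2)
      rw [hconst s hs, one_smul, sub_self] at h4
      exact h4
    have h4 := hJ.is_const_of_deriv_eq_zero hconn
      (fun r hr ↦ (h3 r hr).differentiableAt.differentiableWithinAt)
      (fun r hr ↦ (h3 r hr).deriv) ht ht₀
    simp only [sub_self, zero_smul, sub_zero] at h4
    rw [← h4]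
    abel
  refine ⟨hfst t ht, fun S' hS' hcS' w hw ↦ ?_⟩
  obtain ⟨S, ⟨hS, hcS⟩, -⟩ := h𝓕.isPartition.2 (c t₀).2
  rw [hconst t ht]
  exact h𝓕.orthogonal_line hS hS' hcS hline hcS' (h2 S hS hcS) w hw

end BundleGeometry

/-! ### The zero section and the projection -/

/-- Smoothness and the differential of a map, read off from its expression `f'` in the preferred
charts at `x` and at `f x`. -/
theorem contMDiffAt_and_hasMFDerivAt_of_charts {E E' : Type*} [NormedAddCommGroup E]
    [NormedSpace ℝ E] [NormedAddCommGroup E'] [NormedSpace ℝ E'] {M N : Type*} [TopologicalSpace M]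
    [ChartedSpace E M] [TopologicalSpace N] [ChartedSpace E' N] {f : M → N} {f' : E → E'}
    {D : E →L[ℝ] E'}
    {x : M}
    (h : ∀ᶠ y in 𝓝 x, f y ∈ (chartAt E' (f x)).source ∧
      extChartAt 𝓘(ℝ, E') (f x) (f y) = f' (extChartAt 𝓘(ℝ, E) x y))
    (hf' : ContDiffAt ℝ ∞ f' (extChartAt 𝓘(ℝ, E) x x))
    (hD : HasFDerivAt f' D (extChartAt 𝓘(ℝ, E) x x)) :
    ContMDiffAt 𝓘(ℝ, E) 𝓘(ℝ, E') ∞ f x ∧ HasMFDerivAt 𝓘(ℝ, E) 𝓘(ℝ, E') f x D := by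
  have hx := h.self_of_nhds.2
  have h1 : f =ᶠ[𝓝 x] fun y ↦ (extChartAt 𝓘(ℝ, E') (f x)).symm (f' (extChartAt 𝓘(ℝ, E) x y)) := by
    filter_upwards [h] with y hy
    rw [← hy.2, (extChartAt 𝓘(ℝ, E') (f x)).left_inv (by simpa using hy.1)]
  have hc : ContinuousAt f x := by
    refine ContinuousAt.congr ?_ h1.symm
    have h2 : ContinuousAt (fun y ↦ f' (extChartAt 𝓘(ℝ, E) x y)) x :=
      hf'.continuousAt.comp (continuousAt_extChartAt x)
    refine ContinuousAt.comp (f := fun y ↦ f' (extChartAt 𝓘(ℝ, E) x y)) ?_ h2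
    rw [← hx]
    exact continuousAt_extChartAt_symm (f x)
  have h2 : writtenInExtChartAt 𝓘(ℝ, E) 𝓘(ℝ, E') x f =ᶠ[𝓝 (extChartAt 𝓘(ℝ, E) x x)] f' := by
    have h3 : Filter.Tendsto (extChartAt 𝓘(ℝ, E) x).symm (𝓝 (extChartAt 𝓘(ℝ, E) x x)) (𝓝 x) := by
      have := continuousAt_extChartAt_symm (I := 𝓘(ℝ, E)) x
      rwa [ContinuousAt, extChartAt_to_inv] at this
    have h4 : (extChartAt 𝓘(ℝ, E) x).target ∈ 𝓝 (extChartAt 𝓘(ℝ, E) x x) :=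
      extChartAt_target_mem_nhds x
    filter_upwards [h3.eventually h, h4] with z hz hzt
    rw [writtenInExtChartAt, Function.comp_apply, Function.comp_apply, hz.2,
      (extChartAt 𝓘(ℝ, E) x).right_inv hzt]
  have hf'' := hf'.congr_of_eventuallyEq h2
  constructor
  · rw [contMDiffAt_iff]
    refine ⟨hc, ?_⟩
    simpa only [writtenInExtChartAt, modelWithCornersSelf_coe, range_id, contDiffWithinAt_univ]
      using hf''
  · exact ⟨hc, (hD.congr_of_eventuallyEq h2).hasFDerivWithinAt⟩

namespace BundleAtlas

variable {V : Type*} [NormedAddCommGroup V] [InnerProductSpace ℝ V] {G : Subgroup (V ≃ₗᵢ[ℝ] V)}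
  {EL : Type*} [NormedAddCommGroup EL] [NormedSpace ℝ EL]
  {L : Type*} [TopologicalSpace L] [ChartedSpace EL L]
  {B : Type*} [TopologicalSpace B] (𝒯 : BundleAtlas G EL L B)

/-- The zero section. -/
def zeroSection (x : L) : B := (𝒯.chart x).symm (chartAt EL x x, 0)

theorem proj_zeroSection (x : L) : 𝒯.proj (𝒯.zeroSection x) = x :=
  𝒯.proj_symm_chartAt (𝒯.mem_base x) 0

theorem chart_zeroSection {i x : L} (hx : x ∈ 𝒯.base i) :
    𝒯.chart i (𝒯.zeroSection x) = (chartAt EL i x, 0) := by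
  have h1 := 𝒯.proj_zeroSection x
  refine (𝒯.chart_eq (by rwa [h1])).trans (Prod.ext (by rw [h1]) ?_)
  have h2 : 𝒯.chart x (𝒯.zeroSection x) = (chartAt EL x x, 0) :=
    𝒯.chart_symm_apply (z := (chartAt EL x x, 0)) (𝒯.chartAt_mem_dom (𝒯.mem_base x))
  simp only
  rw [𝒯.snd_chart x i _ (by rw [h1]; exact 𝒯.mem_base x) (by rwa [h1]), h2, map_zero]

theorem eq_zeroSection {i : L} {b : B} (hb : 𝒯.proj b ∈ 𝒯.base i) (h0 : (𝒯.chart i b).2 = 0) :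
    b = 𝒯.zeroSection (𝒯.proj b) := by
  refine (𝒯.chart i).injOn (𝒯.mem_source.2 hb)
    (𝒯.mem_source.2 (by rwa [𝒯.proj_zeroSection])) ?_
  rw [𝒯.chart_zeroSection hb, 𝒯.chart_eq hb, h0]

variable [ChartedSpace (EL × V) B] {𝒯}

theorem contMDiffAt_zeroSection (hB : ∀ b : B, chartAt (EL × V) b = 𝒯.chart (𝒯.proj b)) (x : L) :
    ContMDiffAt 𝓘(ℝ, EL) 𝓘(ℝ, EL × V) ∞ 𝒯.zeroSection x ∧
      HasMFDerivAt 𝓘(ℝ, EL) 𝓘(ℝ, EL × V) 𝒯.zeroSection x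
        (ContinuousLinearMap.inl ℝ EL V : EL →L[ℝ] EL × V) := by
  have h := contMDiffAt_and_hasMFDerivAt_of_charts (E := EL) (E' := EL × V) (f := 𝒯.zeroSection)
    (x := x) (f' := ContinuousLinearMap.inl ℝ EL V) ?_
    (ContinuousLinearMap.inl ℝ EL V).contDiff.contDiffAt
    (ContinuousLinearMap.inl ℝ EL V).hasFDerivAt
  · exact h
  · filter_upwards [(𝒯.isOpen_base x).mem_nhds (𝒯.mem_base x)] with y hy
    rw [extChartAt_coe hB, hB, 𝒯.mem_source, 𝒯.proj_zeroSection, 𝒯.proj_zeroSection,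
      𝒯.chart_zeroSection hy]
    exact ⟨hy, by simp [mfld_simps]⟩

theorem contMDiffAt_proj (hB : ∀ b : B, chartAt (EL × V) b = 𝒯.chart (𝒯.proj b)) (b : B) :
    ContMDiffAt 𝓘(ℝ, EL × V) 𝓘(ℝ, EL) ∞ 𝒯.proj b ∧
      HasMFDerivAt 𝓘(ℝ, EL × V) 𝓘(ℝ, EL) 𝒯.proj b
        (ContinuousLinearMap.fst ℝ EL V : EL × V →L[ℝ] EL) := by
  have h := contMDiffAt_and_hasMFDerivAt_of_charts (E := EL × V) (E' := EL) (f := 𝒯.proj)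
    (x := b) (f' := ContinuousLinearMap.fst ℝ EL V) ?_
    (ContinuousLinearMap.fst ℝ EL V).contDiff.contDiffAt
    (ContinuousLinearMap.fst ℝ EL V).hasFDerivAt
  · exact h
  · filter_upwards [𝒯.continuous_proj.continuousAt.eventually_mem
      ((𝒯.isOpen_base _).mem_nhds (𝒯.mem_base (𝒯.proj b)))] with y hy
    rw [extChartAt_coe hB]
    exact ⟨𝒯.base_subset _ hy, by simpa [mfld_simps] using (𝒯.fst_chart _ _ hy).symm⟩

end BundleAtlas

namespace BundleGeometry

variable {V : Type*} [NormedAddCommGroup V] [InnerProductSpace ℝ V] {𝓕 : Set (Set V)}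
  {EL : Type*} [NormedAddCommGroup EL] [NormedSpace ℝ EL]
  {L : Type*} [TopologicalSpace L] [ChartedSpace EL L]
  {B : Type*} [TopologicalSpace B] {𝒯 : BundleAtlas (leafIsometries 𝓕) EL L B}
  (Γ : BundleGeometry 𝒯) [ChartedSpace (EL × V) B]
  {g : Bundle.RiemannianMetric (fun b : B ↦ TangentSpace 𝓘(ℝ, EL × V) b)}
  {gL : Bundle.RiemannianMetric (fun x : L ↦ TangentSpace 𝓘(ℝ, EL) x)}

omit [ChartedSpace (EL × V) B] in
/-- A vector that is orthogonal to the fibre has no vertical part. -/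
theorem vert_eq_zero {i : L} {z u : EL × V}
    (h : ∀ w : EL × V, w.1 = 0 → Γ.totalForm i z u w = 0) : Γ.vert i z u = 0 := by
  have h3 := h (0, Γ.vert i z u) rfl
  rw [totalForm_eq] at h3
  rw [← inner_self_eq_zero (𝕜 := ℝ), ← h3]
  simp [vert_apply]

omit [ChartedSpace (EL × V) B] in
theorem totalForm_eq_form {i : L} {z u : EL × V} (h : Γ.vert i z u = 0) (w : EL × V) :
    Γ.totalForm i z u w = Γ.form i z.1 u.1 w.1 := by
  rw [totalForm_apply, h, inner_zero_left, add_zero]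

/-- The metric of the base is the one induced on the zero section, where the connection is
trivial. -/
theorem inner_mfderiv_zeroSection (hB : ∀ b : B, chartAt (EL × V) b = 𝒯.chart (𝒯.proj b))
    (hg : ∀ (b : B) (u w : EL × V), g.inner b u w =
      Γ.totalForm (𝒯.proj b) (𝒯.chart (𝒯.proj b) b) u w)
    (hgL : ∀ (x : L) (u w : EL), gL.inner x u w = Γ.form x (chartAt EL x x) u w)
    (x : L) (u w : TangentSpace 𝓘(ℝ, EL) x) :
    gL.inner x u w = g.inner (𝒯.zeroSection x)
      (mfderiv 𝓘(ℝ, EL) 𝓘(ℝ, EL × V) 𝒯.zeroSection x u)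
      (mfderiv 𝓘(ℝ, EL) 𝓘(ℝ, EL × V) 𝒯.zeroSection x w) := by
  rw [(BundleAtlas.contMDiffAt_zeroSection hB x).2.mfderiv]
  refine Eq.trans ?_ (hg (𝒯.zeroSection x) ((u : EL), (0 : V)) ((w : EL), (0 : V))).symm
  rw [hgL x u w, 𝒯.proj_zeroSection, 𝒯.chart_zeroSection (𝒯.mem_base x), totalForm_eq]
  simp

/-- A vector orthogonal to the kernel of the projection has vertical part zero, and its length is by
construction that of its projection. -/
theorem isRiemannianSubmersion_proj (hB : ∀ b : B, chartAt (EL × V) b = 𝒯.chart (𝒯.proj b))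
    (hg : ∀ (b : B) (u w : EL × V), g.inner b u w =
      Γ.totalForm (𝒯.proj b) (𝒯.chart (𝒯.proj b) b) u w)
    (hgL : ∀ (x : L) (u w : EL), gL.inner x u w = Γ.form x (chartAt EL x x) u w) :
    IsRiemannianSubmersion g gL 𝒯.proj := by
  have hd : ∀ b : B, mfderiv 𝓘(ℝ, EL × V) 𝓘(ℝ, EL) 𝒯.proj b =
      (ContinuousLinearMap.fst ℝ EL V : EL × V →L[ℝ] EL) := fun b ↦
    (BundleAtlas.contMDiffAt_proj hB b).2.mfderiv
  refine ⟨fun b ↦ (BundleAtlas.contMDiffAt_proj hB b).1, fun b u ↦ ?_, fun b u w hu _ ↦ ?_⟩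
  · rw [hd]
    exact ⟨((u : EL), (0 : V)), rfl⟩
  · rw [hd] at hu ⊢
    have h1 : Γ.vert (𝒯.proj b) (𝒯.chart (𝒯.proj b) b) u = 0 :=
      Γ.vert_eq_zero fun w hw ↦ (hg b u w).symm.trans (hu w hw)
    refine Eq.trans ?_ ((hg b u w).trans (Γ.totalForm_eq_form h1 w)).symm
    rw [𝒯.fst_chart _ _ (𝒯.mem_base _)]
    exact hgL _ _ _

end BundleGeometry

/-! ### The distance to the zero section -/

namespace BundleGeometry

variable {V : Type*} [NormedAddCommGroup V] [InnerProductSpace ℝ V] {𝓕 : Set (Set V)}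
  {EL : Type*} [NormedAddCommGroup EL] [NormedSpace ℝ EL]
  {L : Type*} [TopologicalSpace L] [ChartedSpace EL L]
  {B : Type*} [TopologicalSpace B] {𝒯 : BundleAtlas (leafIsometries 𝓕) EL L B}
  (Γ : BundleGeometry 𝒯)

/-- Locally, a Riemannian metric of the base dominates a multiple of the norm of the coordinate
space. -/
theorem exists_mul_norm_le_sqrt_form [FiniteDimensional ℝ EL] {i : L} {y₀ : EL}
    (hy₀ : y₀ ∈ (chartAt EL i).target) :
    ∃ m > 0, ∀ᶠ y in 𝓝 y₀, ∀ w, m * ‖w‖ ≤ Real.sqrt (Γ.form i y w w) := by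
  have hb := isVonNBounded_of_pos (Γ.form i y₀) (Γ.form_pos i y₀ hy₀)
  rw [NormedSpace.isVonNBounded_iff, isBounded_iff_forall_norm_le] at hb
  obtain ⟨R, hR⟩ := hb
  set C := max R 0 + 1 with hC
  have hC0 : 0 < C := by positivity
  have h1 : ∀ w ∈ Metric.sphere (0 : EL) 1, (2 * C)⁻¹ ^ 2 < Γ.form i y₀ w w := by
    intro w hw
    have hw1 : ‖w‖ = 1 := by simpa using hw
    have h2 : 1 ≤ Γ.form i y₀ (C • w) (C • w) := by
      by_contra! h2
      have h3 := hR _ h2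
      rw [norm_smul, hw1, mul_one, Real.norm_of_nonneg hC0.le] at h3
      linarith [le_max_left R 0]
    simp only [map_smul, smul_apply, smul_eq_mul] at h2
    rw [inv_pow, inv_lt_iff_one_lt_mul₀ (by positivity)]
    nlinarith [sq_nonneg C]
  have h2 : ∀ᶠ y in 𝓝 y₀, ∀ w ∈ Metric.sphere (0 : EL) 1, (2 * C)⁻¹ ^ 2 < Γ.form i y w w := by
    refine (isCompact_sphere (0 : EL) 1).eventually_forall_of_forall_eventually fun w hw ↦ ?_
    have h3 : ContDiffAt ℝ ∞ (fun z : EL × EL ↦ Γ.form i z.1 z.2 z.2) (y₀, w) :=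
      Γ.contDiffAt_form_comp (y := fun z : EL × EL ↦ z.1) (p := (y₀, w)) hy₀ contDiffAt_fst
        contDiffAt_snd contDiffAt_snd
    exact h3.continuousAt.eventually_mem (Ioi_mem_nhds (h1 w hw))
  refine ⟨(2 * C)⁻¹, by positivity, ?_⟩
  filter_upwards [h2] with y hy w
  rcases eq_or_ne w 0 with rfl | hw
  · simp
  have hn : 0 < ‖w‖ := norm_pos_iff.2 hw
  have h3 := hy (‖w‖⁻¹ • w) (by simp [norm_smul, hn.ne'])
  simp only [map_smul, smul_apply, smul_eq_mul] at h3
  refine Real.le_sqrt_of_sq_le ?_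
  rw [mul_pow, ← le_div_iff₀ (by positivity)]
  refine h3.le.trans_eq ?_
  field_simp

/-- A function on the base with gradient of norm at most `1` that separates two points. -/
theorem exists_separating_function [FiniteDimensional ℝ EL] [IsManifold 𝓘(ℝ, EL) ∞ L] [T2Space L]
    {x y : L} (hxy : x ≠ y) :
    ∃ (ψ : L → ℝ) (ψ' : L → EL →L[ℝ] ℝ), ContMDiff 𝓘(ℝ, EL) 𝓘(ℝ, ℝ) ∞ ψ ∧
      (∀ z, HasMFDerivAt 𝓘(ℝ, EL) 𝓘(ℝ, ℝ) ψ z (ψ' z)) ∧ 0 < ψ x ∧ ψ y = 0 ∧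
      ∀ z w, |ψ' z w| ≤ Real.sqrt (Γ.form z (chartAt EL z z) w w) := by
  obtain ⟨m, hm, hev⟩ := Γ.exists_mul_norm_le_sqrt_form (i := x) (mem_chart_target EL x)
  have hU : {z | z ∈ (chartAt EL x).source ∧ z ≠ y ∧
      ∀ w, m * ‖w‖ ≤ Real.sqrt (Γ.form x (chartAt EL x z) w w)} ∈ 𝓝 x := by
    filter_upwards [(chartAt EL x).open_source.mem_nhds (mem_chart_source EL x),
      isOpen_ne.mem_nhds hxy,
      ((chartAt EL x).continuousAt (mem_chart_source EL x)).eventually hev] with z h1 h2 h3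
    exact ⟨h1, h2, h3⟩
  obtain ⟨f, -, hf⟩ := (SmoothBumpFunction.nhds_basis_tsupport (I := 𝓘(ℝ, EL)) x).mem_iff.1 hU
  have hχ : ContDiff ℝ ∞ f.toContDiffBump := f.toContDiffBump.contDiff
  obtain ⟨K, hK⟩ := hχ.lipschitzWith_of_hasCompactSupport f.toContDiffBump.hasCompactSupport
    (by simp)
  set κ : ℝ := (K / m + 1)⁻¹ with hκ
  have hκ0 : 0 < κ := by positivity
  have hψ : ContMDiff 𝓘(ℝ, EL) 𝓘(ℝ, ℝ) ∞ fun z ↦ κ * f z :=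
    contMDiff_const.mul f.contMDiff
  have key : ∀ z, ∃ D : EL →L[ℝ] ℝ, HasMFDerivAt 𝓘(ℝ, EL) 𝓘(ℝ, ℝ) (fun z ↦ κ * f z) z D ∧
      ∀ w, |D w| ≤ Real.sqrt (Γ.form z (chartAt EL z z) w w) := by
    intro z
    by_cases hz : z ∈ tsupport f
    · obtain ⟨hzs, -, hzm⟩ := hf hz
      have hzt := mem_chart_target EL z
      have hzx : (chartAt EL z).symm (chartAt EL z z) = z :=
        (chartAt EL z).left_inv (mem_chart_source EL z)
      have hb := BundleAtlas.contDiffAt_baseChange (i := z) (j := x) hzt (by rwa [hzx])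
      have hbz : BundleAtlas.baseChange z x (chartAt EL z z) = chartAt EL x z := by
        rw [BundleAtlas.baseChange, Function.comp_apply, hzx]
      have h1 : ContDiffAt ℝ ∞ (fun u ↦ κ * f.toContDiffBump (BundleAtlas.baseChange z x u))
          (chartAt EL z z) := contDiffAt_const.mul (hχ.contDiffAt.comp _ hb)
      have h2 : HasFDerivAt (fun u ↦ κ * f.toContDiffBump (BundleAtlas.baseChange z x u))
          (κ • (fderiv ℝ f.toContDiffBump (chartAt EL x z)).comp
            (fderiv ℝ (BundleAtlas.baseChange z x) (chartAt EL z z))) (chartAt EL z z) := by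
        refine HasFDerivAt.const_mul ?_ κ
        refine HasFDerivAt.comp (g := f.toContDiffBump) _ ?_
          (hb.differentiableAt (by simp)).hasFDerivAt
        rw [hbz]
        exact (hχ.differentiable (by simp) _).hasFDerivAt
      refine ⟨_, (contMDiffAt_and_hasMFDerivAt_of_charts (E := EL) (E' := ℝ)
        (f := fun z ↦ κ * f z) (x := z)
        (f' := fun u ↦ κ * f.toContDiffBump (BundleAtlas.baseChange z x u)) ?_
        (by simpa [mfld_simps] using h1)
        (by simpa [mfld_simps] using h2)).2, fun w ↦ ?_⟩
      · filter_upwards [(chartAt EL z).open_source.mem_nhds (mem_chart_source EL z),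
          f.eventuallyEq_of_mem_source hzs] with u hu hfu
        refine ⟨by simp [chartAt_self_eq], ?_⟩
        simp [chartAt_self_eq, mfld_simps, hfu, BundleAtlas.baseChange, (chartAt EL z).left_inv hu]
      · have h3 := Γ.form_compat z x _ hzt (by rwa [hzx]) w w
        rw [hbz] at h3
        set u := fderiv ℝ (BundleAtlas.baseChange z x) (chartAt EL z z) w with hu
        have h4 := hzm u
        rw [h3] at h4
        have h5 : ‖fderiv ℝ f.toContDiffBump (chartAt EL x z) u‖ ≤ K * ‖u‖ :=
          (ContinuousLinearMap.le_opNorm _ _).trans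
            (mul_le_mul_of_nonneg_right (norm_fderiv_le_of_lipschitz ℝ hK) (norm_nonneg _))
        show |κ * fderiv ℝ f.toContDiffBump (chartAt EL x z) u| ≤ _
        rw [abs_mul, abs_of_pos hκ0, ← Real.norm_eq_abs, hκ, inv_mul_le_iff₀ (by positivity)]
        refine h5.trans ?_
        have h6 : ‖u‖ ≤ Real.sqrt (Γ.form z (chartAt EL z z) w w) / m := by
          rw [le_div_iff₀ hm]; linarith
        have h7 := mul_le_mul_of_nonneg_left h6 K.2
        have h8 := Real.sqrt_nonneg (Γ.form z (chartAt EL z z) w w)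
        calc (K : ℝ) * ‖u‖ ≤ K * (Real.sqrt (Γ.form z (chartAt EL z z) w w) / m) := h7
          _ = K / m * Real.sqrt (Γ.form z (chartAt EL z z) w w) := by ring
          _ ≤ _ := by nlinarith
    · refine ⟨0, ?_, fun w ↦ by simp⟩
      have h1 : (fun z ↦ κ * f z) =ᶠ[𝓝 z] fun _ ↦ 0 := by
        filter_upwards [notMem_tsupport_iff_eventuallyEq.1 hz] with u hu
        rw [hu]; simp
      exact (hasMFDerivAt_const (0 : ℝ) z).congr_of_eventuallyEq h1
  choose ψ' h1 h2 using key
  refine ⟨_, ψ', hψ, h1, ?_, ?_, h2⟩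
  · simpa using hκ0
  · have : f y = 0 := image_eq_zero_of_notMem_tsupport fun h ↦ (hf h).2.1 rfl
    simp [this]

variable [ChartedSpace (EL × V) B]
  {g : Bundle.RiemannianMetric (fun b : B ↦ TangentSpace 𝓘(ℝ, EL × V) b)}

/-- The distances in the bundle are at least those of the product of the base with the half-line of
the radii: the function `β ψ - α √(r² + ε²)`, for the distance `r` to the zero section and a
function `ψ` on the base with gradient of norm at most `1`, is Lipschitz if `α² + β² = 1`. -/
theorem ofReal_le_riemannianDist (hB : ∀ b : B, chartAt (EL × V) b = 𝒯.chart (𝒯.proj b))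
    (hg : ∀ (b : B) (u w : EL × V), g.inner b u w =
      Γ.totalForm (𝒯.proj b) (𝒯.chart (𝒯.proj b) b) u w)
    {ψ : L → ℝ} {ψ' : L → EL →L[ℝ] ℝ} (hψ : ContMDiff 𝓘(ℝ, EL) 𝓘(ℝ, ℝ) ∞ ψ)
    (hψ' : ∀ z, HasMFDerivAt 𝓘(ℝ, EL) 𝓘(ℝ, ℝ) ψ z (ψ' z))
    (hle : ∀ z w, |ψ' z w| ≤ Real.sqrt (Γ.form z (chartAt EL z z) w w))
    {α β ε : ℝ} (hα : 0 ≤ α) (hβ : 0 ≤ β) (hαβ : α ^ 2 + β ^ 2 = 1) (hε : 0 < ε) (b b' : B) :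
    ENNReal.ofReal
      ((β * ψ (𝒯.proj b') - α * Real.sqrt (‖(𝒯.chart (𝒯.proj b') b').2‖ ^ 2 + ε ^ 2)) -
        (β * ψ (𝒯.proj b) - α * Real.sqrt (‖(𝒯.chart (𝒯.proj b) b).2‖ ^ 2 + ε ^ 2))) ≤
      riemannianDist g b b' := by
  set F : B → ℝ := fun b ↦
    β * ψ (𝒯.proj b) - α * Real.sqrt (‖(𝒯.chart (𝒯.proj b) b).2‖ ^ 2 + ε ^ 2) with hF
  have hpos : ∀ v : V, 0 < ‖v‖ ^ 2 + ε ^ 2 := fun v ↦ by positivity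
  have key : ∀ b, ∃ D : EL × V →L[ℝ] ℝ, ContMDiffAt 𝓘(ℝ, EL × V) 𝓘(ℝ, ℝ) ∞ F b ∧
      HasMFDerivAt 𝓘(ℝ, EL × V) 𝓘(ℝ, ℝ) F b D ∧
      ∀ w : EL × V, D w ≤ Real.sqrt (g.inner b w w) := by
    intro b
    set i := 𝒯.proj b with hi
    set z := 𝒯.chart i b with hz
    have hz1 : z.1 = chartAt EL i i := 𝒯.fst_chart i b (𝒯.mem_base i)
    set ρ := Real.sqrt (‖z.2‖ ^ 2 + ε ^ 2) with hρ
    have hρ0 : 0 < ρ := Real.sqrt_pos.2 (hpos _)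
    -- the expression of `F` in the chart
    have h1 : ContDiffAt ℝ ∞ (fun y ↦ ψ ((chartAt EL i).symm y)) z.1 := by
      have := (contMDiffAt_iff.1 (hψ.contMDiffAt (x := i))).2
      rw [hz1]
      simpa [chartAt_self_eq, mfld_simps, contDiffWithinAt_univ, Function.comp_def] using this
    have h2 : HasFDerivAt (fun y ↦ ψ ((chartAt EL i).symm y)) (ψ' i) z.1 := by
      rw [hz1]
      exact (hψ' i).2.hasFDerivAt (by simp)
    have h3 : ContDiffAt ℝ ∞ (fun y : EL × V ↦ β * ψ ((chartAt EL i).symm y.1) -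
        α * Real.sqrt (‖y.2‖ ^ 2 + ε ^ 2)) z := by
      refine (contDiffAt_const.mul (h1.comp z contDiffAt_fst)).sub (contDiffAt_const.mul ?_)
      exact (((contDiff_norm_sq ℝ).contDiffAt.comp z contDiffAt_snd).add contDiffAt_const).sqrt
        (hpos z.2).ne'
    have h4 : HasFDerivAt (fun y : EL × V ↦ β * ψ ((chartAt EL i).symm y.1) -
        α * Real.sqrt (‖y.2‖ ^ 2 + ε ^ 2))
        (β • (ψ' i).comp (ContinuousLinearMap.fst ℝ EL V) -
          α • ((1 / (2 * ρ)) • (2 • (innerSL ℝ z.2).comp (ContinuousLinearMap.snd ℝ EL V)))) z := by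
      refine ((h2.comp z hasFDerivAt_fst).const_mul β).sub (HasFDerivAt.const_mul ?_ α)
      exact ((hasFDerivAt_snd.norm_sq).add_const (ε ^ 2)).sqrt (hpos z.2).ne'
    obtain ⟨h5, h6⟩ := contMDiffAt_and_hasMFDerivAt_of_charts (E := EL × V) (E' := ℝ) (f := F)
      (x := b) (f' := fun y : EL × V ↦ β * ψ ((chartAt EL i).symm y.1) -
        α * Real.sqrt (‖y.2‖ ^ 2 + ε ^ 2)) (by
          filter_upwards [𝒯.continuous_proj.continuousAt.eventually_mem
            ((𝒯.isOpen_base _).mem_nhds (𝒯.mem_base i))] with c hc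
          refine ⟨by simp [chartAt_self_eq], ?_⟩
          rw [BundleAtlas.extChartAt_coe hB, 𝒯.fst_chart i c hc,
            (chartAt EL i).left_inv (𝒯.base_subset i hc),
            𝒯.snd_chart (𝒯.proj c) i c (𝒯.mem_base _) hc, LinearIsometryEquiv.norm_map]
          simp [chartAt_self_eq, hF])
      (by rw [BundleAtlas.extChartAt_coe hB]; exact h3)
      (by rw [BundleAtlas.extChartAt_coe hB]; exact h4)
    refine ⟨_, h5, h6, fun w ↦ ?_⟩
    have hd : z.1 ∈ 𝒯.dom i := 𝒯.chart_fst_mem_dom (𝒯.mem_base i)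
    rw [hg b w w, totalForm_apply, real_inner_self_eq_norm_sq]
    -- the connection is isometric, so the radial derivative only sees the vertical part
    have h7 : inner ℝ z.2 w.2 = inner ℝ z.2 (Γ.vert i z w) := by
      rw [vert_apply, inner_add_right, real_inner_comm (Γ.conn i z.1 w.1 z.2) z.2,
        Γ.inner_conn i _ hd, add_zero]
    have h8 : |inner ℝ z.2 (Γ.vert i z w)| ≤ ρ * ‖Γ.vert i z w‖ := by
      refine (abs_real_inner_le_norm _ _).trans (mul_le_mul_of_nonneg_right ?_ (norm_nonneg _))
      exact Real.le_sqrt_of_sq_le (by nlinarith)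
    have h9 : -(inner ℝ z.2 (Γ.vert i z w) / ρ) ≤ ‖Γ.vert i z w‖ := by
      rw [← neg_div, div_le_iff₀ hρ0]
      linarith [(abs_le.1 h8).1]
    have h10 := (abs_le.1 (hle i w.1)).2
    rw [← hz1] at h10
    set p := Real.sqrt (Γ.form i z.1 w.1 w.1) with hp
    set q := ‖Γ.vert i z w‖ with hq
    have hp2 : p ^ 2 = Γ.form i z.1 w.1 w.1 := Real.sq_sqrt (Γ.form_nonneg hd.1 _)
    rw [← hp2]
    have h11 : (β • (ψ' i).comp (ContinuousLinearMap.fst ℝ EL V) -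
        α • ((1 / (2 * ρ)) • (2 • (innerSL ℝ z.2).comp (ContinuousLinearMap.snd ℝ EL V)))) w =
        β * ψ' i w.1 + α * -(inner ℝ z.2 (Γ.vert i z w) / ρ) := by
      rw [← h7]
      simp
      field_simp
      ring
    rw [h11]
    refine Real.le_sqrt_of_sq_le ?_ |>.trans' ?_ (b := β * p + α * q)
    · nlinarith [sq_nonneg (α * p - β * q)]
    · exact add_le_add (mul_le_mul_of_nonneg_left h10 hβ) (mul_le_mul_of_nonneg_left h9 hα)
  choose F' h1 h2 h3 using key
  exact ofReal_sub_le_riemannianDist g (fun b ↦ (h1 b).of_le (by simp)) h2 h3 b b'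

/-- The straight segment in a fibre from a point to the zero section bounds the distance. -/
theorem riemannianDist_zeroSection_le [IsManifold 𝓘(ℝ, EL × V) ∞ B]
    (hB : ∀ b : B, chartAt (EL × V) b = 𝒯.chart (𝒯.proj b))
    (hg : ∀ (b : B) (u w : EL × V), g.inner b u w =
      Γ.totalForm (𝒯.proj b) (𝒯.chart (𝒯.proj b) b) u w) (b : B) :
    riemannianDist g b (𝒯.zeroSection (𝒯.proj b)) ≤
      ENNReal.ofReal ‖(𝒯.chart (𝒯.proj b) b).2‖ := by
  set i := 𝒯.proj b with hi
  set z := 𝒯.chart i b with hz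
  have hd : z.1 ∈ 𝒯.dom i := 𝒯.chart_fst_mem_dom (𝒯.mem_base i)
  have hz1 : z.1 = chartAt EL i i := 𝒯.fst_chart i b (𝒯.mem_base i)
  set γ : ℝ → B := fun t ↦ (𝒯.chart i).symm (z.1, (1 - t) • z.2) with hγ
  have hproj : ∀ t, 𝒯.proj (γ t) = i := fun t ↦ by
    rw [hγ, hz1]
    exact 𝒯.proj_symm_chartAt (𝒯.mem_base i) _
  have h0 : γ 0 = b := by
    simp only [hγ, sub_zero, one_smul]
    exact 𝒯.symm_chart_apply (𝒯.mem_base i)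
  have h1 : γ 1 = 𝒯.zeroSection i := by
    simp only [hγ, sub_self, zero_smul, hz1]
    rfl
  have hsm : ContMDiff 𝓘(ℝ, ℝ) 𝓘(ℝ, EL × V) ∞ γ := by
    intro t
    have h2 := contMDiffAt_extChartAt_symm (E := EL × V) b (y := (z.1, (1 - t) • z.2))
      ((BundleAtlas.mem_extChartAt_target hB).2 hd)
    rw [BundleAtlas.extChartAt_symm_coe hB] at h2
    refine h2.comp t (ContDiffAt.contMDiffAt ?_)
    fun_prop
  have h2 := riemannianDist_le_of_curve g (hsm.of_le (by simp)) (r := ‖z.2‖) fun t ↦ ?_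
  · rwa [h0, h1] at h2
  have hline : HasDerivAt (fun s : ℝ ↦ (z.1, (1 - s) • z.2)) ((0 : EL), -z.2) t := by
    refine (hasDerivAt_const t z.1).prodMk ?_
    simpa using ((hasDerivAt_id t).const_sub 1).smul_const z.2
  have h3 : (mfderiv 𝓘(ℝ, ℝ) 𝓘(ℝ, EL × V) γ t (1 : ℝ) : EL × V) = ((0 : EL), -z.2) := by
    refine (mfderiv_curve_eq (E := EL × V) (hsm.mdifferentiableAt (by simp))).trans ?_
    rw [BundleAtlas.extChartAt_coe hB, hproj]
    have h4 : (fun s ↦ 𝒯.chart i (γ s)) = fun s : ℝ ↦ (z.1, (1 - s) • z.2) := by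
      ext1 s
      exact 𝒯.chart_symm_apply (z := (z.1, (1 - s) • z.2)) hd
    rw [h4]
    exact hline.deriv
  have h4 : g.inner (γ t) (mfderiv 𝓘(ℝ, ℝ) 𝓘(ℝ, EL × V) γ t (1 : ℝ))
      (mfderiv 𝓘(ℝ, ℝ) 𝓘(ℝ, EL × V) γ t (1 : ℝ)) = ‖z.2‖ ^ 2 := by
    refine (hg (γ t) (mfderiv 𝓘(ℝ, ℝ) 𝓘(ℝ, EL × V) γ t (1 : ℝ))
      (mfderiv 𝓘(ℝ, ℝ) 𝓘(ℝ, EL × V) γ t (1 : ℝ))).trans ?_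
    rw [h3, totalForm_eq]
    simp
  rw [h4, Real.sqrt_sq (norm_nonneg _)]

/-- The bundle projection is the nearest point projection onto the zero section. -/
theorem riemannianDist_zeroSection_lt [FiniteDimensional ℝ EL] [IsManifold 𝓘(ℝ, EL) ∞ L]
    [T2Space L] [IsManifold 𝓘(ℝ, EL × V) ∞ B]
    (hB : ∀ b : B, chartAt (EL × V) b = 𝒯.chart (𝒯.proj b))
    (hg : ∀ (b : B) (u w : EL × V), g.inner b u w =
      Γ.totalForm (𝒯.proj b) (𝒯.chart (𝒯.proj b) b) u w) (b : B) {x : L} (hx : x ≠ 𝒯.proj b) :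
    riemannianDist g b (𝒯.zeroSection (𝒯.proj b)) < riemannianDist g b (𝒯.zeroSection x) := by
  obtain ⟨ψ, ψ', hψ, hψ', hpos, h0, hle⟩ := Γ.exists_separating_function hx
  refine (Γ.riemannianDist_zeroSection_le hB hg b).trans_lt ?_
  set r := ‖(𝒯.chart (𝒯.proj b) b).2‖ with hr
  have hr0 : 0 ≤ r := norm_nonneg _
  set δ := ψ x with hδ
  -- the direction of the segment from `(0, r)` to `(δ, 0)` in the plane
  set R := Real.sqrt (r ^ 2 + δ ^ 2) with hR
  have hR0 : 0 < R := Real.sqrt_pos.2 (by positivity)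
  have hR2 : R ^ 2 = r ^ 2 + δ ^ 2 := Real.sq_sqrt (by positivity)
  have hrR : r < R := Real.lt_sqrt_of_sq_lt (by nlinarith)
  set ε := (R - r) / 2 with hε
  have hε0 : 0 < ε := by rw [hε]; linarith
  have h1 := Γ.ofReal_le_riemannianDist hB hg hψ hψ' hle (α := r / R) (β := δ / R) (ε := ε)
    (by positivity) (by positivity) (by field_simp; linarith) hε0 b (𝒯.zeroSection x)
  refine lt_of_lt_of_le ?_ h1
  rw [𝒯.proj_zeroSection, 𝒯.chart_zeroSection (𝒯.mem_base x), h0, norm_zero,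
    ENNReal.ofReal_lt_ofReal_iff_of_nonneg hr0]
  have h2 : Real.sqrt (0 ^ 2 + ε ^ 2) = ε := by
    rw [zero_pow two_ne_zero, zero_add, Real.sqrt_sq hε0.le]
  have h3 : r ≤ Real.sqrt (r ^ 2 + ε ^ 2) := Real.le_sqrt_of_sq_le (by nlinarith)
  have h4 : r / R ≤ 1 := (div_le_one hR0).2 hrR.le
  have h5 : 0 ≤ r / R := by positivity
  have h6 : δ / R * δ + r / R * r = R := by field_simp; linarith
  rw [h2]
  nlinarith

end BundleGeometry

end SliceConverse

end

theorem mainTheorem7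
    -- the Euclidean space `V` and the disconnected infinitesimal foliation `𝓕`
    {V : Type*} [NormedAddCommGroup V] [InnerProductSpace ℝ V] [FiniteDimensional ℝ V]
    (𝓕 : Set (Set V)) (h𝓕 : SliceConverse.IsDisconnectedInfinitesimalFoliation 𝓕)
    -- the connected manifold `L`
    {EL : Type*} [NormedAddCommGroup EL] [NormedSpace ℝ EL] [FiniteDimensional ℝ EL]
    {L : Type*} [TopologicalSpace L] [ChartedSpace EL L] [IsManifold 𝓘(ℝ, EL) ∞ L]
    [T2Space L] [SecondCountableTopology L] [ConnectedSpace L]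
    -- the Lie group `O(𝓕)`
    {EG : Type*} [NormedAddCommGroup EG] [NormedSpace ℝ EG] [FiniteDimensional ℝ EG]
    [TopologicalSpace (SliceConverse.leafIsometries 𝓕)]
    [ChartedSpace EG (SliceConverse.leafIsometries 𝓕)]
    (hG : SliceConverse.IsLieSubgroupStructure (EG := EG) (SliceConverse.leafIsometries 𝓕))
    -- the principal `O(𝓕)`-bundle `P` over `L`
    {EP : Type*} [NormedAddCommGroup EP] [NormedSpace ℝ EP] [FiniteDimensional ℝ EP]
    {P : Type*} [TopologicalSpace P] [ChartedSpace EP P] [IsManifold 𝓘(ℝ, EP) ∞ P]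
    [MulAction (MulOpposite (SliceConverse.leafIsometries 𝓕)) P]
    (pr : P → L)
    (hP : SliceConverse.IsPrincipalBundle (EL := EL) (EP := EP) EG
      (SliceConverse.leafIsometries 𝓕) pr)
    -- the image of `π₁(L)` in `π₀(O(𝓕))` is transitive on the components of each leaf of `𝓕`
    (p₀ : P)
    (hH : ∀ S ∈ 𝓕, ∀ x ∈ S, ∀ y ∈ S, ∃ g : SliceConverse.leafIsometries 𝓕,
      (Quotient.mk (pathSetoid _) g : ZerothHomotopy (SliceConverse.leafIsometries 𝓕)) ∈
        SliceConverse.monodromyImage pr p₀ ∧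
      JoinedIn S ((g : V ≃ₗᵢ[ℝ] V) x) y) :
    -- the smooth manifold structure of `P ×_{O(𝓕)} V` (the one for which the quotient map from
    -- `P × V` is a submersion)
    ∃ (_ : ChartedSpace (EL × V) (SliceConverse.AssocBundle (SliceConverse.leafIsometries 𝓕) P))
      (_ : IsManifold 𝓘(ℝ, EL × V) ∞
        (SliceConverse.AssocBundle (SliceConverse.leafIsometries 𝓕) P)),
      T2Space (SliceConverse.AssocBundle (SliceConverse.leafIsometries 𝓕) P) ∧
      SecondCountableTopology (SliceConverse.AssocBundle (SliceConverse.leafIsometries 𝓕) P) ∧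
      ContMDiff (𝓘(ℝ, EP).prod 𝓘(ℝ, V)) 𝓘(ℝ, EL × V) ∞
        (SliceConverse.AssocBundle.mk (P := P) (SliceConverse.leafIsometries 𝓕)) ∧
      (∀ a : P × V, Function.Surjective (mfderiv (𝓘(ℝ, EP).prod 𝓘(ℝ, V)) 𝓘(ℝ, EL × V)
        (SliceConverse.AssocBundle.mk (P := P) (SliceConverse.leafIsometries 𝓕)) a)) ∧
      -- the metric on it, the induced metric on `L`, and the zero section
      ∃ (g : Bundle.ContMDiffRiemannianMetric 𝓘(ℝ, EL × V) ∞ (EL × V)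
          (fun e : SliceConverse.AssocBundle (SliceConverse.leafIsometries 𝓕) P ↦
            TangentSpace 𝓘(ℝ, EL × V) e))
        (gL : Bundle.ContMDiffRiemannianMetric 𝓘(ℝ, EL) ∞ EL
          (fun x : L ↦ TangentSpace 𝓘(ℝ, EL) x))
        (s : L → SliceConverse.AssocBundle (SliceConverse.leafIsometries 𝓕) P),
        SliceConverse.IsSingularRiemannianFoliation g.toRiemannianMetric
          (SliceConverse.assocFoliation (P := P) (SliceConverse.leafIsometries 𝓕)
            (SliceConverse.connectedLeaves 𝓕)) ∧
        (∀ p : P, s (pr p) =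
          SliceConverse.AssocBundle.mk (SliceConverse.leafIsometries 𝓕) (p, (0 : V))) ∧
        ContMDiff 𝓘(ℝ, EL) 𝓘(ℝ, EL × V) ∞ s ∧
        (∀ (x : L) (u w : TangentSpace 𝓘(ℝ, EL) x), gL.inner x u w =
          g.inner (s x) (mfderiv 𝓘(ℝ, EL) 𝓘(ℝ, EL × V) s x u)
            (mfderiv 𝓘(ℝ, EL) 𝓘(ℝ, EL × V) s x w)) ∧
        -- the bundle projection is the nearest point projection onto the zero section
        (∀ (e : SliceConverse.AssocBundle (SliceConverse.leafIsometries 𝓕) P) (x : L),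
          x ≠ SliceConverse.AssocBundle.proj pr hP.proj_action e →
          SliceConverse.riemannianDist g.toRiemannianMetric e
              (s (SliceConverse.AssocBundle.proj pr hP.proj_action e)) <
            SliceConverse.riemannianDist g.toRiemannianMetric e (s x)) ∧
        SliceConverse.IsRiemannianSubmersion g.toRiemannianMetric gL.toRiemannianMetric
          (SliceConverse.AssocBundle.proj pr hP.proj_action) := by
  set 𝒯 := hP.bundleAtlas hG with h𝒯
  let _ : ChartedSpace (EL × V) (SliceConverse.AssocBundle (SliceConverse.leafIsometries 𝓕) P) :=
    𝒯.chartedSpace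
  have hM : IsManifold 𝓘(ℝ, EL × V) ∞
    (SliceConverse.AssocBundle (SliceConverse.leafIsometries 𝓕) P) := 𝒯.isManifold
  have hT2 : T2Space (SliceConverse.AssocBundle (SliceConverse.leafIsometries 𝓕) P) := 𝒯.t2Space
  have hB : ∀ b : SliceConverse.AssocBundle (SliceConverse.leafIsometries 𝓕) P,
    chartAt (EL × V) b = 𝒯.chart (𝒯.proj b) := fun _ ↦ rfl
  obtain ⟨Γ⟩ := 𝒯.exists_bundleGeometry
  obtain ⟨g, hg, hg'⟩ := Γ.exists_totalMetric hB
  obtain ⟨gL, hgL⟩ := Γ.exists_baseMetric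
  have hgp := h𝓕.isPartition
  refine ⟨inferInstance, hM, hT2, 𝒯.secondCountableTopology, hP.contMDiff_mk hG hB,
    hP.surjective_mfderiv_mk hG hB, g, gL, 𝒯.zeroSection, ?_, fun p ↦ ?_,
    fun x ↦ (SliceConverse.BundleAtlas.contMDiffAt_zeroSection hB x).1,
    Γ.inner_mfderiv_zeroSection (g := g.toRiemannianMetric) (gL := gL.toRiemannianMetric) hB hg hgL,
    fun e x hx ↦ Γ.riemannianDist_zeroSection_lt hB hg e hx,
    Γ.isRiemannianSubmersion_proj hB hg hgL⟩
  · rw [hP.assocFoliation_eq hG hgp hH]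
    refine ⟨𝒯.isPartition_leaf hgp, ?_, ?_, ?_⟩
    · rintro _ ⟨S, hS, rfl⟩
      exact SliceConverse.BundleAtlas.isConnectedImmersedSubmanifold_leaf hB h𝓕 hS
        (hP.isPathConnected_leaf hG hgp hH hS)
    · rintro _ ⟨S, hS, rfl⟩ b hb w hw
      exact SliceConverse.BundleAtlas.exists_isVertical hB h𝓕 hS hb w hw
    · rintro γ J hJ hJc hγ ⟨t₀, ht₀, h0⟩ t ht
      exact Γ.isOrthogonalAt_of_isGeodesicOn h𝓕 hB hg hg' hJ hJc hγ ht₀ h0 ht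
  · have h1 := 𝒯.eq_zeroSection
      (b := SliceConverse.AssocBundle.mk (SliceConverse.leafIsometries 𝓕) (p, (0 : V)))
      (𝒯.mem_base _) ?_
    · exact h1.symm
    · have h2 : (𝒯.chart (pr p) (SliceConverse.AssocBundle.mk (SliceConverse.leafIsometries 𝓕)
          (p, (0 : V)))).2 = ((hP.triv (pr p) p).2 : V ≃ₗᵢ[ℝ] V) 0 :=
        hP.fibreCoord_mk (hP.mem_trivBase _) 0
      exact h2.trans (map_zero _)
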